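/- **Theorem.** Let $\Omega\subseteq\mathbb{R}^d$ ($d\ge1$) be a bounded open set (for instance a bounded Lipschitz domain), let $T>0$, $0<\alpha<1$, $\eta>0$, and let $\omega_\alpha(t)=t^{\alpha-1}/\Gamma(\alpha)$. Write $\langle\cdot,\cdot\rangle$ and $\|\cdot\|$ for the inner product and norm of the real spaces $L_2(\Omega)$ and $L_2(\Omega)^d$. Suppose that the coefficients satisfy $$\kappa\in L_\infty(\Omega)^{d\times d},\qquad \vec F,\vec G\in C^2\bigl([0,T];W^1_\infty(\Omega)^d\bigr),\qquad a,b\in C^1\bigl([0,T];L_\infty(\Omega)\bigr),$$ where $\kappa=\kappa(x)$ is real and symmetric, and its smallest eigenvalue is bounded below by a positive constant, uniformly for (almost every) $x\in\Omega$. For $0\le s\le t\le T$ define $K(t,s):H^1_0(\Omega)\to H^{-1}(\Omega)$ by $$K(t,s)=\omega_\alpha(t-s)K_1(t)+K_2(s)-\int_s^t\omega_\alpha(z-s)K_1'(z)\,dz,$$ where, for $v,w\in H^1_0(\Omega)$, $$\langle K_1(t)v,w\rangle=\langle\kappa\nabla v,\nabla w\rangle-\langle\vec F(t)v,\nabla w\rangle+\langle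 a(t)v,w\rangle,\qquad \langle K_2(t)v,w\rangle=\langle b(t)v,w\rangle-\langle\vec G(t)v,\nabla w\rangle,$$ $$\langle K_1'(t)v,w\rangle=-\langle\vec F'(t)v,\nabla w\rangle+\langle a'(t)v,w\rangle .$$ Then there is a constant $C$, depending only on $\Omega$, $T$, $\alpha$, $\eta$ and the coefficients $\kappa,\vec F,\vec G,a,b$, such that the following holds. Let $M>0$, let $u_0\in L_2(\Omega)$, let $g:(0,T]\to L_2(\Omega)$ be measurable with $\|g(t)\|\le Mt^{\eta-1}$ for $0<t\le T$, and put $f(t)=u_0+\int_0^tg(s)\,ds$. Let $X$ be any finite-dimensional subspace of $H^1_0(\Omega)$, define $K_X(t,s):X\to X$ and $f_X(t)\in X$ by $$\langle K_X(t,s)v,w\rangle=\langle K(t,s)v,w\rangle\quad\text{and}\quad\langle f_X(t),w\rangle=\langle f(t),w\rangle\qquad\text{for all }v,w\in X,$$ and let $u_X\in C([0,T];X)$ be the solution of the projected Volterra equation $$u_X(t)+\int_0^tK_X(t,s)u_X(s)\,ds=f_X(t)\qquad\text{for }0\le t\le T.$$ Then $$\|u_X(t)\|^2+t^\alpha\|\nabla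 u_X(t)\|^2\le C\bigl(\|u_0\|^2+M^2t^{2\eta}\bigr)\qquad\text{for }0\le t\le T.$$ In particular, $C$ is independent of $X$ (and of $u_0$, $g$, $M$). -/

import Mathlib

open MeasureTheory Set
open scoped ENNReal Distributions

noncomputable section

namespace FracADR

/-! ### Function spaces on an open set `Ω ⊆ ℝᵈ` -/

/-- The space `ℝᵈ` with its Euclidean norm. -/
abbrev Rd (d : ℕ) : Type := EuclideanSpace ℝ (Fin d)

variable {d : ℕ}

/-- Lebesgue measure on `Ω`. -/
abbrev vol (Ω : TopologicalSpace.Opens (Rd d)) : Measure (Rd d) :=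
  (volume : Measure (Rd d)).restrict (Ω : Set (Rd d))

/-- The space `L₂(Ω)` of real-valued functions. -/
abbrev L2 (Ω : TopologicalSpace.Opens (Rd d)) : Type := Lp ℝ 2 (vol Ω)

/-- The space `L₂(Ω)ᵈ`. -/
abbrev L2vec (Ω : TopologicalSpace.Opens (Rd d)) : Type := Lp (Rd d) 2 (vol Ω)

/-- The space `L∞(Ω)`. -/
abbrev Linf (Ω : TopologicalSpace.Opens (Rd d)) : Type := Lp ℝ ∞ (vol Ω)

/-- The space `L∞(Ω)ᵈ`. -/
abbrev LinfVec (Ω : TopologicalSpace.Opens (Rd d)) : Type := Lp (Rd d) ∞ (vol Ω)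

/-- The space `L∞(Ω)^{d×d}`; a `d × d` matrix is identified with the linear map on `ℝᵈ` that it
represents in the standard basis. -/
abbrev LinfMat (Ω : TopologicalSpace.Opens (Rd d)) : Type := Lp (Rd d →L[ℝ] Rd d) ∞ (vol Ω)

/-- `G` is the weak gradient of `v` on `Ω`:
`∫_Ω v ∂_y φ = - ∫_Ω φ (G · y)` for all `φ ∈ C_c^∞(Ω)` and all directions `y`. -/
def HasWeakGradient (Ω : TopologicalSpace.Opens (Rd d)) (v : Rd d → ℝ) (G : Rd d → Rd d) : Prop :=
  ∀ (φ : 𝓓(Ω, ℝ)) (y : Rd d),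
    ∫ x, fderiv ℝ φ x y * v x ∂(vol Ω) = -∫ x, φ x * inner ℝ (G x) y ∂(vol Ω)

/-- `D` is the weak Jacobian of the vector field `F` on `Ω`:
`∫_Ω (∂_y φ) F = - ∫_Ω φ (D y)` for all `φ ∈ C_c^∞(Ω)` and all directions `y`. -/
def HasWeakJacobian (Ω : TopologicalSpace.Opens (Rd d)) (F : Rd d → Rd d)
    (D : Rd d → (Rd d →L[ℝ] Rd d)) : Prop :=
  ∀ (φ : 𝓓(Ω, ℝ)) (y : Rd d),
    ∫ x, fderiv ℝ φ x y • F x ∂(vol Ω) = -∫ x, φ x • D x y ∂(vol Ω)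

theorem integrable_test_smul {V : Type*} [NormedAddCommGroup V] [NormedSpace ℝ V]
    {Ω : TopologicalSpace.Opens (Rd d)} (φ : 𝓓(Ω, ℝ)) {p : ℝ≥0∞} (hp : 1 ≤ p) {v : Rd d → V}
    (hv : MemLp v p (vol Ω)) : Integrable (fun x => φ x • v x) (vol Ω) :=
  (hv.locallyIntegrable hp).integrable_smul_left_of_hasCompactSupport φ.continuous
    φ.hasCompactSupport

theorem integrable_fderiv_test_smul {V : Type*} [NormedAddCommGroup V] [NormedSpace ℝ V]
    {Ω : TopologicalSpace.Opens (Rd d)} (φ : 𝓓(Ω, ℝ)) (y : Rd d) {p : ℝ≥0∞} (hp : 1 ≤ p)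
    {v : Rd d → V} (hv : MemLp v p (vol Ω)) :
    Integrable (fun x => fderiv ℝ φ x y • v x) (vol Ω) := by
  refine (hv.locallyIntegrable hp).integrable_smul_left_of_hasCompactSupport ?_ ?_
  · exact (φ.contDiff.continuous_fderiv (by simp)).clm_apply continuous_const
  · exact φ.hasCompactSupport.fderiv_apply (𝕜 := ℝ) y

/-- The Sobolev space `H¹(Ω)`, as the space of pairs `(v, ∇v)` of an `L₂` function and its weak
gradient in `L₂`, with `‖(v, ∇v)‖² = ‖v‖² + ‖∇v‖²`. -/
def H1 (Ω : TopologicalSpace.Opens (Rd d)) : Submodule ℝ (WithLp 2 (L2 Ω × L2vec Ω)) where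
  carrier := {p | HasWeakGradient Ω p.fst p.snd}
  zero_mem' := by
    intro φ y
    have h1 : (fun x => fderiv ℝ φ x y * (0 : L2 Ω) x) =ᵐ[vol Ω] fun _ => 0 := by
      filter_upwards [Lp.coeFn_zero ℝ 2 (vol Ω)] with x hx
      rw [hx]
      simp
    have h2 : (fun x => φ x * inner ℝ ((0 : L2vec Ω) x) y) =ᵐ[vol Ω] fun _ => 0 := by
      filter_upwards [Lp.coeFn_zero (Rd d) 2 (vol Ω)] with x hx
      rw [hx]
      simp
    simp only [WithLp.zero_fst, WithLp.zero_snd]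
    rw [integral_congr_ae h1, integral_congr_ae h2]
    simp
  add_mem' := by
    intro p q hp hq φ y
    have h1 : (fun x => fderiv ℝ φ x y * (p.fst + q.fst) x) =ᵐ[vol Ω]
        fun x => fderiv ℝ φ x y * p.fst x + fderiv ℝ φ x y * q.fst x := by
      filter_upwards [Lp.coeFn_add p.fst q.fst] with x hx
      rw [hx]
      simp [mul_add]
    have h2 : (fun x => φ x * inner ℝ ((p.snd + q.snd) x) y) =ᵐ[vol Ω]
        fun x => φ x * inner ℝ (p.snd x) y + φ x * inner ℝ (q.snd x) y := by
      filter_upwards [Lp.coeFn_add p.snd q.snd] with x hx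
      rw [hx]
      simp [mul_add, inner_add_left]
    simp only [WithLp.add_fst, WithLp.add_snd]
    rw [integral_congr_ae h1, integral_congr_ae h2, integral_add, integral_add, hp φ y, hq φ y]
    · ring
    · exact integrable_test_smul φ one_le_two ((Lp.memLp p.snd).inner_const y)
    · exact integrable_test_smul φ one_le_two ((Lp.memLp q.snd).inner_const y)
    · exact integrable_fderiv_test_smul φ y one_le_two (Lp.memLp p.fst)
    · exact integrable_fderiv_test_smul φ y one_le_two (Lp.memLp q.fst)
  smul_mem' := by
    intro c p hp φ y
    have h1 : (fun x => fderiv ℝ φ x y * (c • p.fst) x) =ᵐ[vol Ω]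
        fun x => c * (fderiv ℝ φ x y * p.fst x) := by
      filter_upwards [Lp.coeFn_smul c p.fst] with x hx
      simp only [hx, Pi.smul_apply, smul_eq_mul]
      ring
    have h2 : (fun x => φ x * inner ℝ ((c • p.snd) x) y) =ᵐ[vol Ω]
        fun x => c * (φ x * inner ℝ (p.snd x) y) := by
      filter_upwards [Lp.coeFn_smul c p.snd] with x hx
      simp only [hx, Pi.smul_apply, real_inner_smul_left]
      ring
    simp only [WithLp.smul_fst, WithLp.smul_snd]
    rw [integral_congr_ae h1, integral_congr_ae h2, integral_const_mul, integral_const_mul, hp φ y]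
    ring

/-- The pairs `(φ, ∇φ)` with `φ ∈ C_c^∞(Ω)`. -/
def testPairs (Ω : TopologicalSpace.Opens (Rd d)) : Set (WithLp 2 (L2 Ω × L2vec Ω)) :=
  {p | ∃ φ : 𝓓(Ω, ℝ), p.fst =ᵐ[vol Ω] φ ∧ p.snd =ᵐ[vol Ω] gradient φ}

/-- The subspace `H¹₀(Ω)` of `H¹(Ω)`: the closure of `C_c^∞(Ω)` in `H¹(Ω)`. -/
def H10sub (Ω : TopologicalSpace.Opens (Rd d)) : Submodule ℝ (WithLp 2 (L2 Ω × L2vec Ω)) :=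
  H1 Ω ⊓ (Submodule.span ℝ (testPairs Ω)).topologicalClosure

/-- The Sobolev space `H¹₀(Ω)`, with the norm of `H¹(Ω)`. -/
def H10 (Ω : TopologicalSpace.Opens (Rd d)) : Type := H10sub Ω

instance (Ω : TopologicalSpace.Opens (Rd d)) : NormedAddCommGroup (H10 Ω) :=
  inferInstanceAs (NormedAddCommGroup (H10sub Ω))

instance (Ω : TopologicalSpace.Opens (Rd d)) : InnerProductSpace ℝ (H10 Ω) :=
  inferInstanceAs (InnerProductSpace ℝ (H10sub Ω))

/-- The inclusion of `H¹₀(Ω)` into `L₂(Ω) × L₂(Ω)ᵈ`, `v ↦ (v, ∇v)`. -/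
def H10incl (Ω : TopologicalSpace.Opens (Rd d)) : H10 Ω →L[ℝ] WithLp 2 (L2 Ω × L2vec Ω) :=
  (H10sub Ω).subtypeL

/-- The inclusion `H¹₀(Ω) → L₂(Ω)`. -/
def toL2 (Ω : TopologicalSpace.Opens (Rd d)) : H10 Ω →L[ℝ] L2 Ω :=
  WithLp.fstL 2 ℝ (L2 Ω) (L2vec Ω) ∘L H10incl Ω

/-- The gradient `∇ : H¹₀(Ω) → L₂(Ω)ᵈ`. -/
def grad (Ω : TopologicalSpace.Opens (Rd d)) : H10 Ω →L[ℝ] L2vec Ω :=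
  WithLp.sndL 2 ℝ (L2 Ω) (L2vec Ω) ∘L H10incl Ω

/-- The space `H⁻¹(Ω)`, the dual of `H¹₀(Ω)`. -/
abbrev Hneg1 (Ω : TopologicalSpace.Opens (Rd d)) : Type := StrongDual ℝ (H10 Ω)

/-- The pairs `(F, DF)` of a bounded vector field on `Ω` and its bounded weak Jacobian. -/
def W1infSub (Ω : TopologicalSpace.Opens (Rd d)) : Submodule ℝ (LinfVec Ω × LinfMat Ω) where
  carrier := {p | HasWeakJacobian Ω p.1 p.2}
  zero_mem' := by
    intro φ y
    have h1 : (fun x => fderiv ℝ φ x y • (0 : LinfVec Ω) x) =ᵐ[vol Ω] fun _ => 0 := by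
      filter_upwards [Lp.coeFn_zero (Rd d) ∞ (vol Ω)] with x hx
      rw [hx]
      simp
    have h2 : (fun x => φ x • (0 : LinfMat Ω) x y) =ᵐ[vol Ω] fun _ => 0 := by
      filter_upwards [Lp.coeFn_zero (Rd d →L[ℝ] Rd d) ∞ (vol Ω)] with x hx
      rw [hx]
      simp
    simp only [Prod.fst_zero, Prod.snd_zero]
    rw [integral_congr_ae h1, integral_congr_ae h2]
    simp
  add_mem' := by
    intro p q hp hq φ y
    have h1 : (fun x => fderiv ℝ φ x y • (p.1 + q.1) x) =ᵐ[vol Ω]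
        fun x => fderiv ℝ φ x y • p.1 x + fderiv ℝ φ x y • q.1 x := by
      filter_upwards [Lp.coeFn_add p.1 q.1] with x hx
      rw [hx]
      simp
    have h2 : (fun x => φ x • (p.2 + q.2) x y) =ᵐ[vol Ω]
        fun x => φ x • p.2 x y + φ x • q.2 x y := by
      filter_upwards [Lp.coeFn_add p.2 q.2] with x hx
      rw [hx]
      simp
    simp only [Prod.fst_add, Prod.snd_add]
    rw [integral_congr_ae h1, integral_congr_ae h2, integral_add, integral_add, hp φ y, hq φ y]
    · abel
    · exact integrable_test_smul φ le_top
        ((ContinuousLinearMap.apply ℝ (Rd d) y).comp_memLp' (Lp.memLp p.2))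
    · exact integrable_test_smul φ le_top
        ((ContinuousLinearMap.apply ℝ (Rd d) y).comp_memLp' (Lp.memLp q.2))
    · exact integrable_fderiv_test_smul φ y le_top (Lp.memLp p.1)
    · exact integrable_fderiv_test_smul φ y le_top (Lp.memLp q.1)
  smul_mem' := by
    intro c p hp φ y
    have h1 : (fun x => fderiv ℝ φ x y • (c • p.1) x) =ᵐ[vol Ω]
        fun x => c • (fderiv ℝ φ x y • p.1 x) := by
      filter_upwards [Lp.coeFn_smul c p.1] with x hx
      simp only [hx, Pi.smul_apply]
      rw [smul_comm]
    have h2 : (fun x => φ x • (c • p.2) x y) =ᵐ[vol Ω] fun x => c • (φ x • p.2 x y) := by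
      filter_upwards [Lp.coeFn_smul c p.2] with x hx
      simp only [hx, Pi.smul_apply, smul_apply]
      rw [smul_comm]
    simp only [Prod.smul_fst, Prod.smul_snd]
    rw [integral_congr_ae h1, integral_congr_ae h2, integral_smul, integral_smul, hp φ y, smul_neg]

/-- The Sobolev space `W¹_∞(Ω)ᵈ` of bounded vector fields `F` with a bounded weak Jacobian `DF`; its
norm is the maximum of the `L∞` norms of `F` and `DF`. -/
def W1inf (Ω : TopologicalSpace.Opens (Rd d)) : Type := W1infSub Ω

instance (Ω : TopologicalSpace.Opens (Rd d)) : NormedAddCommGroup (W1inf Ω) :=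
  inferInstanceAs (NormedAddCommGroup (W1infSub Ω))

instance (Ω : TopologicalSpace.Opens (Rd d)) : NormedSpace ℝ (W1inf Ω) :=
  inferInstanceAs (NormedSpace ℝ (W1infSub Ω))

/-- The inclusion `W¹_∞(Ω)ᵈ → L∞(Ω)ᵈ`. -/
def toLinf (Ω : TopologicalSpace.Opens (Rd d)) : W1inf Ω →L[ℝ] LinfVec Ω :=
  ContinuousLinearMap.fst ℝ (LinfVec Ω) (LinfMat Ω) ∘L (W1infSub Ω).subtypeL

/-! ### Pointwise products and `L₂` pairings -/

/-- Multiplication `L₂(Ω)ᵈ → L₂(Ω)ᵈ` by a matrix-valued function, `(κ ξ)(x) = κ(x) ξ(x)`. -/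
def mulMat {Ω : TopologicalSpace.Opens (Rd d)} (κ : LinfMat Ω) : L2vec Ω →L[ℝ] L2vec Ω :=
  (ContinuousLinearMap.id ℝ (Rd d →L[ℝ] Rd d)).holderL (vol Ω) ∞ 2 2 κ

/-- Multiplication `L₂(Ω) → L₂(Ω)ᵈ` by a vector field, `(F v)(x) = v(x) F(x)`. -/
def mulVec {Ω : TopologicalSpace.Opens (Rd d)} (F : LinfVec Ω) : L2 Ω →L[ℝ] L2vec Ω :=
  (ContinuousLinearMap.lsmul ℝ ℝ : ℝ →L[ℝ] Rd d →L[ℝ] Rd d).flip.holderL (vol Ω) ∞ 2 2 F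

/-- Multiplication `L₂(Ω) → L₂(Ω)` by a scalar function, `(a v)(x) = a(x) v(x)`. -/
def mulScal {Ω : TopologicalSpace.Opens (Rd d)} (a : Linf Ω) : L2 Ω →L[ℝ] L2 Ω :=
  (ContinuousLinearMap.mul ℝ ℝ).holderL (vol Ω) ∞ 2 2 a

/-- The embedding `L₂(Ω) → H⁻¹(Ω)`, `v ↦ (w ↦ ⟨v, w⟩)`. -/
def pairL2 (Ω : TopologicalSpace.Opens (Rd d)) : L2 Ω →L[ℝ] Hneg1 Ω :=
  LinearMap.mkContinuous₂ ((innerₗ (L2 Ω)).compl₂ (toL2 Ω).toLinearMap) ‖toL2 Ω‖ (by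
    intro v w
    have h1 : ‖inner ℝ v (toL2 Ω w)‖ ≤ ‖v‖ * ‖toL2 Ω w‖ := norm_inner_le_norm _ _
    have h2 : ‖v‖ * ‖toL2 Ω w‖ ≤ ‖v‖ * (‖toL2 Ω‖ * ‖w‖) :=
      mul_le_mul_of_nonneg_left ((toL2 Ω).le_opNorm w) (norm_nonneg v)
    calc _ ≤ _ := h1.trans h2
      _ = _ := by ring)

/-- The map `L₂(Ω)ᵈ → H⁻¹(Ω)`, `ξ ↦ (w ↦ ⟨ξ, ∇w⟩)`. -/
def pairGrad (Ω : TopologicalSpace.Opens (Rd d)) : L2vec Ω →L[ℝ] Hneg1 Ω :=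
  LinearMap.mkContinuous₂ ((innerₗ (L2vec Ω)).compl₂ (grad Ω).toLinearMap) ‖grad Ω‖ (by
    intro v w
    have h1 : ‖inner ℝ v (grad Ω w)‖ ≤ ‖v‖ * ‖grad Ω w‖ := norm_inner_le_norm _ _
    have h2 : ‖v‖ * ‖grad Ω w‖ ≤ ‖v‖ * (‖grad Ω‖ * ‖w‖) :=
      mul_le_mul_of_nonneg_left ((grad Ω).le_opNorm w) (norm_nonneg v)
    calc _ ≤ _ := h1.trans h2
      _ = _ := by ring)

/-! ### The coefficients -/

/-- The coefficients of the equation: the diffusivity `κ = κ(x)` and the time-dependent `F`, `G`,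
`a`, `b`. Only the values at times `t ∈ [0,T]` matter. -/
structure Coefficients (Ω : TopologicalSpace.Opens (Rd d)) where
  /-- The generalized diffusivity. -/
  κ : LinfMat Ω
  /-- The vector field multiplying the fractional derivative. -/
  F : ℝ → W1inf Ω
  /-- The vector field multiplying `u`. -/
  G : ℝ → W1inf Ω
  /-- The reaction coefficient of the fractional derivative. -/
  a : ℝ → Linf Ω
  /-- The reaction coefficient of `u`. -/
  b : ℝ → Linf Ω

namespace Coefficients

variable {Ω : TopologicalSpace.Opens (Rd d)}

/-- `F, G ∈ C²([0,T]; W¹_∞(Ω)ᵈ)` and `a, b ∈ C¹([0,T]; L∞(Ω))`. -/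
structure Regular (c : Coefficients Ω) (T : ℝ) : Prop where
  F_mem : ContDiffOn ℝ 2 c.F (Icc 0 T)
  G_mem : ContDiffOn ℝ 2 c.G (Icc 0 T)
  a_mem : ContDiffOn ℝ 1 c.a (Icc 0 T)
  b_mem : ContDiffOn ℝ 1 c.b (Icc 0 T)

/-- `κ(x)` is symmetric, with all its eigenvalues bounded away from zero uniformly in `x ∈ Ω`. -/
def Elliptic (c : Coefficients Ω) : Prop :=
  ∃ c₀ : ℝ, 0 < c₀ ∧ ∀ᵐ x ∂(vol Ω),
    (c.κ x : Rd d →ₗ[ℝ] Rd d).IsSymmetric ∧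
      ∀ lam : ℝ, Module.End.HasEigenvalue (c.κ x : Rd d →ₗ[ℝ] Rd d) lam → c₀ ≤ lam

/-- `⟨K₁(t)v, w⟩ = ⟨κ∇v, ∇w⟩ - ⟨F(t)v, ∇w⟩ + ⟨a(t)v, w⟩`. -/
def K₁ (c : Coefficients Ω) (t : ℝ) : H10 Ω →L[ℝ] Hneg1 Ω :=
  pairGrad Ω ∘L mulMat c.κ ∘L grad Ω - pairGrad Ω ∘L mulVec (toLinf Ω (c.F t)) ∘L toL2 Ω
    + pairL2 Ω ∘L mulScal (c.a t) ∘L toL2 Ω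

/-- `⟨K₂(t)v, w⟩ = ⟨b(t)v, w⟩ - ⟨G(t)v, ∇w⟩`. -/
def K₂ (c : Coefficients Ω) (t : ℝ) : L2 Ω →L[ℝ] Hneg1 Ω :=
  pairL2 Ω ∘L mulScal (c.b t) - pairGrad Ω ∘L mulVec (toLinf Ω (c.G t))

/-- `⟨K₁'(t)v, w⟩ = - ⟨F'(t)v, ∇w⟩ + ⟨a'(t)v, w⟩`, with one-sided time derivatives at the end
points of `[0,T]`. -/
def K₁' (c : Coefficients Ω) (T t : ℝ) : H10 Ω →L[ℝ] Hneg1 Ω :=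
  -(pairGrad Ω ∘L mulVec (toLinf Ω (derivWithin c.F (Icc 0 T) t)) ∘L toL2 Ω)
    + pairL2 Ω ∘L mulScal (derivWithin c.a (Icc 0 T) t) ∘L toL2 Ω

end Coefficients

/-- `ω_α(t) = t^{α-1} / Γ(α)`. -/
def omega (α t : ℝ) : ℝ := t ^ (α - 1) / Real.Gamma α

/-- The kernel `K(t,s) = ω_α(t-s) K₁(t) + K₂(s) - ∫_s^t ω_α(z-s) K₁'(z) dz`, for
`0 ≤ s ≤ t ≤ T`. -/
def Coefficients.K {Ω : TopologicalSpace.Opens (Rd d)} (c : Coefficients Ω) (T α t s : ℝ) :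
    H10 Ω →L[ℝ] Hneg1 Ω :=
  omega α (t - s) • c.K₁ t + c.K₂ s ∘L toL2 Ω - ∫ z in s..t, omega α (z - s) • c.K₁' T z

/-- `f(t) = u₀ + ∫₀ᵗ g(s) ds`. -/
def source {Ω : TopologicalSpace.Opens (Rd d)} (u₀ : L2 Ω) (g : ℝ → L2 Ω) (t : ℝ) : L2 Ω :=
  u₀ + ∫ s in (0 : ℝ)..t, g s

/-! ### The projected equation -/

variable {Ω : TopologicalSpace.Opens (Rd d)}

theorem eq_zero_of_toL2_eq_zero (v : H10 Ω) (hv : toL2 Ω v = 0) : v = 0 := by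
  have hfst : (H10incl Ω v).fst = 0 := hv
  have hw : HasWeakGradient Ω (H10incl Ω v).fst
      (H10incl Ω v).snd := v.2.1
  rw [hfst] at hw
  have hcomp : ∀ y : Rd d, ∀ᵐ x ∂(vol Ω),
      inner ℝ ((H10incl Ω v).snd x) y = 0 := by
    intro y
    have hmem := (Lp.memLp (H10incl Ω v).snd).inner_const (𝕜 := ℝ) y
    have hae := Ω.isOpen.ae_eq_zero_of_integral_contDiff_smul_eq_zero
      ((hmem.locallyIntegrable one_le_two).locallyIntegrableOn _) (by
        intro φ h1 h2 h3
        have h := hw ⟨φ, h1, h2, h3⟩ y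
        have h0 : (fun x => fderiv ℝ φ x y * (0 : L2 Ω) x) =ᵐ[vol Ω] fun _ => 0 := by
          filter_upwards [Lp.coeFn_zero ℝ 2 (vol Ω)] with x hx
          rw [hx]
          simp
        have h' := (integral_congr_ae h0).symm.trans h
        simpa using h')
    filter_upwards [hae, ae_restrict_mem Ω.isOpen.measurableSet] with x hx hx'
    exact hx hx'
  have hsnd : (H10incl Ω v).snd = 0 := by
    rw [Lp.eq_zero_iff_ae_eq_zero]
    have hall := ae_all_iff.2 fun i : Fin d => hcomp (EuclideanSpace.single i 1)
    filter_upwards [hall] with x hx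
    ext i
    have hi := hx i
    rw [EuclideanSpace.inner_single_right] at hi
    simpa using hi
  apply Subtype.ext
  apply (WithLp.ofLp_injective 2)
  exact Prod.ext hfst hsnd

/-- The `L₂(Ω)` inner product on a subspace `X` of `H¹₀(Ω)`. -/
def l2Form (X : Submodule ℝ (H10 Ω)) : LinearMap.BilinForm ℝ X :=
  (innerₗ (L2 Ω)).compl₁₂ ((toL2 Ω).toLinearMap ∘ₗ X.subtype)
    ((toL2 Ω).toLinearMap ∘ₗ X.subtype)

theorem l2Form_nondegenerate (X : Submodule ℝ (H10 Ω)) : (l2Form X).Nondegenerate := by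
  have key : ∀ v : X, l2Form X v v = 0 → v = 0 := fun v hv =>
    Subtype.ext (eq_zero_of_toL2_eq_zero _ (inner_self_eq_zero.1 hv))
  exact ⟨fun v hv => key v (hv v), fun v hv => key v (hv v)⟩

/-- For a functional `ℓ ∈ H⁻¹(Ω)`, the unique element `P_X ℓ` of the finite-dimensional space
`X ⊆ H¹₀(Ω)` with `⟨P_X ℓ, w⟩ = ℓ(w)` for all `w ∈ X`, where `⟨·, ·⟩` is the inner product
of `L₂(Ω)`. -/
def proj (X : Submodule ℝ (H10 Ω)) [FiniteDimensional ℝ X] : Hneg1 Ω →ₗ[ℝ] X where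
  toFun ℓ := ((l2Form X).toDual (l2Form_nondegenerate X)).symm (ℓ.toLinearMap ∘ₗ X.subtype)
  map_add' ℓ₁ ℓ₂ := by
    rw [← map_add]
    rfl
  map_smul' r ℓ := by
    rw [RingHom.id_apply, ← map_smul]
    rfl

theorem inner_proj (X : Submodule ℝ (H10 Ω)) [FiniteDimensional ℝ X] (ℓ : Hneg1 Ω) (w : X) :
    inner ℝ (toL2 Ω (proj X ℓ)) (toL2 Ω w) = ℓ w :=
  LinearMap.BilinForm.apply_toDual_symm_apply (B := l2Form X) (hB := l2Form_nondegenerate X)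
    (ℓ.toLinearMap ∘ₗ X.subtype) w

/-- The operator `K_X(t,s) : X → X` with `⟨K_X(t,s)v, w⟩ = ⟨K(t,s)v, w⟩` for `v, w ∈ X`. -/
def KX (c : Coefficients Ω) (T α : ℝ) (X : Submodule ℝ (H10 Ω)) [FiniteDimensional ℝ X]
    (t s : ℝ) : X →ₗ[ℝ] X :=
  proj X ∘ₗ (c.K T α t s).toLinearMap ∘ₗ X.subtype

/-- The `L₂` projection `f_X(t) ∈ X` of `f(t)`: `⟨f_X(t), w⟩ = ⟨f(t), w⟩` for `w ∈ X`. -/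
def fX (u₀ : L2 Ω) (g : ℝ → L2 Ω) (X : Submodule ℝ (H10 Ω)) [FiniteDimensional ℝ X]
    (t : ℝ) : X :=
  proj X (pairL2 Ω (source u₀ g t))

/-- `u ∈ C([0,T]; X)` solves the projected Volterra equation
`u(t) + ∫₀ᵗ K_X(t,s) u(s) ds = f_X(t)` for `0 ≤ t ≤ T`. -/
structure IsGalerkinSolution (c : Coefficients Ω) (T α : ℝ) (u₀ : L2 Ω) (g : ℝ → L2 Ω)
    (X : Submodule ℝ (H10 Ω)) [FiniteDimensional ℝ X] (u : ℝ → X) : Prop where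
  continuousOn : ContinuousOn u (Icc 0 T)
  equation : ∀ t ∈ Icc 0 T, u t + ∫ s in (0 : ℝ)..t, KX c T α X t s (u s) = fX u₀ g X t

end FracADR

end

/-!
Integrating the memory part of `K` by parts in time turns the projected equation into an equation
`⟨u, w⟩ + (ω_α * a(u, w))(t) = ⟨u₀, w⟩ + …` in which only the `κ`-form `a` is of second order; the
remaining terms pair `w` in `L₂(Ω)` with quantities bounded by the `H¹` norm of `u`, because `F` and
`G` are Lipschitz. In an `L₂`-orthonormal basis of `X` that diagonalises `a` the equation decouples
into scalar ones `y + λ ω_α * y = …`, whose resolvents `E_α(-λ t^α)` and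
`t^{α-1} E_{α,α}(-λ t^α)` satisfy bounds uniform in `λ ≥ 0`. Multiplying by `√(1 + λ)` costs only a
factor `t^{-α/2}`, so Parseval's identity gives a weakly singular integral inequality for the `H¹`
norm of `u`, and Gronwall's lemma closes the estimate. The eigenvalues, the only trace of `X`, do
not enter the constant.
-/

noncomputable section

namespace FracADR

/-! ### Power kernels -/

theorem integral_rpow_mul_rpow {p q t : ℝ} (hp : 0 < p) (hq : 0 < q) (ht : 0 < t) :
    ∫ s in (0 : ℝ)..t, (t - s) ^ (p - 1) * s ^ (q - 1)
      = t ^ (p + q - 1) * ProbabilityTheory.beta p q := by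
  have h := Complex.betaIntegral_scaled (q : ℂ) (p : ℂ) ht
  rw [Complex.betaIntegral_symm] at h
  have h1 : ∫ x in (0 : ℝ)..t, (x : ℂ) ^ ((q : ℂ) - 1) * ((t : ℂ) - x) ^ ((p : ℂ) - 1)
      = ((∫ s in (0 : ℝ)..t, (t - s) ^ (p - 1) * s ^ (q - 1) : ℝ) : ℂ) := by
    rw [← intervalIntegral.integral_ofReal]
    apply intervalIntegral.integral_congr
    intro x hx
    rw [uIcc_of_le ht.le] at hx
    simp only
    rw [Complex.ofReal_mul, Complex.ofReal_cpow (sub_nonneg.2 hx.2), Complex.ofReal_cpow hx.1]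
    push_cast
    ring
  rw [h1] at h
  have h2 := congrArg Complex.re h
  rw [Complex.ofReal_re] at h2
  rw [h2, ProbabilityTheory.beta_eq_betaIntegralReal p q hp hq, add_comm p q,
    show ((q : ℂ) + p - 1) = ((q + p - 1 : ℝ) : ℂ) by push_cast; ring,
    ← Complex.ofReal_cpow ht.le, Complex.re_ofReal_mul]

theorem intervalIntegrable_rpow_mul_rpow {p q t : ℝ} (hp : 0 < p) (hq : 0 < q) (ht : 0 ≤ t) :
    IntervalIntegrable (fun s => (t - s) ^ (p - 1) * s ^ (q - 1)) volume 0 t := by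
  rcases ht.eq_or_lt with rfl | ht
  · exact IntervalIntegrable.refl
  · apply intervalIntegral.intervalIntegrable_of_integral_ne_zero
    rw [integral_rpow_mul_rpow hp hq ht]
    exact (mul_pos (Real.rpow_pos_of_pos ht _) (ProbabilityTheory.beta_pos hp hq)).ne'

theorem intervalIntegrable_rpow_sub_one {p : ℝ} (hp : 0 < p) (a b : ℝ) :
    IntervalIntegrable (fun s : ℝ => s ^ (p - 1)) volume a b :=
  intervalIntegral.intervalIntegrable_rpow' (by linarith)

theorem intervalIntegrable_sub_rpow_sub_one {p : ℝ} (hp : 0 < p) (t a b : ℝ) :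
    IntervalIntegrable (fun s : ℝ => (t - s) ^ (p - 1)) volume a b := by
  have := (intervalIntegrable_rpow_sub_one hp (t - a) (t - b)).comp_sub_left t
  simpa using this

theorem integral_sub_rpow_sub_one {p : ℝ} (hp : 0 < p) (a t : ℝ) :
    ∫ s in a..t, (t - s) ^ (p - 1) = (t - a) ^ p / p := by
  rw [intervalIntegral.integral_comp_sub_left (fun x => x ^ (p - 1)), sub_self,
    integral_rpow (Or.inl (by linarith))]
  simp [Real.zero_rpow hp.ne']

theorem omega_nonneg {α t : ℝ} (hα : 0 < α) (ht : 0 ≤ t) : 0 ≤ omega α t :=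
  div_nonneg (Real.rpow_nonneg ht _) (Real.Gamma_pos_of_pos hα).le

theorem omega_pos {α t : ℝ} (hα : 0 < α) (ht : 0 < t) : 0 < omega α t :=
  div_pos (Real.rpow_pos_of_pos ht _) (Real.Gamma_pos_of_pos hα)

theorem intervalIntegrable_omega {α : ℝ} (hα : 0 < α) (a b : ℝ) :
    IntervalIntegrable (omega α) volume a b :=
  (intervalIntegrable_rpow_sub_one hα a b).div_const _

/-! ### Fubini on a triangle -/

/-- The measure `dr ds` on the square `(0,t]²`. -/
abbrev sqMeasure (t : ℝ) : Measure (ℝ × ℝ) :=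
  (volume.restrict (Ioc 0 t)).prod (volume.restrict (Ioc 0 t))

/-- The triangle `r < s` in the plane of points `(s, r)`. -/
def tri : Set (ℝ × ℝ) := {x | x.2 < x.1}

theorem measurableSet_tri : MeasurableSet tri := measurableSet_lt measurable_snd measurable_fst

section Triangle

variable {E : Type*} [NormedAddCommGroup E] [NormedSpace ℝ E] {F : ℝ → ℝ → E} {t : ℝ}

theorem setIntegral_tri_fst {s : ℝ} (hs : s ∈ Ioc 0 t) :
    ∫ r in Ioc 0 t, tri.indicator (Function.uncurry F) (s, r) = ∫ r in (0 : ℝ)..s, F s r := by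
  have h : (fun r => tri.indicator (Function.uncurry F) (s, r)) =
      (Iio s).indicator (fun r => F s r) := by
    ext r
    by_cases hr : r < s <;> simp [tri, hr]
  rw [h, setIntegral_indicator measurableSet_Iio, intervalIntegral.integral_of_le hs.1.le,
    integral_Ioc_eq_integral_Ioo (y := s)]
  congr 2
  ext r
  simp only [mem_inter_iff, mem_Ioc, mem_Iio, mem_Ioo]
  exact ⟨fun h => ⟨h.1.1, h.2⟩, fun h => ⟨⟨h.1, h.2.le.trans hs.2⟩, h.2⟩⟩

theorem setIntegral_tri_snd {r : ℝ} (hr : r ∈ Ioc 0 t) :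
    ∫ s in Ioc 0 t, tri.indicator (Function.uncurry F) (s, r) = ∫ s in r..t, F s r := by
  have h : (fun s => tri.indicator (Function.uncurry F) (s, r)) =
      (Ioi r).indicator (fun s => F s r) := by
    ext s
    by_cases hs : r < s <;> simp [tri, hs]
  rw [h, setIntegral_indicator measurableSet_Ioi, intervalIntegral.integral_of_le hr.2]
  congr 2
  ext s
  simp only [mem_inter_iff, mem_Ioc, mem_Ioi]
  exact ⟨fun h => ⟨h.2, h.1.2⟩, fun h => ⟨⟨hr.1.trans h.1, h.2⟩, h.1⟩⟩

theorem intervalIntegrable_tri_fst (ht : 0 ≤ t)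
    (hF : Integrable (tri.indicator (Function.uncurry F)) (sqMeasure t)) :
    IntervalIntegrable (fun s => ∫ r in (0 : ℝ)..s, F s r) volume 0 t := by
  rw [intervalIntegrable_iff_integrableOn_Ioc_of_le ht]
  refine hF.integral_prod_left.congr ?_
  filter_upwards [ae_restrict_mem measurableSet_Ioc] with s hs
  exact setIntegral_tri_fst hs

theorem intervalIntegrable_tri_snd (ht : 0 ≤ t)
    (hF : Integrable (tri.indicator (Function.uncurry F)) (sqMeasure t)) :
    IntervalIntegrable (fun r => ∫ s in r..t, F s r) volume 0 t := by
  rw [intervalIntegrable_iff_integrableOn_Ioc_of_le ht]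
  refine hF.integral_prod_right.congr ?_
  filter_upwards [ae_restrict_mem measurableSet_Ioc] with s hs
  exact setIntegral_tri_snd hs

theorem integral_tri_swap (ht : 0 ≤ t)
    (hF : Integrable (tri.indicator (Function.uncurry F)) (sqMeasure t)) :
    ∫ s in (0 : ℝ)..t, ∫ r in (0 : ℝ)..s, F s r = ∫ r in (0 : ℝ)..t, ∫ s in r..t, F s r := by
  rw [intervalIntegral.integral_of_le ht, intervalIntegral.integral_of_le ht]
  have h := integral_integral_swap (f := fun s r => tri.indicator (Function.uncurry F) (s, r)) hF
  rw [setIntegral_congr_fun measurableSet_Ioc (fun s hs => setIntegral_tri_fst hs),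
    setIntegral_congr_fun measurableSet_Ioc (fun s hs => setIntegral_tri_snd hs)] at h
  exact h

end Triangle

/-! ### Volterra convolution -/

/-- The Volterra convolution `(k * h)(t) = ∫₀ᵗ k(t-s) h(s) ds`. -/
def vconv (k h : ℝ → ℝ) (t : ℝ) : ℝ := ∫ s in (0 : ℝ)..t, k (t - s) * h s

theorem vconv_comm (k h : ℝ → ℝ) (t : ℝ) : vconv k h t = vconv h k t := by
  have := intervalIntegral.integral_comp_sub_left (a := 0) (b := t)
    (fun x => k (t - x) * h x) t
  simp only [sub_sub_cancel, sub_self, sub_zero] at this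
  rw [vconv, vconv, ← this]
  exact intervalIntegral.integral_congr fun s _ => mul_comm _ _

theorem vconv_congr_right {k h₁ h₂ : ℝ → ℝ} {t : ℝ} (ht : 0 ≤ t) (h : EqOn h₁ h₂ (Ioc 0 t)) :
    vconv k h₁ t = vconv k h₂ t := by
  rw [vconv, vconv, intervalIntegral.integral_of_le ht, intervalIntegral.integral_of_le ht]
  exact setIntegral_congr_fun measurableSet_Ioc fun s hs => by simp only [h hs]

theorem vconv_congr_left {k₁ k₂ h : ℝ → ℝ} {t : ℝ} (ht : 0 ≤ t) (hk : EqOn k₁ k₂ (Ioc 0 t)) :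
    vconv k₁ h t = vconv k₂ h t := by
  rw [vconv_comm k₁, vconv_comm k₂, vconv_congr_right ht hk]

theorem vconv_const_mul_right (k h : ℝ → ℝ) (c t : ℝ) :
    vconv k (fun s => c * h s) t = c * vconv k h t := by
  rw [vconv, vconv, ← intervalIntegral.integral_const_mul]
  exact intervalIntegral.integral_congr fun s _ => mul_left_comm _ _ _

theorem vconv_const_mul_left (k h : ℝ → ℝ) (c t : ℝ) :
    vconv (fun s => c * k s) h t = c * vconv k h t := by
  rw [vconv_comm, vconv_const_mul_right, vconv_comm]

theorem vconv_add_right {k h₁ h₂ : ℝ → ℝ} {t : ℝ}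
    (hi₁ : IntervalIntegrable (fun s => k (t - s) * h₁ s) volume 0 t)
    (hi₂ : IntervalIntegrable (fun s => k (t - s) * h₂ s) volume 0 t) :
    vconv k (fun s => h₁ s + h₂ s) t = vconv k h₁ t + vconv k h₂ t := by
  simp only [vconv, mul_add]
  exact intervalIntegral.integral_add hi₁ hi₂

theorem vconv_sub_left {k₁ k₂ h : ℝ → ℝ} {t : ℝ}
    (hi₁ : IntervalIntegrable (fun s => k₁ (t - s) * h s) volume 0 t)
    (hi₂ : IntervalIntegrable (fun s => k₂ (t - s) * h s) volume 0 t) :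
    vconv (fun s => k₁ s - k₂ s) h t = vconv k₁ h t - vconv k₂ h t := by
  simp only [vconv, sub_mul]
  exact intervalIntegral.integral_sub hi₁ hi₂

theorem vconv_one_left (h : ℝ → ℝ) (t : ℝ) : vconv (fun _ => 1) h t = ∫ s in (0 : ℝ)..t, h s := by
  simp only [vconv, one_mul]

theorem mul_vconv {k h : ℝ → ℝ} {t : ℝ}
    (hi₁ : IntervalIntegrable (fun s => (t - s) * k (t - s) * h s) volume 0 t)
    (hi₂ : IntervalIntegrable (fun s => k (t - s) * (s * h s)) volume 0 t) :
    t * vconv k h t = vconv (fun s => s * k s) h t + vconv k (fun s => s * h s) t := by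
  simp only [vconv]
  rw [← intervalIntegral.integral_const_mul, ← intervalIntegral.integral_add hi₁ hi₂]
  exact intervalIntegral.integral_congr fun s _ => by ring

theorem vconv_omega_omega {p q t : ℝ} (hp : 0 < p) (hq : 0 < q) (ht : 0 < t) :
    vconv (omega p) (omega q) t = omega (p + q) t := by
  have h := integral_rpow_mul_rpow hp hq ht
  have : ∀ s, omega p (t - s) * omega q s
      = (Real.Gamma p * Real.Gamma q)⁻¹ * ((t - s) ^ (p - 1) * s ^ (q - 1)) := by
    intro s
    unfold omega
    field_simp
  simp only [vconv, this]
  rw [intervalIntegral.integral_const_mul, h, omega, ProbabilityTheory.beta]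
  have h1 := (Real.Gamma_pos_of_pos hp).ne'
  have h2 := (Real.Gamma_pos_of_pos hq).ne'
  field_simp

theorem vconv_one_omega {α t : ℝ} (hα : 0 < α) (ht : 0 < t) :
    vconv (fun _ => 1) (omega α) t = t ^ α / Real.Gamma (α + 1) := by
  have h1 : (fun _ : ℝ => (1 : ℝ)) = omega 1 := by
    ext
    simp [omega]
  rw [h1, vconv_omega_omega one_pos hα ht, omega, add_comm 1 α, add_sub_cancel_right]

theorem mul_omega_eq {α t : ℝ} (hα : 0 < α) (ht : 0 < t) :
    t * omega α t = α * vconv (fun _ => 1) (omega α) t := by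
  have hΓ := (Real.Gamma_pos_of_pos hα).ne'
  rw [vconv_one_omega hα ht, Real.Gamma_add_one hα.ne', omega, Real.rpow_sub_one ht.ne']
  field_simp

theorem vconv_assoc {k₁ k₂ h : ℝ → ℝ} {t : ℝ} (ht : 0 ≤ t)
    (hF : Integrable (tri.indicator (Function.uncurry fun s r => k₁ (t - s) * (k₂ (s - r) * h r)))
      (sqMeasure t)) :
    vconv k₁ (vconv k₂ h) t = vconv (vconv k₁ k₂) h t := by
  have h1 := integral_tri_swap ht hF
  simp only [intervalIntegral.integral_const_mul] at h1
  rw [vconv]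
  refine h1.trans ?_
  rw [vconv]
  refine intervalIntegral.integral_congr fun r _ => ?_
  have h2 : ∀ s, k₁ (t - s) * (k₂ (s - r) * h r) = k₁ (t - s) * k₂ (s - r) * h r := fun s => by ring
  simp only [h2]
  rw [intervalIntegral.integral_mul_const]
  congr 1
  have := intervalIntegral.integral_comp_sub_right (a := r) (b := t)
    (fun x => k₁ (t - r - x) * k₂ x) r
  rw [sub_self] at this
  rw [vconv, ← this]
  refine intervalIntegral.integral_congr fun s _ => ?_
  simp only [sub_sub, add_sub_cancel]

theorem integrable_indicator_Ioc {f : ℝ → ℝ} {t : ℝ} (ht : 0 ≤ t)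
    (hf : IntervalIntegrable f volume 0 t) : Integrable ((Ioc 0 t).indicator f) := by
  rw [integrable_indicator_iff measurableSet_Ioc]
  exact (intervalIntegrable_iff_integrableOn_Ioc_of_le ht).1 hf

theorem intervalIntegrable_comp_sub {f : ℝ → ℝ} {t : ℝ}
    (hf : IntervalIntegrable f volume 0 t) :
    IntervalIntegrable (fun s => f (t - s)) volume 0 t := by
  have := (hf.comp_sub_left t).symm
  simpa using this
theorem integrable_tri_of_integrable_indicator {F : ℝ × ℝ → ℝ} {k : ℝ → ℝ} {t : ℝ}
    (h : Integrable (fun x => F x * (Ioc 0 t).indicator k (x.1 - x.2)) (sqMeasure t)) :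
    Integrable (tri.indicator fun x => F x * k (x.1 - x.2)) (sqMeasure t) := by
  refine (h.indicator measurableSet_tri).congr ?_
  rw [Filter.EventuallyEq, sqMeasure, Measure.prod_restrict]
  filter_upwards [ae_restrict_mem (measurableSet_Ioc.prod measurableSet_Ioc)] with x hx
  by_cases hxt : x ∈ tri
  · have : x.1 - x.2 ∈ Ioc 0 t := ⟨sub_pos.2 hxt, by linarith [hx.1.2, hx.2.1]⟩
    simp only [indicator_of_mem hxt, indicator_of_mem this]
  · rw [indicator_of_notMem hxt, indicator_of_notMem hxt]

theorem integrable_tri_left {f k : ℝ → ℝ} {t : ℝ} (ht : 0 ≤ t)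
    (hf : IntervalIntegrable f volume 0 t) (hk : IntervalIntegrable k volume 0 t) :
    Integrable (tri.indicator (Function.uncurry fun s r => f s * k (s - r))) (sqMeasure t) := by
  have hk₀ : Integrable ((Ioc 0 t).indicator k) := integrable_indicator_Ioc ht hk
  set k₀ := (Ioc 0 t).indicator k
  have hf' : Integrable f (volume.restrict (Ioc 0 t)) :=
    (intervalIntegrable_iff_integrableOn_Ioc_of_le ht).1 hf
  have hmeas : AEStronglyMeasurable (fun x : ℝ × ℝ => f x.1 * k₀ (x.1 - x.2))
      ((volume.restrict (Ioc 0 t)).prod volume) := by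
    have h := hk₀.aestronglyMeasurable.comp_quasiMeasurePreserving
      (quasiMeasurePreserving_sub_of_right_invariant (volume : Measure ℝ) volume)
    exact hf'.aestronglyMeasurable.comp_fst.mul
      (h.mono_ac (Measure.absolutelyContinuous_restrict.prod Measure.AbsolutelyContinuous.rfl))
  have hint : Integrable (fun x : ℝ × ℝ => f x.1 * k₀ (x.1 - x.2))
      ((volume.restrict (Ioc 0 t)).prod volume) := by
    rw [integrable_prod_iff hmeas]
    refine ⟨.of_forall fun s => (hk₀.comp_sub_left s).const_mul (f s), ?_⟩
    have : ∀ s, ∫ r, ‖f s * k₀ (s - r)‖ = ‖f s‖ * ∫ r, ‖k₀ r‖ := by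
      intro s
      simp only [norm_mul]
      rw [integral_const_mul, integral_sub_left_eq_self (fun x => ‖k₀ x‖)]
    simp only [this]
    exact hf'.norm.mul_const _
  exact integrable_tri_of_integrable_indicator
    (hint.mono_measure (Measure.prod_mono le_rfl Measure.restrict_le_self))

theorem integrable_tri_right {h k : ℝ → ℝ} {t : ℝ} (ht : 0 ≤ t)
    (hh : IntervalIntegrable h volume 0 t) (hk : IntervalIntegrable k volume 0 t) :
    Integrable (tri.indicator (Function.uncurry fun s r => h r * k (s - r))) (sqMeasure t) := by
  have hh' : Integrable h (volume.restrict (Ioc 0 t)) :=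
    (intervalIntegrable_iff_integrableOn_Ioc_of_le ht).1 hh
  have hint := hh'.convolution_integrand (ContinuousLinearMap.mul ℝ ℝ)
    (integrable_indicator_Ioc ht hk)
  exact integrable_tri_of_integrable_indicator
    (hint.mono_measure (Measure.prod_mono Measure.restrict_le_self le_rfl))

theorem integrable_tri_bdd_mul {f g : ℝ → ℝ → ℝ} {t : ℝ} {C : ℝ}
    (hg : Integrable (tri.indicator (Function.uncurry g)) (sqMeasure t))
    (hf : AEStronglyMeasurable (Function.uncurry f) (sqMeasure t))
    (hC : ∀ s r, 0 < r → r < s → s ≤ t → |f s r| ≤ C) :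
    Integrable (tri.indicator (Function.uncurry fun s r => f s r * g s r)) (sqMeasure t) := by
  have h : (tri.indicator (Function.uncurry fun s r => f s r * g s r))
      = fun x => tri.indicator (Function.uncurry f) x * tri.indicator (Function.uncurry g) x := by
    ext x
    by_cases hx : x ∈ tri <;> simp [hx, Function.uncurry]
  rw [h]
  refine hg.bdd_mul (c := max C 0) (hf.indicator measurableSet_tri) ?_
  rw [sqMeasure, Measure.prod_restrict]
  filter_upwards [ae_restrict_mem (measurableSet_Ioc.prod measurableSet_Ioc)] with x hx
  by_cases hxt : x ∈ tri
  · rw [indicator_of_mem hxt]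
    exact (hC x.1 x.2 hx.2.1 hxt hx.1.2).trans (le_max_left _ _)
  · simp [indicator_of_notMem hxt]

theorem aestronglyMeasurable_of_intervalIntegrable {f : ℝ → ℝ} {t : ℝ} (ht : 0 ≤ t)
    (hf : IntervalIntegrable f volume 0 t) :
    AEStronglyMeasurable f (volume.restrict (Ioc 0 t)) :=
  ((intervalIntegrable_iff_integrableOn_Ioc_of_le ht).1 hf).aestronglyMeasurable

theorem vconv_assoc_of_bdd_right {k₁ k₂ h : ℝ → ℝ} {t C : ℝ} (ht : 0 ≤ t)
    (h₁ : IntervalIntegrable k₁ volume 0 t) (h₂ : IntervalIntegrable k₂ volume 0 t)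
    (hh : IntervalIntegrable h volume 0 t) (hC : ∀ s ∈ Ioc 0 t, |h s| ≤ C) :
    vconv k₁ (vconv k₂ h) t = vconv (vconv k₁ k₂) h t := by
  refine vconv_assoc ht ?_
  have := integrable_tri_bdd_mul (f := fun _ r => h r) (C := C)
    (integrable_tri_left ht (intervalIntegrable_comp_sub h₁) h₂)
    (aestronglyMeasurable_of_intervalIntegrable ht hh).comp_snd
    (fun s r h1 h2 h3 => hC r ⟨h1, h2.le.trans h3⟩)
  convert this using 5
  ring

theorem vconv_assoc_one {k₁ h : ℝ → ℝ} {t : ℝ} (ht : 0 ≤ t)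
    (h₁ : IntervalIntegrable k₁ volume 0 t) (hh : IntervalIntegrable h volume 0 t) :
    vconv k₁ (vconv (fun _ => 1) h) t = vconv (vconv k₁ (fun _ => 1)) h t := by
  refine vconv_assoc ht ?_
  have h1 := (intervalIntegrable_iff_integrableOn_Ioc_of_le ht).1 (intervalIntegrable_comp_sub h₁)
  have h2 := (intervalIntegrable_iff_integrableOn_Ioc_of_le ht).1 hh
  have := (Integrable.mul_prod h1 h2).indicator measurableSet_tri
  simpa [Function.uncurry_def] using this

theorem vconv_one_assoc {k₂ h : ℝ → ℝ} {t : ℝ} (ht : 0 ≤ t)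
    (h₂ : IntervalIntegrable k₂ volume 0 t) (hh : IntervalIntegrable h volume 0 t) :
    vconv (fun _ => 1) (vconv k₂ h) t = vconv (vconv (fun _ => 1) k₂) h t := by
  refine vconv_assoc ht ?_
  simpa only [one_mul, mul_comm (h _)] using integrable_tri_right ht hh h₂

theorem intervalIntegrable_vconv_right {k h : ℝ → ℝ} {t : ℝ}
    (hk : IntervalIntegrable k volume 0 t) (hh : ContinuousOn h (uIcc 0 t)) :
    IntervalIntegrable (fun s => k (t - s) * h s) volume 0 t :=
  (intervalIntegrable_comp_sub hk).mul_continuousOn hh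

theorem intervalIntegrable_vconv_left {k h : ℝ → ℝ} {t : ℝ}
    (hk : Continuous k) (hh : IntervalIntegrable h volume 0 t) :
    IntervalIntegrable (fun s => k (t - s) * h s) volume 0 t :=
  hh.continuousOn_mul (hk.comp (continuous_const.sub continuous_id)).continuousOn

theorem intervalIntegrable_vconv {k h : ℝ → ℝ} {t : ℝ} (ht : 0 ≤ t)
    (hk : IntervalIntegrable k volume 0 t) (hh : IntervalIntegrable h volume 0 t) :
    IntervalIntegrable (vconv k h) volume 0 t := by
  refine (intervalIntegrable_tri_fst ht (integrable_tri_right ht hh hk)).congr fun s _ => ?_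
  exact intervalIntegral.integral_congr fun r _ => mul_comm _ _

/-! ### Mittag-Leffler resolvents -/

theorem rpow_mul_exp_le_Gamma {R b : ℝ} (hR : 0 < R) (hb : 0 < b) :
    R ^ b * Real.exp (-(R + 1)) ≤ Real.Gamma (b + 1) := by
  have hint := Real.GammaIntegral_convergent (s := b + 1) (by linarith)
  have hsub : Ioc R (R + 1) ⊆ Ioi 0 := fun x hx => hR.trans hx.1
  calc R ^ b * Real.exp (-(R + 1))
      = ∫ _ in Ioc R (R + 1), R ^ b * Real.exp (-(R + 1)) := by simp
    _ ≤ ∫ x in Ioc R (R + 1), Real.exp (-x) * x ^ (b + 1 - 1) := by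
      refine setIntegral_mono_on (integrableOn_const (by simp)) (hint.mono_set hsub)
        measurableSet_Ioc fun x hx => ?_
      rw [add_sub_cancel_right, mul_comm]
      exact mul_le_mul (Real.exp_le_exp.2 (by linarith [hx.2]))
        (Real.rpow_le_rpow hR.le hx.1.le hb.le) (Real.rpow_nonneg hR.le _) (Real.exp_pos _).le
    _ ≤ ∫ x in Ioi 0, Real.exp (-x) * x ^ (b + 1 - 1) := by
      refine setIntegral_mono_set hint ?_ hsub.eventuallyLE
      filter_upwards [ae_restrict_mem measurableSet_Ioi] with x hx
      exact mul_nonneg (Real.exp_pos _).le (Real.rpow_nonneg (le_of_lt hx) _)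
    _ = Real.Gamma (b + 1) := (Real.Gamma_eq_integral (by linarith)).symm

theorem inv_Gamma_le {R b : ℝ} (hR : 0 < R) (hb : 0 < b) :
    (Real.Gamma b)⁻¹ ≤ b * Real.exp (R + 1) * (R ^ b)⁻¹ := by
  have h := rpow_mul_exp_le_Gamma hR hb
  have hΓ := Real.Gamma_pos_of_pos hb
  have hRb := Real.rpow_pos_of_pos hR b
  rw [Real.Gamma_add_one hb.ne', Real.exp_neg, ← div_eq_mul_inv, div_le_iff₀ (Real.exp_pos _)] at h
  rw [← div_eq_mul_inv, le_div_iff₀ hRb, inv_mul_le_iff₀ hΓ]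
  linarith

theorem summable_pow_div_Gamma {α : ℝ} (hα : 0 < α) (x : ℝ) :
    Summable fun k : ℕ => |x| ^ k / Real.Gamma (α * (k + 1)) := by
  set R : ℝ := (2 * |x| + 1) ^ α⁻¹
  have hb : 0 < 2 * |x| + 1 := by positivity
  have hRα : ∀ k : ℕ, R ^ (α * (k + 1)) = (2 * |x| + 1) ^ (k + 1) := fun k => by
    rw [← Real.rpow_mul hb.le, inv_mul_cancel_left₀ hα.ne']
    exact_mod_cast Real.rpow_natCast _ (k + 1)
  have hratio : ∀ k : ℕ, |x| ^ k * ((2 * |x| + 1) ^ (k + 1))⁻¹ ≤ (1 / 2 : ℝ) ^ k := fun k => by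
    rw [← div_eq_mul_inv, div_le_iff₀ (by positivity)]
    calc |x| ^ k = (1 / 2 : ℝ) ^ k * (2 * |x|) ^ k := by rw [← mul_pow]; ring_nf
      _ ≤ (1 / 2 : ℝ) ^ k * (2 * |x| + 1) ^ k := by gcongr; linarith
      _ ≤ (1 / 2 : ℝ) ^ k * (2 * |x| + 1) ^ (k + 1) := by
        gcongr
        · linarith [abs_nonneg x]
        · omega
  have hgeom : Summable fun k : ℕ => ((k : ℝ) + 1) * (1 / 2 : ℝ) ^ k := by
    simp only [add_mul, one_mul]
    refine Summable.add ?_ (summable_geometric_of_lt_one (by norm_num) (by norm_num))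
    simpa using summable_pow_mul_geometric_of_norm_lt_one 1 (r := (1 / 2 : ℝ)) (by norm_num)
  refine Summable.of_nonneg_of_le
    (fun k => div_nonneg (by positivity) (Real.Gamma_pos_of_pos (by positivity)).le) (fun k => ?_)
    (hgeom.mul_left (α * Real.exp (R + 1)))
  calc |x| ^ k / Real.Gamma (α * (k + 1))
      ≤ |x| ^ k * (α * (k + 1) * Real.exp (R + 1) * (R ^ (α * ((k : ℝ) + 1)))⁻¹) :=
        mul_le_mul_of_nonneg_left
          (inv_Gamma_le (Real.rpow_pos_of_pos hb _) (by positivity)) (by positivity)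
    _ = α * Real.exp (R + 1) * (k + 1) * (|x| ^ k * ((2 * |x| + 1) ^ (k + 1))⁻¹) := by
        rw [hRα]; ring
    _ ≤ α * Real.exp (R + 1) * (k + 1) * (1 / 2 : ℝ) ^ k := by gcongr; exact hratio k
    _ = α * Real.exp (R + 1) * ((k + 1) * (1 / 2 : ℝ) ^ k) := by ring

/-- The two-parameter Mittag-Leffler function `E_{α,α}(x) = ∑ xᵏ / Γ(αk + α)`. -/
def mittagLeffler (α x : ℝ) : ℝ := ∑' k : ℕ, x ^ k / Real.Gamma (α * (k + 1))

theorem norm_pow_div_Gamma {α : ℝ} (hα : 0 < α) (x : ℝ) (k : ℕ) :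
    ‖x ^ k / Real.Gamma (α * (k + 1))‖ = |x| ^ k / Real.Gamma (α * (k + 1)) := by
  have : 0 < Real.Gamma (α * (k + 1)) := Real.Gamma_pos_of_pos (by positivity)
  rw [norm_div, norm_pow, Real.norm_eq_abs, Real.norm_of_nonneg this.le]

theorem summable_mittagLeffler {α : ℝ} (hα : 0 < α) (x : ℝ) :
    Summable fun k : ℕ => x ^ k / Real.Gamma (α * (k + 1)) :=
  .of_norm (by simpa only [norm_pow_div_Gamma hα] using summable_pow_div_Gamma hα x)

theorem continuous_mittagLeffler {α : ℝ} (hα : 0 < α) : Continuous (mittagLeffler α) := by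
  refine continuous_iff_continuousAt.2 fun x => ?_
  have h : ContinuousOn (mittagLeffler α) (Metric.ball 0 (|x| + 1)) := by
    refine continuousOn_tsum (fun k => by fun_prop) (summable_pow_div_Gamma hα (|x| + 1))
      fun k y hy => ?_
    have hyx : |y| ≤ |(|x| + 1)| := (mem_ball_zero_iff.1 hy).le.trans (le_abs_self _)
    have : 0 < Real.Gamma (α * (k + 1)) := Real.Gamma_pos_of_pos (by positivity)
    rw [norm_pow_div_Gamma hα]
    gcongr
  exact h.continuousAt (Metric.isOpen_ball.mem_nhds (by simp))

/-- The resolvent kernel `P(t) = t^{α-1} E_{α,α}(-λ t^α)` of the Volterra operator with kernel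
`λ ω_α`. -/
def resP (α lam t : ℝ) : ℝ := t ^ (α - 1) * mittagLeffler α (-lam * t ^ α)

/-- The solution `E(t) = E_{α,1}(-λ t^α)` of `E + λ ω_α * E = 1`, written as
`1 - λ ∫₀ᵗ P(s) ds`. -/
def resE (α lam t : ℝ) : ℝ := 1 - lam * ∫ s in (0 : ℝ)..t, resP α lam s

section Resolvent

variable {α lam t : ℝ}

theorem continuous_mittagLeffler_comp (hα : 0 < α) :
    Continuous fun t : ℝ => mittagLeffler α (-lam * t ^ α) :=
  (continuous_mittagLeffler hα).comp
    (continuous_const.mul (Real.continuous_rpow_const hα.le))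

theorem continuousOn_resP (hα : 0 < α) : ContinuousOn (resP α lam) (Ioi 0) :=
  (continuousOn_id.rpow_const fun _ hs => Or.inl (ne_of_gt hs)).mul
    (continuous_mittagLeffler_comp hα).continuousOn

theorem continuousOn_mul_resP (hα : 0 < α) :
    ContinuousOn (fun s => s * resP α lam s) (Ici 0) := by
  have h : ContinuousOn (fun s : ℝ => s ^ α * mittagLeffler α (-lam * s ^ α)) (Ici 0) :=
    ((Real.continuous_rpow_const hα.le).mul (continuous_mittagLeffler_comp hα)).continuousOn
  refine h.congr fun s hs => ?_
  rcases (mem_Ici.1 hs).eq_or_lt with rfl | hs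
  · simp [Real.zero_rpow hα.ne']
  · simp only [resP]
    rw [Real.rpow_sub_one hs.ne']
    field_simp

theorem intervalIntegrable_resP (hα : 0 < α) (a b : ℝ) :
    IntervalIntegrable (resP α lam) volume a b :=
  (intervalIntegrable_rpow_sub_one hα a b).mul_continuousOn
    (continuous_mittagLeffler_comp hα).continuousOn

theorem continuous_resE (hα : 0 < α) : Continuous (resE α lam) :=
  continuous_const.sub (continuous_const.mul
    (intervalIntegral.continuous_primitive (intervalIntegrable_resP hα) 0))

theorem intervalIntegrable_omega_mul_resP (hα : 0 < α) (ht : 0 ≤ t) :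
    IntervalIntegrable (fun s => omega α (t - s) * resP α lam s) volume 0 t := by
  have h := ((intervalIntegrable_rpow_mul_rpow hα hα ht).mul_continuousOn
    (continuous_mittagLeffler_comp (lam := lam) hα).continuousOn).div_const (Real.Gamma α)
  refine h.congr fun s _ => ?_
  simp only [omega, resP]
  ring

theorem hasSum_resP (hα : 0 < α) (ht : 0 < t) :
    HasSum (fun k : ℕ => (-lam) ^ k * omega (α * (k + 1)) t) (resP α lam t) := by
  have h := (summable_mittagLeffler hα (-lam * t ^ α)).hasSum.mul_left (t ^ (α - 1))
  refine HasSum.congr_fun h fun k => ?_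
  have h1 : t ^ (α * ((k : ℝ) + 1) - 1) = t ^ (α - 1) * (t ^ α) ^ k := by
    rw [← Real.rpow_natCast, ← Real.rpow_mul ht.le, ← Real.rpow_add ht]
    ring_nf
  rw [omega, h1, mul_pow]
  ring

theorem hasSum_vconv_omega_resP (hα : 0 < α) (ht : 0 < t) :
    HasSum (fun k : ℕ => (-lam) ^ k * vconv (omega α) (omega (α * (k + 1))) t)
      (vconv (omega α) (resP α lam) t) := by
  have hterm : ∀ (c : ℝ) {s : ℝ}, s ∈ Ioc 0 t → HasSum (fun k : ℕ => c ^ k *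
      (omega α (t - s) * omega (α * (k + 1)) s)) (omega α (t - s) * resP α (-c) s) := by
    intro c s hs
    have h := (hasSum_resP (lam := -c) hα hs.1).mul_left (omega α (t - s))
    rw [neg_neg] at h
    exact h.congr_fun fun k => by ring
  have hk : ∀ k : ℕ, 0 < α * ((k : ℝ) + 1) := fun k => by positivity
  simp only [vconv, ← intervalIntegral.integral_const_mul]
  refine intervalIntegral.hasSum_integral_of_dominated_convergence
    (fun k s => |lam| ^ k * (omega α (t - s) * omega (α * (k + 1)) s)) (fun k => ?_)
    (fun k => .of_forall fun s hs => ?_) (.of_forall fun s hs => ?_) ?_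
    (.of_forall fun s hs => ?_)
  · refine Measurable.aestronglyMeasurable ?_
    unfold omega
    fun_prop
  · rw [uIoc_of_le ht.le] at hs
    rw [norm_mul, norm_pow, norm_neg, Real.norm_eq_abs, Real.norm_of_nonneg
      (mul_nonneg (omega_nonneg hα (sub_nonneg.2 hs.2)) (omega_nonneg (hk k) hs.1.le))]
  · exact (hterm |lam| (uIoc_of_le ht.le ▸ hs)).summable
  · refine (intervalIntegrable_omega_mul_resP (lam := -|lam|) hα ht.le).congr fun s hs => ?_
    exact (hterm |lam| (uIoc_of_le ht.le ▸ hs)).tsum_eq.symm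
  · have h := hterm (-lam) (uIoc_of_le ht.le ▸ hs)
    rwa [neg_neg] at h

theorem resP_add_vconv (hα : 0 < α) (ht : 0 < t) :
    resP α lam t + lam * vconv (omega α) (resP α lam) t = omega α t := by
  have h_tail : HasSum (fun k : ℕ => (-lam) ^ (k + 1) * omega (α * ((k + 1 : ℕ) + 1)) t)
      (-lam * vconv (omega α) (resP α lam) t) := by
    refine ((hasSum_vconv_omega_resP hα ht).mul_left (-lam)).congr_fun fun k => ?_
    have hk : 0 < α * ((k : ℝ) + 1) := by positivity
    rw [vconv_omega_omega hα hk ht, pow_succ]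
    push_cast
    ring_nf
  have h := ((hasSum_nat_add_iff' 1).2 (hasSum_resP hα ht)).unique h_tail
  simp only [Finset.range_one, Finset.sum_singleton, pow_zero, Nat.cast_zero, zero_add, mul_one,
    one_mul] at h
  linarith

theorem resE_eq_one_sub (t : ℝ) :
    resE α lam t = 1 - lam * vconv (fun _ => 1) (resP α lam) t := by
  rw [vconv_one_left, resE]

theorem vconv_one_resP_add (hα : 0 < α) (ht : 0 ≤ t) :
    vconv (fun _ => 1) (resP α lam) t
      + lam * vconv (fun _ => 1) (vconv (omega α) (resP α lam)) t
      = vconv (fun _ => 1) (omega α) t := by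
  have hP := intervalIntegrable_resP (lam := lam) hα 0 t
  have hωP := intervalIntegrable_vconv ht (intervalIntegrable_omega hα 0 t) hP
  rw [← vconv_const_mul_right, ← vconv_add_right (by simpa only [one_mul] using hP)
    (by simpa only [one_mul] using hωP.const_mul lam)]
  exact vconv_congr_right ht fun s hs => resP_add_vconv hα hs.1

theorem resE_add_vconv (hα : 0 < α) (ht : 0 ≤ t) :
    resE α lam t + lam * vconv (omega α) (resE α lam) t = 1 := by
  have hω := intervalIntegrable_omega hα 0 t
  have hP := intervalIntegrable_resP (lam := lam) hα 0 t
  have hcont : Continuous (vconv (fun _ => 1) (resP α lam)) := by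
    simpa only [funext (vconv_one_left (resP α lam))] using
      intervalIntegral.continuous_primitive (intervalIntegrable_resP hα) 0
  have hωE : vconv (omega α) (resE α lam) t = vconv (omega α) (fun _ => 1) t
      - lam * vconv (omega α) (vconv (fun _ => 1) (resP α lam)) t := by
    have hE : resE α lam = fun s => 1 + -lam * vconv (fun _ => 1) (resP α lam) s :=
      funext fun s => by rw [resE_eq_one_sub]; ring
    rw [hE, vconv_add_right (h₂ := fun s => -lam * vconv (fun _ => 1) (resP α lam) s)
      (intervalIntegrable_vconv_right hω continuousOn_const)
      (intervalIntegrable_vconv_right hω (continuous_const.mul hcont).continuousOn),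
      vconv_const_mul_right]
    ring
  have hcomm : vconv (omega α) (vconv (fun _ => 1) (resP α lam)) t
      = vconv (fun _ => 1) (vconv (omega α) (resP α lam)) t := by
    rw [vconv_assoc_one ht hω hP, vconv_one_assoc ht hω hP,
      funext (vconv_comm (omega α) (fun _ => 1))]
  rw [hωE, hcomm, vconv_comm (omega α), ← vconv_one_resP_add (lam := lam) hα ht, resE_eq_one_sub]
  ring

end Resolvent

/-! ### Positivity and decay of the resolvents -/

section Positivity

open Filter Topology

theorem omega_le_omega {α s t : ℝ} (hα : 0 < α) (hα₁ : α ≤ 1) (hs : 0 < s) (hst : s ≤ t) :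
    omega α t ≤ omega α s :=
  div_le_div_of_nonneg_right (Real.rpow_le_rpow_of_nonpos hs hst (by linarith))
    (Real.Gamma_pos_of_pos hα).le

theorem omega_mul_omega_sub_le {α s t u : ℝ} (hα : 0 < α) (hα₁ : α ≤ 1) (hs : 0 < s)
    (hst : s < t) (htu : t ≤ u) :
    omega α t * omega α (u - s) ≤ omega α u * omega α (t - s) := by
  have hts : 0 < t - s := sub_pos.2 hst
  have hus : 0 < u - s := by linarith
  have h : (t * (u - s)) ^ (α - 1) ≤ (u * (t - s)) ^ (α - 1) :=
    Real.rpow_le_rpow_of_nonpos (mul_pos (by linarith) hts) (by nlinarith) (by linarith)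
  rw [Real.mul_rpow (by linarith) hus.le, Real.mul_rpow (by linarith) hts.le] at h
  simp only [omega, div_mul_div_comm]
  gcongr

theorem exists_first_nonpos {y : ℝ → ℝ} {t : ℝ} (hy : ContinuousOn y (Ioi 0))
    (hnear : ∀ᶠ s in 𝓝[>] 0, 0 < y s) (ht : 0 < t) (hyt : y t ≤ 0) :
    ∃ t₀ > 0, y t₀ ≤ 0 ∧ ∀ s ∈ Ioo 0 t₀, 0 < y s := by
  obtain ⟨δ, hδ : 0 < δ, hδy⟩ := mem_nhdsGT_iff_exists_Ioo_subset.1 hnear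
  have hδt : δ ≤ t := not_lt.1 fun h => hyt.not_gt (hδy ⟨ht, h⟩)
  have hclosed : IsClosed (Icc δ t ∩ y ⁻¹' Iic 0) :=
    (hy.mono fun s hs => hδ.trans_le hs.1).preimage_isClosed_of_isClosed isClosed_Icc isClosed_Iic
  have hbdd : BddBelow (Icc δ t ∩ y ⁻¹' Iic 0) := bddBelow_Icc.mono inter_subset_left
  obtain ⟨hmem, hy₀⟩ := hclosed.csInf_mem ⟨t, ⟨hδt, le_rfl⟩, hyt⟩ hbdd
  refine ⟨_, hδ.trans_le hmem.1, hy₀, fun s hs => not_le.1 fun hys => ?_⟩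
  have hδs : δ ≤ s := not_lt.1 fun h => hys.not_gt (hδy ⟨hs.1, h⟩)
  exact hs.2.not_ge (csInf_le hbdd ⟨⟨hδs, hs.2.le.trans hmem.2⟩, hys⟩)

variable {α lam : ℝ} {y h : ℝ → ℝ}

/- Comparing the equation at `t` with `ω_α(t) / ω_α(t₀)` times the equation at `t₀` removes the
integral over `(0, t)`, since `ω_α(t - s) / ω_α(t₀ - s)` is at least that factor. -/
theorem le_mul_integral_of_volterra (hα : 0 < α) (hα₁ : α ≤ 1) (hlam : 0 ≤ lam)
    (hint : ∀ t > 0, IntervalIntegrable (fun s => omega α (t - s) * y s) volume 0 t)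
    (heq : ∀ t > 0, y t + lam * vconv (omega α) y t = h t)
    (hh : ∀ s t, 0 < s → s ≤ t → h s * omega α t ≤ h t * omega α s)
    {t t₀ : ℝ} (ht : 0 < t) (htt₀ : t ≤ t₀) (hy₀ : y t₀ ≤ 0) (hpos : ∀ s ∈ Ioo 0 t₀, 0 < y s) :
    omega α t₀ * y t ≤ lam * (omega α t * ∫ s in t..t₀, omega α (t₀ - s) * y s) := by
  have ht₀ : 0 < t₀ := ht.trans_le htt₀
  have hi := hint t₀ ht₀
  have hi₁ : IntervalIntegrable (fun s => omega α (t₀ - s) * y s) volume 0 t :=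
    hi.mono_set (uIcc_subset_uIcc_left (by simp [uIcc_of_le ht₀.le, ht.le, htt₀]))
  have hi₂ : IntervalIntegrable (fun s => omega α (t₀ - s) * y s) volume t t₀ :=
    hi.mono_set (uIcc_subset_uIcc_right (by simp [uIcc_of_le ht₀.le, ht.le, htt₀]))
  have hsplit := intervalIntegral.integral_add_adjacent_intervals hi₁ hi₂
  have hcompare : omega α t * ∫ s in (0 : ℝ)..t, omega α (t₀ - s) * y s
      ≤ omega α t₀ * vconv (omega α) y t := by
    rw [vconv, ← intervalIntegral.integral_const_mul, ← intervalIntegral.integral_const_mul]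
    refine intervalIntegral.integral_mono_on_of_le_Ioo ht.le (hi₁.const_mul _)
      ((hint t ht).const_mul _) fun s hs => ?_
    rw [← mul_assoc, ← mul_assoc]
    exact mul_le_mul_of_nonneg_right (omega_mul_omega_sub_le hα hα₁ hs.1 hs.2 htt₀)
      (hpos s ⟨hs.1, hs.2.trans_le htt₀⟩).le
  have heq₀ := heq t₀ ht₀
  rw [vconv, ← hsplit] at heq₀
  have hω := mul_nonpos_of_nonneg_of_nonpos (omega_pos hα ht).le hy₀
  linear_combination omega α t₀ * heq t ht - omega α t * heq₀ + hh t t₀ ht htt₀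
    + lam * hcompare + hω

theorem eventually_volterra_contraction (hα : 0 < α) {t₀ : ℝ} (ht₀ : 0 < t₀) :
    ∀ᶠ t in 𝓝[<] t₀, lam * (omega α t * ((t₀ - t) ^ α / α / Real.Gamma α)) < omega α t₀ := by
  have hω : ContinuousAt (omega α) t₀ :=
    (Real.continuousAt_rpow_const _ _ (Or.inl ht₀.ne')).div_const _
  have hpow : ContinuousAt (fun t => (t₀ - t) ^ α) t₀ :=
    (continuousAt_const.sub continuousAt_id).rpow_const (Or.inr hα.le)
  have hlim : ContinuousAt (fun t => lam * (omega α t * ((t₀ - t) ^ α / α / Real.Gamma α))) t₀ :=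
    continuousAt_const.mul (hω.mul ((hpow.div_const _).div_const _))
  refine (hlim.eventually (gt_mem_nhds ?_)).filter_mono nhdsWithin_le_nhds
  simpa [Real.zero_rpow hα.ne'] using omega_pos hα ht₀

theorem volterra_pos (hα : 0 < α) (hα₁ : α ≤ 1) (hlam : 0 ≤ lam) (hy : ContinuousOn y (Ioi 0))
    (hint : ∀ t > 0, IntervalIntegrable (fun s => omega α (t - s) * y s) volume 0 t)
    (heq : ∀ t > 0, y t + lam * vconv (omega α) y t = h t)
    (hh : ∀ s t, 0 < s → s ≤ t → h s * omega α t ≤ h t * omega α s)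
    (hnear : ∀ᶠ s in 𝓝[>] 0, 0 < y s) {t : ℝ} (ht : 0 < t) : 0 < y t := by
  by_contra! hyt
  obtain ⟨t₀, ht₀, hy₀, hpos⟩ := exists_first_nonpos hy hnear ht hyt
  obtain ⟨t₁, ht₁, hcontr⟩ := (mem_nhdsLT_iff_exists_mem_Ico_Ioo_subset ht₀).1
    (eventually_volterra_contraction (lam := lam) hα ht₀)
  obtain ⟨t₂, ht₁₂, ht₂⟩ := exists_between ht₁.2
  have ht₂0 : 0 < t₂ := ht₁.1.trans_lt ht₁₂
  obtain ⟨m, hm, hmax⟩ := isCompact_Icc.exists_isMaxOn (nonempty_Icc.2 ht₂.le)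
    (hy.mono fun s (hs : s ∈ Icc t₂ t₀) => ht₂0.trans_le hs.1)
  have hym : 0 < y m := (hpos t₂ ⟨ht₂0, ht₂⟩).trans_le (hmax ⟨le_rfl, ht₂.le⟩)
  have hm0 : 0 < m := ht₂0.trans_le hm.1
  have hmt₀ : m < t₀ := hm.2.lt_of_ne fun h => (h ▸ hym).not_ge hy₀
  have hi : IntervalIntegrable (fun s => omega α (t₀ - s) * y s) volume m t₀ :=
    (hint t₀ ht₀).mono_set (uIcc_subset_uIcc_right (by simp [uIcc_of_le ht₀.le, hm0.le, hm.2]))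
  have hω : IntervalIntegrable (fun s => omega α (t₀ - s)) volume m t₀ :=
    (intervalIntegrable_sub_rpow_sub_one hα t₀ m t₀).div_const _
  have hbound : ∫ s in m..t₀, omega α (t₀ - s) * y s
      ≤ (t₀ - m) ^ α / α / Real.Gamma α * y m := by
    rw [← integral_sub_rpow_sub_one hα, ← intervalIntegral.integral_div,
      ← intervalIntegral.integral_mul_const]
    exact intervalIntegral.integral_mono_on hm.2 hi (hω.mul_const _) fun s hs =>
      mul_le_mul_of_nonneg_left (hmax ⟨hm.1.trans hs.1, hs.2⟩)
        (omega_nonneg hα (sub_nonneg.2 hs.2))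
  have hle := le_mul_integral_of_volterra hα hα₁ hlam hint heq hh hm0 hm.2 hy₀ hpos
  refine lt_irrefl (omega α t₀ * y m) (hle.trans_lt ?_)
  calc lam * (omega α m * ∫ s in m..t₀, omega α (t₀ - s) * y s)
      ≤ lam * (omega α m * ((t₀ - m) ^ α / α / Real.Gamma α * y m)) :=
        mul_le_mul_of_nonneg_left
          (mul_le_mul_of_nonneg_left hbound (omega_pos hα hm0).le) hlam
    _ = lam * (omega α m * ((t₀ - m) ^ α / α / Real.Gamma α)) * y m := by ring
    _ < omega α t₀ * y m :=
        mul_lt_mul_of_pos_right (hcontr ⟨ht₁₂.trans_le hm.1, hmt₀⟩) hym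

theorem resP_pos (hα : 0 < α) (hα₁ : α ≤ 1) (hlam : 0 ≤ lam) {t : ℝ} (ht : 0 < t) :
    0 < resP α lam t := by
  refine volterra_pos hα hα₁ hlam (continuousOn_resP hα)
    (fun s hs => intervalIntegrable_omega_mul_resP hα hs.le) (fun s hs => resP_add_vconv hα hs)
    (fun s t _ _ => (mul_comm _ _).le) ?_ ht
  have hML : ∀ᶠ s in 𝓝 (0 : ℝ), 0 < mittagLeffler α (-lam * s ^ α) := by
    refine (continuous_mittagLeffler_comp hα).continuousAt.eventually (lt_mem_nhds ?_)
    beta_reduce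
    rw [Real.zero_rpow hα.ne', mul_zero, mittagLeffler, tsum_eq_single 0 fun k hk => by simp [hk]]
    simpa using Real.Gamma_pos_of_pos hα
  filter_upwards [hML.filter_mono nhdsWithin_le_nhds, self_mem_nhdsWithin] with s hs h0
  exact mul_pos (Real.rpow_pos_of_pos h0 _) hs

theorem resE_pos (hα : 0 < α) (hα₁ : α ≤ 1) (hlam : 0 ≤ lam) {t : ℝ} (ht : 0 < t) :
    0 < resE α lam t := by
  refine volterra_pos hα hα₁ hlam (continuous_resE hα).continuousOn
    (fun s _ => intervalIntegrable_vconv_right (intervalIntegrable_omega hα 0 s)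
      (continuous_resE hα).continuousOn)
    (fun s hs => resE_add_vconv hα hs.le) (fun r s hr hrs => ?_) ?_ ht
  · simpa only [one_mul] using omega_le_omega hα hα₁ hr hrs
  · refine ((continuous_resE hα).continuousAt.eventually (lt_mem_nhds ?_)).filter_mono
      nhdsWithin_le_nhds
    simp [resE]

end Positivity

section Decay

variable {α lam t : ℝ}

theorem resP_le_omega (hα : 0 < α) (hα₁ : α ≤ 1) (hlam : 0 ≤ lam) (ht : 0 < t) :
    resP α lam t ≤ omega α t := by
  have h : 0 ≤ vconv (omega α) (resP α lam) t := by
    rw [vconv, intervalIntegral.integral_of_le ht.le]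
    exact setIntegral_nonneg measurableSet_Ioc fun s hs =>
      mul_nonneg (omega_nonneg hα (sub_nonneg.2 hs.2)) (resP_pos hα hα₁ hlam hs.1).le
  linarith [resP_add_vconv (lam := lam) hα ht, mul_nonneg hlam h]

theorem antitoneOn_resE (hα : 0 < α) (hα₁ : α ≤ 1) (hlam : 0 ≤ lam) :
    AntitoneOn (resE α lam) (Ici 0) := by
  intro s (hs : 0 ≤ s) t _ hst
  have h : ∫ x in (0 : ℝ)..s, resP α lam x ≤ ∫ x in (0 : ℝ)..t, resP α lam x := by
    refine intervalIntegral.integral_mono_interval le_rfl hs hst ?_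
      (intervalIntegrable_resP hα 0 t)
    filter_upwards [ae_restrict_mem measurableSet_Ioc] with x hx
    exact (resP_pos hα hα₁ hlam hx.1).le
  exact sub_le_sub_left (mul_le_mul_of_nonneg_left h hlam) 1

theorem resE_le_one (hα : 0 < α) (hα₁ : α ≤ 1) (hlam : 0 ≤ lam) (ht : 0 ≤ t) :
    resE α lam t ≤ 1 := by
  simpa [resE] using antitoneOn_resE hα hα₁ hlam (mem_Ici.2 le_rfl) ht ht

theorem lam_mul_rpow_mul_resE_le (hα : 0 < α) (hα₁ : α ≤ 1) (hlam : 0 ≤ lam) (ht : 0 < t) :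
    lam * t ^ α * resE α lam t ≤ Real.Gamma (α + 1) := by
  have hω := intervalIntegrable_omega hα 0 t
  have h1 : vconv (fun _ => 1) (omega α) t * resE α lam t ≤ vconv (omega α) (resE α lam) t := by
    rw [vconv_comm, vconv, vconv, ← intervalIntegral.integral_mul_const]
    refine intervalIntegral.integral_mono_on_of_le_Ioo ht.le
      ((intervalIntegrable_vconv_right hω continuousOn_const).mul_const _)
      (intervalIntegrable_vconv_right hω (continuous_resE hα).continuousOn) fun s hs => ?_
    rw [mul_one]
    exact mul_le_mul_of_nonneg_left
      (antitoneOn_resE hα hα₁ hlam hs.1.le (mem_Ici.2 ht.le) hs.2.le)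
      (omega_nonneg hα (sub_nonneg.2 hs.2.le))
  have h2 : lam * (vconv (fun _ => 1) (omega α) t * resE α lam t) ≤ 1 := by
    linarith [resE_add_vconv (lam := lam) hα ht.le, resE_pos hα hα₁ hlam ht,
      mul_le_mul_of_nonneg_left h1 hlam]
  rw [vconv_one_omega hα ht] at h2
  rw [← div_le_one (Real.Gamma_pos_of_pos (by linarith))]
  linear_combination h2

theorem mul_resP_add_vconv (hα : 0 < α) (ht : 0 < t) :
    t * resP α lam t + lam * vconv (omega α) (fun s => s * resP α lam s) t
      = vconv (fun _ => 1) (fun s => α * resP α lam s) t := by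
  have hω := intervalIntegrable_omega hα 0 t
  have hP := intervalIntegrable_resP (lam := lam) hα 0 t
  have hωP := intervalIntegrable_omega_mul_resP (lam := lam) hα ht.le
  have hprod : t * vconv (omega α) (resP α lam) t
      = vconv (fun s => s * omega α s) (resP α lam) t
        + vconv (omega α) (fun s => s * resP α lam s) t := by
    refine mul_vconv ?_ (intervalIntegrable_vconv_right hω
      ((continuousOn_mul_resP hα).mono (by rw [uIcc_of_le ht.le]; exact Icc_subset_Ici_self)))
    simpa only [mul_assoc] using hωP.continuousOn_mul (g := fun s => t - s) (by fun_prop)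
  have hsω : vconv (fun s => s * omega α s) (resP α lam) t
      = α * vconv (fun _ => 1) (vconv (omega α) (resP α lam)) t := by
    rw [vconv_congr_left ht.le fun s hs => mul_omega_eq hα hs.1, vconv_const_mul_left,
      vconv_one_assoc ht.le hω hP]
  rw [vconv_const_mul_right]
  linear_combination t * resP_add_vconv (lam := lam) hα ht - lam * hprod - lam * hsω
    + mul_omega_eq hα ht - α * vconv_one_resP_add (lam := lam) hα ht.le

end Decay

section Solution

variable {α lam t : ℝ}

theorem lam_mul_vconv_resP_vconv_omega (hα : 0 < α) (ht : 0 < t) {z : ℝ → ℝ}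
    (hz : ContinuousOn z (Icc 0 t)) :
    lam * vconv (resP α lam) (vconv (omega α) z) t
      = vconv (omega α) z t - vconv (resP α lam) z t := by
  have hP := intervalIntegrable_resP (lam := lam) hα 0 t
  have hω := intervalIntegrable_omega hα 0 t
  have hz' : ContinuousOn z (uIcc 0 t) := by rwa [uIcc_of_le ht.le]
  obtain ⟨C, hC⟩ := isCompact_Icc.exists_bound_of_continuousOn hz
  rw [vconv_assoc_of_bdd_right ht.le hP hω hz'.intervalIntegrable (C := C)
      fun s hs => hC s ⟨hs.1.le, hs.2⟩,
    ← vconv_sub_left (intervalIntegrable_vconv_right hω hz')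
      (intervalIntegrable_vconv_right hP hz'), ← vconv_const_mul_left]
  refine vconv_congr_left ht.le fun s hs => ?_
  rw [vconv_comm]
  linarith [resP_add_vconv (lam := lam) hα hs.1]

theorem lam_mul_vconv_resP_one (t : ℝ) :
    lam * vconv (resP α lam) (fun _ => 1) t = 1 - resE α lam t := by
  rw [vconv_comm, resE_eq_one_sub]
  ring

theorem lam_mul_vconv_resP_vconv_one (hα : 0 < α) (ht : 0 ≤ t) {χ : ℝ → ℝ}
    (hχ : IntervalIntegrable χ volume 0 t) :
    lam * vconv (resP α lam) (vconv (fun _ => 1) χ) t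
      = vconv (fun _ => 1) χ t - vconv (resE α lam) χ t := by
  rw [vconv_assoc_one ht (intervalIntegrable_resP hα 0 t) hχ,
    ← vconv_sub_left (by simpa only [one_mul] using hχ)
      (intervalIntegrable_vconv_left (continuous_resE hα) hχ), ← vconv_const_mul_left]
  exact vconv_congr_left ht fun s _ => lam_mul_vconv_resP_one s

theorem intervalIntegrable_vconv_vconv {k₁ k₂ z : ℝ → ℝ} (ht : 0 ≤ t)
    (h₁ : IntervalIntegrable k₁ volume 0 t) (h₂ : IntervalIntegrable k₂ volume 0 t)
    (hz : ContinuousOn z (Icc 0 t)) :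
    IntervalIntegrable (fun s => k₁ (t - s) * vconv k₂ z s) volume 0 t := by
  obtain ⟨C, hC⟩ := isCompact_Icc.exists_bound_of_continuousOn hz
  have hz' : IntervalIntegrable z volume 0 t := (uIcc_of_le ht ▸ hz).intervalIntegrable
  have h := integrable_tri_bdd_mul (f := fun _ r => z r) (C := C)
    (integrable_tri_left ht (intervalIntegrable_comp_sub h₁) h₂)
    (aestronglyMeasurable_of_intervalIntegrable ht hz').comp_snd
    (fun s r h1 h2 h3 => hC r ⟨h1.le, h2.le.trans h3⟩)
  refine (intervalIntegrable_tri_fst ht h).congr fun s _ => ?_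
  rw [vconv, ← intervalIntegral.integral_const_mul]
  exact intervalIntegral.integral_congr fun r _ => by ring

/- Convolving the equation with `P` and eliminating `P * y` gives the formula, because
`λ P * ω_α = ω_α - P` and `λ P * 1 = 1 - E`. -/
theorem eq_of_volterra (hα : 0 < α) {y₀ : ℝ} (ht : 0 < t) {y φ χ : ℝ → ℝ}
    (hy : ContinuousOn y (Icc 0 t)) (hφ : ContinuousOn φ (Icc 0 t))
    (hχ : IntervalIntegrable χ volume 0 t)
    (heq : ∀ s ∈ Ioc 0 t, y s + lam * vconv (omega α) y s
      = y₀ + vconv (omega α) φ s + vconv (fun _ => 1) χ s) :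
    y t = y₀ * resE α lam t + vconv (resP α lam) φ t + vconv (resE α lam) χ t := by
  have hP := intervalIntegrable_resP (lam := lam) hα 0 t
  have hω := intervalIntegrable_omega hα 0 t
  have hy' : ContinuousOn y (uIcc 0 t) := by rwa [uIcc_of_le ht.le]
  have hχcont : ContinuousOn (vconv (fun _ => 1) χ) (uIcc 0 t) := by
    simpa only [funext (vconv_one_left χ)] using
      intervalIntegral.continuousOn_primitive_interval' hχ left_mem_uIcc
  have hPy₀ : IntervalIntegrable (fun s => resP α lam (t - s) * (y₀ * 1)) volume 0 t :=
    intervalIntegrable_vconv_right hP continuousOn_const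
  have hPωφ := intervalIntegrable_vconv_vconv ht.le hP hω hφ
  have hconv : vconv (resP α lam) y t + lam * vconv (resP α lam) (vconv (omega α) y) t
      = y₀ * vconv (resP α lam) (fun _ => 1) t + vconv (resP α lam) (vconv (omega α) φ) t
        + vconv (resP α lam) (vconv (fun _ => 1) χ) t := by
    rw [← vconv_const_mul_right, ← vconv_const_mul_right, ← vconv_add_right
        (intervalIntegrable_vconv_right hP hy') (by
          simpa only [mul_left_comm] using
            (intervalIntegrable_vconv_vconv ht.le hP hω hy).const_mul lam),
      ← vconv_add_right hPy₀ hPωφ,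
      ← vconv_add_right (by simpa only [mul_add] using hPy₀.add hPωφ)
        (intervalIntegrable_vconv_right hP hχcont)]
    exact vconv_congr_right ht.le fun s hs => by simpa only [mul_one] using heq s hs
  linear_combination heq t ⟨ht, le_rfl⟩ - lam * hconv
    + lam * lam_mul_vconv_resP_vconv_omega (lam := lam) hα ht hy
    - y₀ * lam_mul_vconv_resP_one (α := α) (lam := lam) t
    - lam_mul_vconv_resP_vconv_omega (lam := lam) hα ht hφ
    - lam_mul_vconv_resP_vconv_one (lam := lam) hα ht.le hχ

theorem mul_resP_eq (hα : 0 < α) (ht : 0 < t) :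
    t * resP α lam t = vconv (resE α lam) (fun s => α * resP α lam s) t := by
  have h := eq_of_volterra (lam := lam) hα (y₀ := 0) ht (φ := fun _ => 0)
    (χ := fun s => α * resP α lam s)
    ((continuousOn_mul_resP (lam := lam) hα).mono Icc_subset_Ici_self) continuousOn_const
    ((intervalIntegrable_resP hα 0 t).const_mul α) fun s hs => by
      rw [mul_resP_add_vconv hα hs.1]
      simp [vconv.eq_1 (omega α)]
  simpa [vconv.eq_1 (resP α lam)] using h

theorem lam_mul_mul_resP_le (hα : 0 < α) (hα₁ : α ≤ 1) (hlam : 0 ≤ lam) (ht : 0 < t) :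
    lam * (t * resP α lam t) ≤ α := by
  have hP := (intervalIntegrable_resP (lam := lam) hα 0 t).const_mul α
  have hle : t * resP α lam t ≤ α * ∫ s in (0 : ℝ)..t, resP α lam s := by
    rw [mul_resP_eq hα ht, vconv, ← intervalIntegral.integral_const_mul]
    refine intervalIntegral.integral_mono_on_of_le_Ioo ht.le
      (intervalIntegrable_vconv_left (continuous_resE hα) hP) hP fun s hs => ?_
    exact mul_le_of_le_one_left (mul_nonneg hα.le (resP_pos hα hα₁ hlam hs.1).le)
      (resE_le_one hα hα₁ hlam (sub_nonneg.2 hs.2.le))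
  have hE := resE_pos hα hα₁ hlam ht
  rw [resE] at hE
  linarith [mul_le_mul_of_nonneg_left hle hlam, mul_pos hα hE]

theorem sqrt_mul_resE_le (hα : 0 < α) (hα₁ : α ≤ 1) (hlam : 0 ≤ lam) (ht : 0 < t) :
    √lam * resE α lam t ≤ √(Real.Gamma (α + 1)) * t ^ (1 - α / 2 - 1) := by
  have hE := resE_pos hα hα₁ hlam ht
  have hΓ := Real.Gamma_pos_of_pos (show 0 < α + 1 by linarith)
  refine (sq_le_sq₀ (by positivity) (by positivity)).1 ?_
  rw [mul_pow, mul_pow, Real.sq_sqrt hlam, Real.sq_sqrt hΓ.le, ← Real.rpow_mul_natCast ht.le,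
    show (1 - α / 2 - 1) * ((2 : ℕ) : ℝ) = -α by push_cast; ring, Real.rpow_neg ht.le,
    ← div_eq_mul_inv, le_div_iff₀ (Real.rpow_pos_of_pos ht α)]
  calc lam * resE α lam t ^ 2 * t ^ α = lam * t ^ α * resE α lam t * resE α lam t := by ring
    _ ≤ lam * t ^ α * resE α lam t * 1 :=
      mul_le_mul_of_nonneg_left (resE_le_one hα hα₁ hlam ht.le) (by positivity)
    _ ≤ Real.Gamma (α + 1) := (mul_one _).trans_le (lam_mul_rpow_mul_resE_le hα hα₁ hlam ht)

theorem sqrt_mul_resP_le (hα : 0 < α) (hα₁ : α ≤ 1) (hlam : 0 ≤ lam) (ht : 0 < t) :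
    √lam * resP α lam t ≤ √(α / Real.Gamma α) * t ^ (α / 2 - 1) := by
  have hP := resP_pos hα hα₁ hlam ht
  have hsq : lam * (t * resP α lam t) * resP α lam t ≤ α * omega α t :=
    mul_le_mul (lam_mul_mul_resP_le hα hα₁ hlam ht) (resP_le_omega hα hα₁ hlam ht) hP.le hα.le
  refine (sq_le_sq₀ (by positivity) (by positivity)).1 ?_
  rw [mul_pow, mul_pow, Real.sq_sqrt hlam, Real.sq_sqrt (by positivity),
    ← Real.rpow_mul_natCast ht.le,
    show (α / 2 - 1) * ((2 : ℕ) : ℝ) = (α - 1) - 1 by push_cast; ring, Real.rpow_sub_one ht.ne',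
    mul_div_assoc', le_div_iff₀ ht]
  calc lam * resP α lam t ^ 2 * t = lam * (t * resP α lam t) * resP α lam t := by ring
    _ ≤ α * omega α t := hsq
    _ = α / Real.Gamma α * t ^ (α - 1) := by rw [omega]; ring

end Solution

/-! ### A weakly singular Gronwall inequality -/

section Gronwall

theorem rpow_sub_one_le {p q T x : ℝ} (hqp : q ≤ p) (hx : x ∈ Ioc 0 T) :
    x ^ (p - 1) ≤ T ^ (p - q) * x ^ (q - 1) := by
  rw [show p - 1 = (p - q) + (q - 1) by ring, Real.rpow_add hx.1]
  exact mul_le_mul_of_nonneg_right (Real.rpow_le_rpow hx.1.le hx.2 (sub_nonneg.2 hqp))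
    (Real.rpow_nonneg hx.1.le _)

theorem exp_neg_le_rpow_neg {x γ : ℝ} (hx : 0 < x) (hγ : 0 ≤ γ) (hγ₁ : γ ≤ 1) :
    Real.exp (-x) ≤ x ^ (-γ) := by
  rw [Real.exp_neg, Real.rpow_neg hx.le]
  refine inv_anti₀ (Real.rpow_pos_of_pos hx _) ?_
  rcases le_total x 1 with h | h
  · exact (Real.rpow_le_one hx.le h hγ).trans (Real.one_le_exp hx.le)
  · calc x ^ γ ≤ x ^ (1 : ℝ) := Real.rpow_le_rpow_of_exponent_le h hγ₁
      _ = x := Real.rpow_one x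
      _ ≤ Real.exp x := by linarith [Real.add_one_le_exp x]

theorem intervalIntegrable_rpow_mul_exp {b p σ t : ℝ} (hb : 0 < b) (hp : 0 < p) (ht : 0 ≤ t) :
    IntervalIntegrable (fun s => (t - s) ^ (b - 1) * (s ^ (p - 1) * Real.exp (σ * s)))
      volume 0 t := by
  have h := (intervalIntegrable_rpow_mul_rpow hb hp ht).mul_continuousOn
    (g := fun s => Real.exp (σ * s)) (by fun_prop)
  simpa only [mul_assoc] using h

/- The exponential weight buys the small factor `σ ^ (-γ)` at the price of a kernel that is more
singular by the order `γ`. -/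
theorem integral_rpow_mul_exp_le {b p γ σ t : ℝ} (hγ : 0 ≤ γ) (hγb : γ < b)
    (hb₁ : b ≤ 1) (hp : 0 < p) (hσ : 0 < σ) (ht : 0 < t) :
    ∫ s in (0 : ℝ)..t, (t - s) ^ (b - 1) * (s ^ (p - 1) * Real.exp (σ * s))
      ≤ Real.exp (σ * t) * σ ^ (-γ) * (t ^ (b - γ + p - 1) * ProbabilityTheory.beta (b - γ) p) := by
  rw [← integral_rpow_mul_rpow (sub_pos.2 hγb) hp ht, ← intervalIntegral.integral_const_mul]
  refine intervalIntegral.integral_mono_on_of_le_Ioo ht.le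
    (intervalIntegrable_rpow_mul_exp (hγ.trans_lt hγb) hp ht.le)
    ((intervalIntegrable_rpow_mul_rpow (sub_pos.2 hγb) hp ht.le).const_mul _) fun s hs => ?_
  have hts : 0 < t - s := sub_pos.2 hs.2
  have hexp : Real.exp (σ * s) ≤ Real.exp (σ * t) * (σ ^ (-γ) * (t - s) ^ (-γ)) := by
    rw [← Real.mul_rpow hσ.le hts.le]
    calc Real.exp (σ * s) = Real.exp (σ * t) * Real.exp (-(σ * (t - s))) := by
          rw [← Real.exp_add]
          ring_nf
      _ ≤ _ := mul_le_mul_of_nonneg_left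
          (exp_neg_le_rpow_neg (mul_pos hσ hts) hγ (hγb.le.trans hb₁)) (Real.exp_pos _).le
  have hs₀ := Real.rpow_nonneg hs.1.le (p - 1)
  calc (t - s) ^ (b - 1) * (s ^ (p - 1) * Real.exp (σ * s))
      ≤ (t - s) ^ (b - 1) * (s ^ (p - 1) *
        (Real.exp (σ * t) * (σ ^ (-γ) * (t - s) ^ (-γ)))) := by gcongr
    _ = Real.exp (σ * t) * σ ^ (-γ) * ((t - s) ^ (b - γ - 1) * s ^ (p - 1)) := by
        rw [show b - γ - 1 = (b - 1) + -γ by ring, Real.rpow_add hts]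
        ring

theorem exists_weighted_max {N : ℝ → ℝ} {p t : ℝ} (hp : p < 1) (ht : 0 ≤ t)
    (hN : ContinuousOn N (Icc 0 t)) (σ : ℝ) :
    ∃ q, 0 ≤ q ∧ (∀ s ∈ Ioc 0 t, N s ≤ q * (s ^ (p - 1) * Real.exp (σ * s))) ∧
      (q = 0 ∨ ∃ r ∈ Ioc 0 t, q * (r ^ (p - 1) * Real.exp (σ * r)) = N r) := by
  have hcont : ContinuousOn (fun s => s ^ (1 - p) * Real.exp (-(σ * s)) * N s) (Icc 0 t) :=
    ((Real.continuous_rpow_const (sub_nonneg.2 hp.le)).mul (by fun_prop)).continuousOn.mul hN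
  obtain ⟨r, hr, hmax⟩ := isCompact_Icc.exists_isMaxOn ⟨0, le_rfl, ht⟩ hcont
  have hinv : ∀ s, 0 < s → s ^ (1 - p) * Real.exp (-(σ * s)) * N s
      * (s ^ (p - 1) * Real.exp (σ * s)) = N s := fun s hs => by
    have hpow : s ^ (1 - p) * s ^ (p - 1) = 1 := by rw [← Real.rpow_add hs]; simp
    have hexp : Real.exp (-(σ * s)) * Real.exp (σ * s) = 1 := by rw [← Real.exp_add]; simp
    linear_combination N s * (Real.exp (-(σ * s)) * Real.exp (σ * s) * hpow + hexp)
  have hzero : (0 : ℝ) ^ (1 - p) * Real.exp (-(σ * 0)) * N 0 = 0 := by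
    simp [Real.zero_rpow (sub_pos.2 hp).ne']
  refine ⟨_, hzero.symm.trans_le (hmax ⟨le_rfl, ht⟩), fun s hs => ?_, ?_⟩
  · have hs₀ := Real.rpow_nonneg hs.1.le (p - 1)
    exact (hinv s hs.1).symm.trans_le
      (mul_le_mul_of_nonneg_right (hmax ⟨hs.1.le, hs.2⟩) (by positivity))
  · rcases hr.1.eq_or_lt with rfl | hr₀
    · exact .inl hzero
    · exact .inr ⟨r, ⟨hr₀, hr.2⟩, hinv r hr₀⟩

theorem exists_pos_mul_rpow_neg_le {γ : ℝ} (hγ : 0 < γ) {A : ℝ} (hA : 0 ≤ A) :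
    ∃ σ > 0, A * σ ^ (-γ) ≤ 1 / 2 := by
  refine ⟨(2 * A + 1) ^ γ⁻¹, by positivity, ?_⟩
  rw [Real.rpow_neg (by positivity), Real.rpow_inv_rpow (by positivity) hγ.ne', ← div_eq_mul_inv,
    div_le_div_iff₀ (by positivity) two_pos]
  linarith

theorem vconv_rpow_le_vconv_rpow {β t : ℝ} {N₁ N₂ : ℝ → ℝ} (ht : 0 ≤ t)
    (h₁ : IntervalIntegrable (fun s => (t - s) ^ (β - 1) * N₁ s) volume 0 t)
    (h₂ : IntervalIntegrable (fun s => (t - s) ^ (β - 1) * N₂ s) volume 0 t)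
    (hle : ∀ s ∈ Ioc 0 t, N₁ s ≤ N₂ s) :
    vconv (fun x => x ^ (β - 1)) N₁ t ≤ vconv (fun x => x ^ (β - 1)) N₂ t :=
  intervalIntegral.integral_mono_on_of_le_Ioo ht h₁ h₂ fun s hs =>
    mul_le_mul_of_nonneg_left (hle s ⟨hs.1, hs.2.le⟩) (Real.rpow_nonneg (sub_nonneg.2 hs.2.le) _)

theorem vconv_rpow_le_of_le_weight {β p q σ t : ℝ} {N : ℝ → ℝ} (hβ : 0 < β) (hβ₁ : β ≤ 1)
    (hp : 0 < p) (hσ : 0 < σ) (ht : 0 < t) (hq : 0 ≤ q) (hN : ContinuousOn N (Icc 0 t))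
    (hNq : ∀ s ∈ Ioc 0 t, N s ≤ q * (s ^ (p - 1) * Real.exp (σ * s))) :
    vconv (fun x => x ^ (β - 1)) N t ≤ q * (Real.exp (σ * t) * σ ^ (-(β / 2))
      * (t ^ (β / 2) * t ^ (p - 1) * ProbabilityTheory.beta (β / 2) p)) := by
  have hI := integral_rpow_mul_exp_le (half_pos hβ).le (half_lt_self hβ) hβ₁ hp hσ ht
  rw [sub_half, add_sub_assoc, Real.rpow_add ht] at hI
  have hw := intervalIntegrable_rpow_mul_exp (σ := σ) hβ hp ht.le
  have hN' : ContinuousOn N (uIcc 0 t) := by rwa [uIcc_of_le ht.le]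
  calc vconv (fun x => x ^ (β - 1)) N t
      ≤ vconv (fun x => x ^ (β - 1)) (fun s => q * (s ^ (p - 1) * Real.exp (σ * s))) t :=
        vconv_rpow_le_vconv_rpow ht.le
          (intervalIntegrable_vconv_right (intervalIntegrable_rpow_sub_one hβ 0 t) hN')
          ((hw.const_mul q).congr fun _ _ => by ring) hNq
    _ = q * vconv (fun x => x ^ (β - 1)) (fun s => s ^ (p - 1) * Real.exp (σ * s)) t :=
        vconv_const_mul_right _ _ _ _
    _ ≤ _ := mul_le_mul_of_nonneg_left hI hq

theorem exists_bound_of_le_add_vconv_rpow {β p b : ℝ} (hβ : 0 < β) (hβ₁ : β ≤ 1) (hp : 0 < p)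
    (hp₁ : p < 1) (hb : 0 ≤ b) (T : ℝ) :
    ∃ C, 0 ≤ C ∧ ∀ {t D : ℝ} {N : ℝ → ℝ}, t ∈ Ioc 0 T → 0 ≤ D → ContinuousOn N (Icc 0 t) →
      (∀ s ∈ Ioc 0 t, N s ≤ D * s ^ (p - 1) + b * vconv (fun x => x ^ (β - 1)) N s) →
      ∀ s ∈ Ioc 0 t, N s ≤ C * D * s ^ (p - 1) := by
  set B := ProbabilityTheory.beta (β / 2) p
  have hB : 0 < B := ProbabilityTheory.beta_pos (half_pos hβ) hp
  obtain ⟨σ, hσ, hσ₂⟩ := exists_pos_mul_rpow_neg_le (half_pos hβ) (A := b * B * |T| ^ (β / 2))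
    (by positivity)
  refine ⟨2 * Real.exp (σ * T), by positivity, fun {t D N} ht hD hN hle s hs => ?_⟩
  obtain ⟨q, hq, hNq, hmax⟩ := exists_weighted_max hp₁ ht.1.le hN σ
  have hqD : q ≤ 2 * D := by
    rcases hmax with rfl | ⟨r, hr, hrN⟩
    · positivity
    have hrp := Real.rpow_pos_of_pos hr.1 (p - 1)
    have hpow : r ^ (β / 2) ≤ |T| ^ (β / 2) :=
      Real.rpow_le_rpow hr.1.le (hr.2.trans (ht.2.trans (le_abs_self T))) (half_pos hβ).le
    have hconv := vconv_rpow_le_of_le_weight hβ hβ₁ hp hσ hr.1 hq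
      (hN.mono (Icc_subset_Icc_right hr.2)) fun s hs => hNq s ⟨hs.1, hs.2.trans hr.2⟩
    have hexp : 1 ≤ Real.exp (σ * r) := Real.one_le_exp (mul_pos hσ hr.1).le
    have hself : q * (r ^ (p - 1) * Real.exp (σ * r))
        ≤ (D + q / 2) * (r ^ (p - 1) * Real.exp (σ * r)) := by
      calc q * (r ^ (p - 1) * Real.exp (σ * r))
          ≤ D * r ^ (p - 1) + b * (q * (Real.exp (σ * r) * σ ^ (-(β / 2))
            * (r ^ (β / 2) * r ^ (p - 1) * B))) :=
            hrN.trans_le ((hle r hr).trans (by gcongr))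
        _ ≤ D * r ^ (p - 1) * Real.exp (σ * r) + b * (q * (Real.exp (σ * r) * σ ^ (-(β / 2))
            * (|T| ^ (β / 2) * r ^ (p - 1) * B))) := by
            refine add_le_add (le_mul_of_one_le_right (by positivity) hexp) ?_
            gcongr
        _ = (D + b * B * |T| ^ (β / 2) * σ ^ (-(β / 2)) * q)
            * (r ^ (p - 1) * Real.exp (σ * r)) := by ring
        _ ≤ (D + q / 2) * (r ^ (p - 1) * Real.exp (σ * r)) := by
            gcongr
            linarith [mul_le_mul_of_nonneg_right hσ₂ hq]
    linarith [le_of_mul_le_mul_right hself (by positivity)]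
  have hs₀ := Real.rpow_nonneg hs.1.le (p - 1)
  have hsT : s ≤ T := hs.2.trans ht.2
  calc N s ≤ q * (s ^ (p - 1) * Real.exp (σ * s)) := hNq s hs
    _ ≤ 2 * D * (s ^ (p - 1) * Real.exp (σ * T)) := by gcongr
    _ = 2 * Real.exp (σ * T) * D * s ^ (p - 1) := by ring

theorem vconv_rpow_add_vconv_rpow_le {β α T t : ℝ} {N : ℝ → ℝ} (hβ : 0 < β) (hα : 0 < α)
    (ht : t ∈ Ioc 0 T) (hN : ContinuousOn N (Icc 0 t)) (hN₀ : ∀ s ∈ Icc 0 t, 0 ≤ N s) :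
    vconv (fun x => x ^ (β - 1)) (fun s => N s + vconv (fun x => x ^ (α - 1)) N s) t
      ≤ (1 + T ^ α * ProbabilityTheory.beta β α) * vconv (fun x => x ^ (β - 1)) N t := by
  set B := ProbabilityTheory.beta β α
  have hB : 0 < B := ProbabilityTheory.beta_pos hβ hα
  have hβi := intervalIntegrable_rpow_sub_one hβ 0 t
  have hαi := intervalIntegrable_rpow_sub_one hα 0 t
  have hN' : ContinuousOn N (uIcc 0 t) := by rwa [uIcc_of_le ht.1.le]
  have hNβ := intervalIntegrable_vconv_right hβi hN'
  obtain ⟨C, hC⟩ := isCompact_Icc.exists_bound_of_continuousOn hN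
  have hdouble : vconv (fun x => x ^ (β - 1)) (vconv (fun x => x ^ (α - 1)) N) t
      ≤ T ^ α * B * vconv (fun x => x ^ (β - 1)) N t := by
    have hβα := intervalIntegrable_rpow_sub_one (add_pos hβ hα) 0 t
    have hker : vconv (vconv (fun x => x ^ (β - 1)) fun x => x ^ (α - 1)) N t
        = vconv (fun x => B * x ^ (β + α - 1)) N t :=
      vconv_congr_left ht.1.le fun s hs =>
        (integral_rpow_mul_rpow hβ hα hs.1).trans (mul_comm _ _)
    rw [vconv_assoc_of_bdd_right ht.1.le hβi hαi hN'.intervalIntegrable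
      fun s hs => hC s ⟨hs.1.le, hs.2⟩, hker, ← vconv_const_mul_left]
    refine intervalIntegral.integral_mono_on_of_le_Ioo ht.1.le
      (intervalIntegrable_vconv_right (hβα.const_mul B) hN')
      (intervalIntegrable_vconv_right (hβi.const_mul (T ^ α * B)) hN') fun s hs => ?_
    have hle := rpow_sub_one_le (T := T) (p := β + α) (q := β) (x := t - s) (by linarith)
      ⟨sub_pos.2 hs.2, by linarith [hs.1, ht.2]⟩
    rw [add_sub_cancel_left] at hle
    refine mul_le_mul_of_nonneg_right ?_ (hN₀ s ⟨hs.1.le, hs.2.le⟩)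
    linarith [mul_le_mul_of_nonneg_left hle hB.le]
  rw [vconv_add_right hNβ (intervalIntegrable_vconv_vconv ht.1.le hβi hαi hN)]
  linarith

end Gronwall

/-! ### A priori bounds for systems of Volterra equations -/

section KernelBound

variable {T α lam x : ℝ}

theorem sqrt_one_add_le (hlam : 0 ≤ lam) : √(1 + lam) ≤ 1 + √lam := by
  refine (Real.sqrt_le_left (by positivity)).2 ?_
  nlinarith [Real.sq_sqrt hlam, Real.sqrt_nonneg lam]

theorem sqrt_one_add_mul_resE_le (hα : 0 < α) (hα₁ : α ≤ 1) (hlam : 0 ≤ lam) (hx : x ∈ Ioc 0 T) :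
    √(1 + lam) * resE α lam x
      ≤ (T ^ (α / 2) + √(Real.Gamma (α + 1))) * x ^ (1 - α / 2 - 1) := by
  have hE := (resE_pos hα hα₁ hlam hx.1).le
  have hone : resE α lam x ≤ T ^ (α / 2) * x ^ (1 - α / 2 - 1) := by
    have h := rpow_sub_one_le (p := 1) (q := 1 - α / 2) (by linarith) hx
    rw [sub_self, Real.rpow_zero, sub_sub_cancel] at h
    exact (resE_le_one hα hα₁ hlam hx.1.le).trans h
  calc √(1 + lam) * resE α lam x ≤ (1 + √lam) * resE α lam x :=
        mul_le_mul_of_nonneg_right (sqrt_one_add_le hlam) hE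
    _ ≤ _ := by linarith [sqrt_mul_resE_le hα hα₁ hlam hx.1]

theorem sqrt_one_add_mul_resP_le (hα : 0 < α) (hα₁ : α ≤ 1) (hlam : 0 ≤ lam) (hx : x ∈ Ioc 0 T) :
    √(1 + lam) * resP α lam x
      ≤ (T ^ (α / 2) / Real.Gamma α + √(α / Real.Gamma α)) * x ^ (α / 2 - 1) := by
  have hω : resP α lam x ≤ T ^ (α / 2) / Real.Gamma α * x ^ (α / 2 - 1) := by
    have h := rpow_sub_one_le (p := α) (q := α / 2) (by linarith) hx
    rw [sub_half] at h
    rw [div_mul_eq_mul_div]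
    exact (resP_le_omega hα hα₁ hlam hx.1).trans
      (div_le_div_of_nonneg_right h (Real.Gamma_pos_of_pos hα).le)
  calc √(1 + lam) * resP α lam x ≤ (1 + √lam) * resP α lam x :=
        mul_le_mul_of_nonneg_right (sqrt_one_add_le hlam) (resP_pos hα hα₁ hlam hx.1).le
    _ ≤ _ := by linarith [sqrt_mul_resP_le hα hα₁ hlam hx.1]

/-- Bounds for the resolvent kernels, weighted by `√(1 + λ)` and uniform in `λ ≥ 0`. The second
bound for `E` is weaker than the first; it gives `E` and `P` a common kernel. -/
structure KernelBound (T α κ : ℝ) : Prop where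
  one_le : 1 ≤ κ
  resE_le : ∀ lam, 0 ≤ lam → ∀ x ∈ Ioc 0 T,
    √(1 + lam) * resE α lam x ≤ κ * x ^ (1 - α / 2 - 1)
  resE_le' : ∀ lam, 0 ≤ lam → ∀ x ∈ Ioc 0 T, √(1 + lam) * resE α lam x ≤ κ * x ^ (α / 2 - 1)
  resP_le : ∀ lam, 0 ≤ lam → ∀ x ∈ Ioc 0 T, √(1 + lam) * resP α lam x ≤ κ * x ^ (α / 2 - 1)

theorem exists_kernelBound (hT : 0 ≤ T) (hα : 0 < α) (hα₁ : α ≤ 1) : ∃ κ, KernelBound T α κ := by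
  set a := T ^ (α / 2) + √(Real.Gamma (α + 1))
  set b := T ^ (α / 2) / Real.Gamma α + √(α / Real.Gamma α)
  have ha : 0 ≤ a := by positivity
  have hb : 0 ≤ b := by positivity
  have haT : 0 ≤ a * T ^ (1 - α / 2 - α / 2) := by positivity
  refine ⟨1 + a + a * T ^ (1 - α / 2 - α / 2) + b, by linarith, fun lam hlam x hx => ?_,
    fun lam hlam x hx => ?_, fun lam hlam x hx => ?_⟩
  · exact (sqrt_one_add_mul_resE_le hα hα₁ hlam hx).trans
      (mul_le_mul_of_nonneg_right (by linarith) (Real.rpow_nonneg hx.1.le _))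
  · calc √(1 + lam) * resE α lam x ≤ a * x ^ (1 - α / 2 - 1) :=
          sqrt_one_add_mul_resE_le hα hα₁ hlam hx
      _ ≤ a * (T ^ (1 - α / 2 - α / 2) * x ^ (α / 2 - 1)) :=
          mul_le_mul_of_nonneg_left (rpow_sub_one_le (by linarith) hx) ha
      _ = a * T ^ (1 - α / 2 - α / 2) * x ^ (α / 2 - 1) := (mul_assoc _ _ _).symm
      _ ≤ _ := mul_le_mul_of_nonneg_right (by linarith) (Real.rpow_nonneg hx.1.le _)
  · exact (sqrt_one_add_mul_resP_le hα hα₁ hlam hx).trans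
      (mul_le_mul_of_nonneg_right (by linarith) (Real.rpow_nonneg hx.1.le _))

end KernelBound

theorem intervalIntegrable_of_mem_Ioc {E : Type*} [NormedAddCommGroup E] {h : ℝ → E} {t T : ℝ}
    (hh : IntervalIntegrable h volume 0 T) (ht : t ∈ Ioc 0 T) : IntervalIntegrable h volume 0 t :=
  hh.mono_set (uIcc_subset_uIcc_left (by simp [uIcc_of_le (ht.1.le.trans ht.2), ht.1.le, ht.2]))

section SqrtSum

variable {n : ℕ}

theorem sqrt_sum_add_sq_le (a b : Fin n → ℝ) :
    √(∑ j, (a j + b j) ^ 2) ≤ √(∑ j, a j ^ 2) + √(∑ j, b j ^ 2) := by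
  have h := norm_add_le (WithLp.toLp 2 a : EuclideanSpace ℝ (Fin n)) (WithLp.toLp 2 b)
  simpa [EuclideanSpace.norm_eq, sq_abs] using h

theorem sqrt_sum_sq_integral_le {F : Fin n → ℝ → ℝ} {m : ℝ → ℝ} {t : ℝ} (ht : 0 ≤ t)
    (hF : ∀ j, IntervalIntegrable (F j) volume 0 t) (hm : IntervalIntegrable m volume 0 t)
    (hle : ∀ s ∈ Ioo 0 t, √(∑ j, F j s ^ 2) ≤ m s) :
    √(∑ j, (∫ s in (0 : ℝ)..t, F j s) ^ 2) ≤ ∫ s in (0 : ℝ)..t, m s := by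
  set G : ℝ → EuclideanSpace ℝ (Fin n) := fun s => WithLp.toLp 2 fun j => F j s
  have hG : ∀ j, Integrable (fun s => G s j) (volume.restrict (Ioo 0 t)) := fun j =>
    (intervalIntegrable_iff_integrableOn_Ioo_of_le ht).1 (hF j)
  have hm' := (intervalIntegrable_iff_integrableOn_Ioo_of_le ht).1 hm
  have h : ‖∫ s in Ioo 0 t, G s‖ ≤ ∫ s in Ioo 0 t, m s :=
    norm_integral_le_of_norm_le hm' <| (ae_restrict_mem measurableSet_Ioo).mono fun s hs => by
      simpa only [G, EuclideanSpace.norm_eq, Real.norm_eq_abs, sq_abs] using hle s hs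
  simp only [EuclideanSpace.norm_eq, Real.norm_eq_abs, sq_abs, eval_integral_piLp hG] at h
  simpa only [intervalIntegral.integral_of_le ht, integral_Ioc_eq_integral_Ioo] using h

variable {H : Type*} [NormedAddCommGroup H] [InnerProductSpace ℝ H] {φ : Fin n → H}

theorem sqrt_sum_mul_inner_sq_le (hφ : Orthonormal ℝ φ) {k : Fin n → ℝ} {m : ℝ} (hm : 0 ≤ m)
    (hk : ∀ j, |k j| ≤ m) (x : H) :
    √(∑ j, (k j * inner ℝ x (φ j)) ^ 2) ≤ m * ‖x‖ := by
  refine (Real.sqrt_le_left (by positivity)).2 ?_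
  calc ∑ j, (k j * inner ℝ x (φ j)) ^ 2 ≤ ∑ j, m ^ 2 * ‖inner ℝ (φ j) x‖ ^ 2 := by
        refine Finset.sum_le_sum fun j _ => ?_
        rw [mul_pow, real_inner_comm, Real.norm_eq_abs, sq_abs]
        exact mul_le_mul_of_nonneg_right (sq_le_sq.2 ((hk j).trans (le_abs_self m))) (sq_nonneg _)
    _ = m ^ 2 * ∑ j, ‖inner ℝ (φ j) x‖ ^ 2 := by rw [Finset.mul_sum]
    _ ≤ m ^ 2 * ‖x‖ ^ 2 :=
        mul_le_mul_of_nonneg_left (hφ.sum_inner_products_le x) (sq_nonneg _)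
    _ = (m * ‖x‖) ^ 2 := (mul_pow m ‖x‖ 2).symm

theorem sqrt_sum_sq_vconv_inner_le (hφ : Orthonormal ℝ φ) {k : Fin n → ℝ → ℝ} {h : ℝ → H}
    {m b : ℝ → ℝ} {t : ℝ} (ht : 0 ≤ t)
    (hint : ∀ j, IntervalIntegrable (fun s => k j (t - s) * inner ℝ (h s) (φ j)) volume 0 t)
    (hmb : IntervalIntegrable (fun s => m (t - s) * b s) volume 0 t)
    (hm : ∀ x ∈ Ioo 0 t, 0 ≤ m x) (hk : ∀ j, ∀ x ∈ Ioo 0 t, |k j x| ≤ m x)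
    (hh : ∀ s ∈ Ioo 0 t, ‖h s‖ ≤ b s) :
    √(∑ j, vconv (k j) (fun s => inner ℝ (h s) (φ j)) t ^ 2) ≤ vconv m b t :=
  sqrt_sum_sq_integral_le ht hint hmb fun s hs => by
    have hts : t - s ∈ Ioo 0 t := ⟨sub_pos.2 hs.2, sub_lt_self t hs.1⟩
    exact (sqrt_sum_mul_inner_sq_le hφ (hm _ hts) (fun j => hk j _ hts) (h s)).trans
      (mul_le_mul_of_nonneg_left (hh s hs) (hm _ hts))

end SqrtSum

section System

variable {H : Type*} [NormedAddCommGroup H] [InnerProductSpace ℝ H]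

/-- A system of scalar Volterra equations
`yⱼ + λⱼ ω_α * yⱼ = ⟨u₀, φⱼ⟩ + ω_α * ⟨f, φⱼ⟩ + 1 * ⟨g + ψ, φⱼ⟩` on `(0, T]`, as satisfied by the
coordinates of a Galerkin solution in an eigenbasis. The terms `f` and `ψ`, which depend on the
solution, are controlled by `N`, and `N` by the `yⱼ`. -/
structure VolterraSystem {n : ℕ} (T α η c L M : ℝ) (φ : Fin n → H) (lam : Fin n → ℝ)
    (y : Fin n → ℝ → ℝ) (N : ℝ → ℝ) (u₀ : H) (f ψ g : ℝ → H) : Prop where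
  orthonormal : Orthonormal ℝ φ
  lam_nonneg : ∀ j, 0 ≤ lam j
  continuousOn_y : ∀ j, ContinuousOn (y j) (Icc 0 T)
  continuousOn_N : ContinuousOn N (Icc 0 T)
  N_nonneg : ∀ t ∈ Icc 0 T, 0 ≤ N t
  N_le : ∀ t ∈ Icc 0 T, N t ≤ c * √(∑ j, (√(1 + lam j) * y j t) ^ 2)
  continuousOn_f : ContinuousOn f (Icc 0 T)
  norm_f_le : ∀ s ∈ Ioc 0 T, ‖f s‖ ≤ L * N s
  norm_ψ_le : ∀ s ∈ Ioc 0 T, ‖ψ s‖ ≤ L * (N s + vconv (fun x => x ^ (α - 1)) N s)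
  intervalIntegrable_ψ : ∀ j, IntervalIntegrable (fun s => inner ℝ (ψ s) (φ j)) volume 0 T
  norm_g_le : ∀ s ∈ Ioc 0 T, ‖g s‖ ≤ M * s ^ (η - 1)
  intervalIntegrable_g : ∀ j, IntervalIntegrable (fun s => inner ℝ (g s) (φ j)) volume 0 T
  equation : ∀ j, ∀ t ∈ Ioc 0 T, y j t + lam j * vconv (omega α) (y j) t
    = inner ℝ u₀ (φ j) + vconv (omega α) (fun s => inner ℝ (f s) (φ j)) t
      + vconv (fun _ => 1) (fun s => inner ℝ (g s) (φ j) + inner ℝ (ψ s) (φ j)) t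

namespace VolterraSystem

variable {n : ℕ} {T α η c L M : ℝ} {φ : Fin n → H} {lam : Fin n → ℝ}
    {y : Fin n → ℝ → ℝ} {N : ℝ → ℝ} {u₀ : H} {f ψ g : ℝ → H} {t : ℝ}

theorem M_nonneg (hS : VolterraSystem T α η c L M φ lam y N u₀ f ψ g) (ht : t ∈ Ioc 0 T) :
    0 ≤ M :=
  nonneg_of_mul_nonneg_left ((norm_nonneg _).trans (hS.norm_g_le t ht))
    (Real.rpow_pos_of_pos ht.1 _)

theorem mul_y_eq (hS : VolterraSystem T α η c L M φ lam y N u₀ f ψ g) (hα : 0 < α)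
    (ht : t ∈ Ioc 0 T) (w : ℝ) (j : Fin n) :
    w * y j t = (w * resE α (lam j) t * inner ℝ u₀ (φ j)
        + vconv (fun x => w * resE α (lam j) x) (fun s => inner ℝ (g s) (φ j)) t)
      + (vconv (fun x => w * resP α (lam j) x) (fun s => inner ℝ (f s) (φ j)) t
        + vconv (fun x => w * resE α (lam j) x) (fun s => inner ℝ (ψ s) (φ j)) t) := by
  have hsub : Icc 0 t ⊆ Icc 0 T := Icc_subset_Icc_right ht.2
  have hgj := intervalIntegrable_of_mem_Ioc (hS.intervalIntegrable_g j) ht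
  have hψj := intervalIntegrable_of_mem_Ioc (hS.intervalIntegrable_ψ j) ht
  have hE : Continuous (resE α (lam j)) := continuous_resE hα
  rw [eq_of_volterra (lam := lam j) hα ht.1 ((hS.continuousOn_y j).mono hsub)
      ((hS.continuousOn_f.mono hsub).inner continuousOn_const) (hgj.add hψj)
      fun s hs => hS.equation j s ⟨hs.1, hs.2.trans ht.2⟩,
    vconv_add_right (intervalIntegrable_vconv_left hE hgj) (intervalIntegrable_vconv_left hE hψj),
    vconv_const_mul_left, vconv_const_mul_left, vconv_const_mul_left]
  ring

theorem sqrt_sum_sq_vconv_le (hS : VolterraSystem T α η c L M φ lam y N u₀ f ψ g) (hα : 0 < α)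
    (hL : 0 ≤ L) (ht : t ∈ Ioc 0 T) {k : Fin n → ℝ → ℝ} {h : ℝ → H} {κ : ℝ} (hκ : 0 ≤ κ)
    (hint : ∀ j, IntervalIntegrable (fun s => k j (t - s) * inner ℝ (h s) (φ j)) volume 0 t)
    (hk : ∀ j, ∀ x ∈ Ioc 0 T, |k j x| ≤ κ * x ^ (α / 2 - 1))
    (hh : ∀ s ∈ Ioc 0 T, ‖h s‖ ≤ L * (N s + vconv (fun x => x ^ (α - 1)) N s)) :
    √(∑ j, vconv (k j) (fun s => inner ℝ (h s) (φ j)) t ^ 2)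
      ≤ κ * L * (1 + T ^ α * ProbabilityTheory.beta (α / 2) α)
        * vconv (fun x => x ^ (α / 2 - 1)) N t := by
  have hN : ContinuousOn N (Icc 0 t) := hS.continuousOn_N.mono (Icc_subset_Icc_right ht.2)
  have hIoo : ∀ s ∈ Ioo 0 t, s ∈ Ioc 0 T := fun s hs => ⟨hs.1, hs.2.le.trans ht.2⟩
  have hβ := intervalIntegrable_rpow_sub_one (half_pos hα) 0 t
  have hβN := intervalIntegrable_vconv_right hβ (uIcc_of_le ht.1.le ▸ hN)
  have hβαN := intervalIntegrable_vconv_vconv ht.1.le hβ (intervalIntegrable_rpow_sub_one hα 0 t) hN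
  calc √(∑ j, vconv (k j) (fun s => inner ℝ (h s) (φ j)) t ^ 2)
      ≤ vconv (fun x => κ * x ^ (α / 2 - 1))
          (fun s => L * (N s + vconv (fun x => x ^ (α - 1)) N s)) t :=
        sqrt_sum_sq_vconv_inner_le hS.orthonormal ht.1.le hint
          (((hβN.add hβαN).const_mul (κ * L)).congr fun s _ => by ring)
          (fun x hx => mul_nonneg hκ (Real.rpow_nonneg hx.1.le _))
          (fun j x hx => hk j x (hIoo x hx)) fun s hs => hh s (hIoo s hs)
    _ = κ * L * vconv (fun x => x ^ (α / 2 - 1))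
          (fun s => N s + vconv (fun x => x ^ (α - 1)) N s) t := by
        rw [vconv_const_mul_left, vconv_const_mul_right, mul_assoc]
    _ ≤ _ := by
        rw [mul_assoc (κ * L)]
        exact mul_le_mul_of_nonneg_left (vconv_rpow_add_vconv_rpow_le (half_pos hα) hα ht hN
          fun s hs => hS.N_nonneg s ⟨hs.1, hs.2.trans ht.2⟩) (mul_nonneg hκ hL)

theorem sqrt_sum_sq_vconv_g_le (hS : VolterraSystem T α η c L M φ lam y N u₀ f ψ g) (hα : 0 < α)
    (hη : 0 < η) (ht : t ∈ Ioc 0 T) {w : Fin n → ℝ} {p κ : ℝ} (hp : 0 < p) (hκ : 0 ≤ κ)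
    (hE : ∀ j, ∀ x ∈ Ioc 0 T, |w j * resE α (lam j) x| ≤ κ * x ^ (p - 1)) :
    √(∑ j, vconv (fun x => w j * resE α (lam j) x) (fun s => inner ℝ (g s) (φ j)) t ^ 2)
      ≤ κ * M * (t ^ η * t ^ (p - 1) * ProbabilityTheory.beta p η) := by
  have hIoo : ∀ s ∈ Ioo 0 t, s ∈ Ioc 0 T := fun s hs => ⟨hs.1, hs.2.le.trans ht.2⟩
  calc √(∑ j, vconv (fun x => w j * resE α (lam j) x) (fun s => inner ℝ (g s) (φ j)) t ^ 2)
      ≤ vconv (fun x => κ * x ^ (p - 1)) (fun s => M * s ^ (η - 1)) t :=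
        sqrt_sum_sq_vconv_inner_le hS.orthonormal ht.1.le
          (fun j => intervalIntegrable_vconv_left (continuous_const.mul (continuous_resE hα))
            (intervalIntegrable_of_mem_Ioc (hS.intervalIntegrable_g j) ht))
          (((intervalIntegrable_rpow_mul_rpow hp hη ht.1.le).const_mul (κ * M)).congr
            fun s _ => by ring)
          (fun x hx => mul_nonneg hκ (Real.rpow_nonneg hx.1.le _))
          (fun j x hx => hE j x (hIoo x hx)) fun s hs => hS.norm_g_le s (hIoo s hs)
    _ = κ * M * (t ^ η * t ^ (p - 1) * ProbabilityTheory.beta p η) := by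
        rw [vconv_const_mul_left, vconv_const_mul_right, vconv, integral_rpow_mul_rpow hp hη ht.1,
          show p + η - 1 = η + (p - 1) by ring, Real.rpow_add ht.1]
        ring

theorem sqrt_sum_mul_sq_le (hS : VolterraSystem T α η c L M φ lam y N u₀ f ψ g) (hα : 0 < α)
    (hη : 0 < η) (hL : 0 ≤ L) (ht : t ∈ Ioc 0 T) {w : Fin n → ℝ} {p κ : ℝ} (hp : 0 < p)
    (hκ : 0 ≤ κ) (hE : ∀ j, ∀ x ∈ Ioc 0 T, |w j * resE α (lam j) x| ≤ κ * x ^ (p - 1))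
    (hE' : ∀ j, ∀ x ∈ Ioc 0 T, |w j * resE α (lam j) x| ≤ κ * x ^ (α / 2 - 1))
    (hP : ∀ j, ∀ x ∈ Ioc 0 T, |w j * resP α (lam j) x| ≤ κ * x ^ (α / 2 - 1)) :
    √(∑ j, (w j * y j t) ^ 2)
      ≤ κ * (1 + ProbabilityTheory.beta p η) * (‖u₀‖ + M * t ^ η) * t ^ (p - 1)
        + 2 * (κ * L * (1 + T ^ α * ProbabilityTheory.beta (α / 2) α))
          * vconv (fun x => x ^ (α / 2 - 1)) N t := by
  have hu₀ := sqrt_sum_mul_inner_sq_le hS.orthonormal (mul_nonneg hκ (Real.rpow_nonneg ht.1.le _))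
    (fun j => hE j t ht) u₀
  have hg := hS.sqrt_sum_sq_vconv_g_le hα hη ht hp hκ hE
  have hf := hS.sqrt_sum_sq_vconv_le hα hL ht hκ (k := fun j x => w j * resP α (lam j) x) (h := f)
    (fun j => intervalIntegrable_vconv_right ((intervalIntegrable_resP hα 0 t).const_mul (w j))
      (uIcc_of_le ht.1.le ▸ (hS.continuousOn_f.mono (Icc_subset_Icc_right ht.2)).inner
        continuousOn_const)) hP fun s hs => (hS.norm_f_le s hs).trans <|
          mul_le_mul_of_nonneg_left (le_add_of_nonneg_right
            (intervalIntegral.integral_nonneg hs.1.le fun r hr =>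
              mul_nonneg (Real.rpow_nonneg (sub_nonneg.2 hr.2) _)
              (hS.N_nonneg r ⟨hr.1, hr.2.trans hs.2⟩))) hL
  have hψ := hS.sqrt_sum_sq_vconv_le hα hL ht hκ (k := fun j x => w j * resE α (lam j) x) (h := ψ)
    (fun j => intervalIntegrable_vconv_left (continuous_const.mul (continuous_resE hα))
      (intervalIntegrable_of_mem_Ioc (hS.intervalIntegrable_ψ j) ht)) hE' hS.norm_ψ_le
  have hu₀g := mul_nonneg (mul_nonneg hκ (Real.rpow_nonneg ht.1.le (p - 1)))
    (add_nonneg (mul_nonneg (norm_nonneg u₀) (ProbabilityTheory.beta_pos hp hη).le)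
      (mul_nonneg (hS.M_nonneg ht) (Real.rpow_nonneg ht.1.le η)))
  simp only [hS.mul_y_eq hα ht (w _)]
  refine (sqrt_sum_add_sq_le _ _).trans ((add_le_add ((sqrt_sum_add_sq_le _ _).trans
    (add_le_add hu₀ hg)) ((sqrt_sum_add_sq_le _ _).trans (add_le_add hf hψ))).trans ?_)
  linarith

theorem N_le_add_vconv (hS : VolterraSystem T α η c L M φ lam y N u₀ f ψ g) {κ : ℝ}
    (hκ : KernelBound T α κ) (hα : 0 < α) (hα₁ : α ≤ 1) (hη : 0 < η) (hc : 0 ≤ c) (hL : 0 ≤ L)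
    (ht : t ∈ Ioc 0 T) :
    N t ≤ c * (κ * (1 + ProbabilityTheory.beta (1 - α / 2) η)) * (‖u₀‖ + M * t ^ η)
        * t ^ (1 - α / 2 - 1)
      + c * (2 * (κ * L * (1 + T ^ α * ProbabilityTheory.beta (α / 2) α)))
        * vconv (fun x => x ^ (α / 2 - 1)) N t := by
  have hE₀ : ∀ j, ∀ x ∈ Ioc 0 T, 0 ≤ √(1 + lam j) * resE α (lam j) x := fun j x hx =>
    mul_nonneg (Real.sqrt_nonneg _) (resE_pos hα hα₁ (hS.lam_nonneg j) hx.1).le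
  have hP₀ : ∀ j, ∀ x ∈ Ioc 0 T, 0 ≤ √(1 + lam j) * resP α (lam j) x := fun j x hx =>
    mul_nonneg (Real.sqrt_nonneg _) (resP_pos hα hα₁ (hS.lam_nonneg j) hx.1).le
  have h := hS.sqrt_sum_mul_sq_le hα hη hL ht (w := fun j => √(1 + lam j)) (p := 1 - α / 2)
    (by linarith) (zero_le_one.trans hκ.one_le)
    (fun j x hx => (abs_of_nonneg (hE₀ j x hx)).trans_le (hκ.resE_le _ (hS.lam_nonneg j) x hx))
    (fun j x hx => (abs_of_nonneg (hE₀ j x hx)).trans_le (hκ.resE_le' _ (hS.lam_nonneg j) x hx))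
    (fun j x hx => (abs_of_nonneg (hP₀ j x hx)).trans_le (hκ.resP_le _ (hS.lam_nonneg j) x hx))
  linarith [hS.N_le t ⟨ht.1.le, ht.2⟩, mul_le_mul_of_nonneg_left h hc]

theorem sqrt_sum_sq_le_of_N_le (hS : VolterraSystem T α η c L M φ lam y N u₀ f ψ g) {κ q : ℝ}
    (hκ : KernelBound T α κ) (hα : 0 < α) (hα₁ : α ≤ 1) (hη : 0 < η) (hL : 0 ≤ L)
    (ht : t ∈ Ioc 0 T) (hN : ∀ s ∈ Ioc 0 t, N s ≤ q * s ^ (1 - α / 2 - 1)) :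
    √(∑ j, y j t ^ 2) ≤ κ * (1 + ProbabilityTheory.beta 1 η) * (‖u₀‖ + M * t ^ η)
      + 2 * (κ * L * (1 + T ^ α * ProbabilityTheory.beta (α / 2) α))
        * (q * ProbabilityTheory.beta (α / 2) (1 - α / 2)) := by
  have hκ₀ : 0 ≤ κ := zero_le_one.trans hκ.one_le
  have hle : ∀ j {x : ℝ}, 0 ≤ x → |1 * x| ≤ √(1 + lam j) * x := fun j x hx => by
    rw [one_mul, abs_of_nonneg hx]
    exact le_mul_of_one_le_left hx (Real.one_le_sqrt.2 (by linarith [hS.lam_nonneg j]))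
  have hE₀ : ∀ j, ∀ x ∈ Ioc 0 T, 0 ≤ resE α (lam j) x := fun j x hx =>
    (resE_pos hα hα₁ (hS.lam_nonneg j) hx.1).le
  have hP₀ : ∀ j, ∀ x ∈ Ioc 0 T, 0 ≤ resP α (lam j) x := fun j x hx =>
    (resP_pos hα hα₁ (hS.lam_nonneg j) hx.1).le
  have h := hS.sqrt_sum_mul_sq_le hα hη hL ht (w := fun _ => 1) one_pos hκ₀
    (fun j x hx => by
      rw [one_mul, abs_of_nonneg (hE₀ j x hx), sub_self, Real.rpow_zero, mul_one]
      exact (resE_le_one hα hα₁ (hS.lam_nonneg j) hx.1.le).trans hκ.one_le)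
    (fun j x hx => (hle j (hE₀ j x hx)).trans (hκ.resE_le' _ (hS.lam_nonneg j) x hx))
    (fun j x hx => (hle j (hP₀ j x hx)).trans (hκ.resP_le _ (hS.lam_nonneg j) x hx))
  simp only [one_mul, sub_self, Real.rpow_zero, mul_one] at h
  have hb : 0 < 1 - α / 2 := by linarith
  have hβ := intervalIntegrable_rpow_sub_one (half_pos hα) 0 t
  have hvconv : vconv (fun x => x ^ (α / 2 - 1)) N t
      ≤ q * ProbabilityTheory.beta (α / 2) (1 - α / 2) := by
    have hNt : ContinuousOn N (uIcc 0 t) := by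
      rw [uIcc_of_le ht.1.le]
      exact hS.continuousOn_N.mono (Icc_subset_Icc_right ht.2)
    calc vconv (fun x => x ^ (α / 2 - 1)) N t
        ≤ vconv (fun x => x ^ (α / 2 - 1)) (fun s => q * s ^ (1 - α / 2 - 1)) t :=
          vconv_rpow_le_vconv_rpow ht.1.le (intervalIntegrable_vconv_right hβ hNt)
            (((intervalIntegrable_rpow_mul_rpow (half_pos hα) hb ht.1.le).const_mul q).congr
              fun s _ => by ring) hN
      _ = q * ProbabilityTheory.beta (α / 2) (1 - α / 2) := by
          rw [vconv_const_mul_right, vconv, integral_rpow_mul_rpow (half_pos hα) hb ht.1,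
            add_sub_cancel, sub_self, Real.rpow_zero, one_mul]
  have hT := Real.rpow_nonneg (ht.1.le.trans ht.2) α
  have hB := (ProbabilityTheory.beta_pos (half_pos hα) hα).le
  exact h.trans (add_le_add_right (mul_le_mul_of_nonneg_left hvconv (by positivity)) _)

end VolterraSystem

theorem exists_N_le_of_volterraSystem {T α η c L : ℝ} (hT : 0 ≤ T) (hα : 0 < α) (hα₁ : α ≤ 1)
    (hη : 0 < η) (hc : 0 ≤ c) (hL : 0 ≤ L) :
    ∃ G : ℝ, 0 ≤ G ∧ ∀ {M : ℝ} {n : ℕ} {φ : Fin n → H} {lam : Fin n → ℝ}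
      {y : Fin n → ℝ → ℝ} {N : ℝ → ℝ} {u₀ : H} {f ψ g : ℝ → H},
      VolterraSystem T α η c L M φ lam y N u₀ f ψ g → ∀ t ∈ Ioc 0 T, ∀ s ∈ Ioc 0 t,
        N s ≤ G * (‖u₀‖ + M * t ^ η) * s ^ (1 - α / 2 - 1) := by
  obtain ⟨κ, hκ⟩ := exists_kernelBound hT hα hα₁
  have hκ₀ : 0 ≤ κ := zero_le_one.trans hκ.one_le
  have hb : 0 < 1 - α / 2 := by linarith
  have hBη := ProbabilityTheory.beta_pos hb hη
  have hBα := ProbabilityTheory.beta_pos (half_pos hα) hα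
  set Λ := 2 * (κ * L * (1 + T ^ α * ProbabilityTheory.beta (α / 2) α))
  set a := c * (κ * (1 + ProbabilityTheory.beta (1 - α / 2) η))
  have hΛ : 0 ≤ Λ := by positivity
  have ha : 0 ≤ a := by positivity
  obtain ⟨G, hG, hGron⟩ := exists_bound_of_le_add_vconv_rpow (half_pos hα) (by linarith) hb
    (by linarith) (mul_nonneg hc hΛ) T
  refine ⟨G * a, mul_nonneg hG ha, fun {M n φ lam y N u₀ f ψ g} hS t ht => ?_⟩
  have hM := hS.M_nonneg ht
  have hD : 0 ≤ a * (‖u₀‖ + M * t ^ η) :=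
    mul_nonneg ha (add_nonneg (norm_nonneg _) (mul_nonneg hM (Real.rpow_nonneg ht.1.le _)))
  rw [mul_assoc G]
  refine hGron ht hD (hS.continuousOn_N.mono (Icc_subset_Icc_right ht.2)) fun s hs => ?_
  have hs₀ := Real.rpow_nonneg hs.1.le (1 - α / 2 - 1)
  have hsη : s ^ η ≤ t ^ η := Real.rpow_le_rpow hs.1.le hs.2 hη.le
  refine (hS.N_le_add_vconv hκ hα hα₁ hη hc hL ⟨hs.1, hs.2.trans ht.2⟩).trans
    (add_le_add_left ?_ _)
  gcongr

theorem exists_bound_of_volterraSystem {T α η c L : ℝ} (hT : 0 ≤ T) (hα : 0 < α) (hα₁ : α ≤ 1)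
    (hη : 0 < η) (hc : 0 ≤ c) (hL : 0 ≤ L) :
    ∃ C : ℝ, ∀ {M : ℝ} {n : ℕ} {φ : Fin n → H} {lam : Fin n → ℝ}
      {y : Fin n → ℝ → ℝ} {N : ℝ → ℝ} {u₀ : H} {f ψ g : ℝ → H},
      VolterraSystem T α η c L M φ lam y N u₀ f ψ g → ∀ t ∈ Ioc 0 T,
        √(∑ j, y j t ^ 2) ≤ C * (‖u₀‖ + M * t ^ η) ∧
        t ^ (α / 2) * N t ≤ C * (‖u₀‖ + M * t ^ η) := by
  obtain ⟨κ, hκ⟩ := exists_kernelBound hT hα hα₁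
  obtain ⟨G, hG, hN⟩ := exists_N_le_of_volterraSystem (H := H) hT hα hα₁ hη hc hL
  have hκ₀ : 0 ≤ κ := zero_le_one.trans hκ.one_le
  have hBα := ProbabilityTheory.beta_pos (half_pos hα) hα
  have hB₁ := ProbabilityTheory.beta_pos one_pos hη
  have hB := ProbabilityTheory.beta_pos (half_pos hα) (show 0 < 1 - α / 2 by linarith)
  set A := κ * (1 + ProbabilityTheory.beta 1 η)
    + 2 * (κ * L * (1 + T ^ α * ProbabilityTheory.beta (α / 2) α))
      * (G * ProbabilityTheory.beta (α / 2) (1 - α / 2))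
  have hA : 0 ≤ A := by positivity
  refine ⟨A + G, fun {M n φ lam y N u₀ f ψ g} hS t ht => ?_⟩
  have hD : 0 ≤ ‖u₀‖ + M * t ^ η :=
    add_nonneg (norm_nonneg _) (mul_nonneg (hS.M_nonneg ht) (Real.rpow_nonneg ht.1.le _))
  have hy := hS.sqrt_sum_sq_le_of_N_le hκ hα hα₁ hη hL ht (hN hS t ht)
  have hpow : t ^ (α / 2) * t ^ (1 - α / 2 - 1) = 1 := by
    rw [← Real.rpow_add ht.1, show α / 2 + (1 - α / 2 - 1) = 0 by ring, Real.rpow_zero]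
  have hNt := mul_le_mul_of_nonneg_left (hN hS t ht t ⟨ht.1, le_rfl⟩)
    (Real.rpow_nonneg ht.1.le (α / 2))
  rw [mul_left_comm, hpow] at hNt
  constructor
  · linarith [mul_nonneg hG hD]
  · linarith [mul_nonneg hA hD]

end System

/-! ### Integration by parts in `H¹₀(Ω)` -/

section

variable {d : ℕ} {Ω : TopologicalSpace.Opens (Rd d)}

/-- The trace of an endomorphism of `ℝᵈ`, as a continuous linear map. -/
def traceL (d : ℕ) : (Rd d →L[ℝ] Rd d) →L[ℝ] ℝ :=
  ∑ i : Fin d, (EuclideanSpace.proj i : Rd d →L[ℝ] ℝ) ∘L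
    ContinuousLinearMap.apply ℝ (Rd d) (EuclideanSpace.single i (1 : ℝ))

theorem traceL_apply (D : Rd d →L[ℝ] Rd d) :
    traceL d D = ∑ i, D (EuclideanSpace.single i (1 : ℝ)) i := by
  simp [traceL]

/-- The weak Jacobian `W¹_∞(Ω)ᵈ → L∞(Ω)^{d×d}`. -/
def jacobianL (Ω : TopologicalSpace.Opens (Rd d)) : W1inf Ω →L[ℝ] LinfMat Ω :=
  ContinuousLinearMap.snd ℝ (LinfVec Ω) (LinfMat Ω) ∘L (W1infSub Ω).subtypeL

/-- The divergence `W¹_∞(Ω)ᵈ → L∞(Ω)`, the trace of the weak Jacobian. -/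
def divL (Ω : TopologicalSpace.Opens (Rd d)) : W1inf Ω →L[ℝ] Linf Ω :=
  (traceL d).compLpL ∞ (vol Ω) ∘L jacobianL Ω

/-- The pointwise inner product `L∞(Ω)ᵈ × L₂(Ω)ᵈ → L₂(Ω)`, `(F, ξ) ↦ F · ξ`. -/
def dotL (Ω : TopologicalSpace.Opens (Rd d)) : LinfVec Ω →L[ℝ] L2vec Ω →L[ℝ] L2 Ω :=
  (innerSL ℝ : Rd d →L[ℝ] Rd d →L[ℝ] ℝ).holderL (vol Ω) ∞ 2 2

/-- The operator `mulScal` as a continuous bilinear map `(a, v) ↦ a v`. -/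
def mulScalL (Ω : TopologicalSpace.Opens (Rd d)) : Linf Ω →L[ℝ] L2 Ω →L[ℝ] L2 Ω :=
  (ContinuousLinearMap.mul ℝ ℝ).holderL (vol Ω) ∞ 2 2

/-- The operator `v ↦ div (F v) = F · ∇v + (div F) v`, for `F ∈ W¹_∞(Ω)ᵈ`. -/
def divMul (Ω : TopologicalSpace.Opens (Rd d)) : W1inf Ω →L[ℝ] H10 Ω →L[ℝ] L2 Ω :=
  (ContinuousLinearMap.compL ℝ (H10 Ω) (L2vec Ω) (L2 Ω)).flip (grad Ω) ∘L dotL Ω ∘L toLinf Ω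
    + (ContinuousLinearMap.compL ℝ (H10 Ω) (L2 Ω) (L2 Ω)).flip (toL2 Ω) ∘L mulScalL Ω ∘L divL Ω

theorem coeFn_mulVec (F : LinfVec Ω) (v : L2 Ω) : mulVec F v =ᵐ[vol Ω] fun x => v x • F x :=
  ContinuousLinearMap.coeFn_holder _ _ _

theorem coeFn_mulMat (κ : LinfMat Ω) (ξ : L2vec Ω) : mulMat κ ξ =ᵐ[vol Ω] fun x => κ x (ξ x) :=
  ContinuousLinearMap.coeFn_holder _ _ _

theorem coeFn_dotL (F : LinfVec Ω) (ξ : L2vec Ω) :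
    dotL Ω F ξ =ᵐ[vol Ω] fun x => inner ℝ (F x) (ξ x) :=
  ContinuousLinearMap.coeFn_holder _ _ _

theorem coeFn_mulScalL (a : Linf Ω) (v : L2 Ω) : mulScalL Ω a v =ᵐ[vol Ω] fun x => a x * v x :=
  ContinuousLinearMap.coeFn_holder _ _ _

theorem coeFn_divL (F : W1inf Ω) :
    divL Ω F =ᵐ[vol Ω] fun x => ∑ i, jacobianL Ω F x (EuclideanSpace.single i (1 : ℝ)) i := by
  filter_upwards [(traceL d).coeFn_compLpL (jacobianL Ω F)] with x hx
  exact hx.trans (traceL_apply _)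

theorem inner_gradient_eq_sum (f : Rd d → ℝ) (x ξ : Rd d) :
    inner ℝ ξ (gradient f x) = ∑ i, fderiv ℝ f x (EuclideanSpace.single i (1 : ℝ)) * ξ i := by
  rw [real_inner_comm, gradient, InnerProductSpace.toDual_symm_apply]
  conv_lhs => rw [← (EuclideanSpace.basisFun (Fin d) ℝ).sum_repr ξ]
  simp [mul_comm]

theorem gradient_mul {E : Type*} [NormedAddCommGroup E] [InnerProductSpace ℝ E] [CompleteSpace E]
    {f g : E → ℝ} {x : E} (hf : DifferentiableAt ℝ f x) (hg : DifferentiableAt ℝ g x) :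
    gradient (fun y => f y * g y) x = f x • gradient g x + g x • gradient f x := by
  simp only [gradient, fderiv_fun_mul hf hg, map_add, map_smul]

/-- The product of two test functions. -/
def testMul (φ ψ : 𝓓(Ω, ℝ)) : 𝓓(Ω, ℝ) :=
  ⟨fun x => φ x * ψ x, φ.contDiff.mul ψ.contDiff, φ.hasCompactSupport.mul_right,
    tsupport_mul_subset_left.trans φ.tsupport_subset⟩

theorem inner_gradient_testMul (φ ψ : 𝓓(Ω, ℝ)) (x ξ : Rd d) :
    inner ℝ ξ (gradient (testMul φ ψ) x)
      = φ x * inner ℝ ξ (gradient ψ x) + ψ x * inner ℝ ξ (gradient φ x) := by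
  have h : gradient (testMul φ ψ) x = φ x • gradient ψ x + ψ x • gradient φ x :=
    gradient_mul (φ.contDiff.differentiable (by simp) x) (ψ.contDiff.differentiable (by simp) x)
  rw [h, inner_add_right, real_inner_smul_right, real_inner_smul_right]

theorem integrable_fderiv_test_mul_and (F : W1inf Ω) (φ : 𝓓(Ω, ℝ)) (y : Rd d) (i : Fin d) :
    Integrable (fun x => fderiv ℝ φ x y * toLinf Ω F x i) (vol Ω) ∧
      Integrable (fun x => φ x * jacobianL Ω F x y i) (vol Ω) :=
  ⟨(EuclideanSpace.proj i : Rd d →L[ℝ] ℝ).integrable_comp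
      (integrable_fderiv_test_smul φ y le_top (Lp.memLp (toLinf Ω F))),
    (EuclideanSpace.proj i : Rd d →L[ℝ] ℝ).integrable_comp (integrable_test_smul φ le_top
      ((ContinuousLinearMap.apply ℝ (Rd d) y).comp_memLp' (Lp.memLp (jacobianL Ω F))))⟩

theorem integral_fderiv_test_mul_add_eq_zero (F : W1inf Ω) (φ : 𝓓(Ω, ℝ)) (y : Rd d) (i : Fin d) :
    ∫ x, (fderiv ℝ φ x y * toLinf Ω F x i + φ x * jacobianL Ω F x y i) ∂(vol Ω) = 0 := by
  have hweak : HasWeakJacobian Ω (toLinf Ω F) (jacobianL Ω F) := F.2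
  have hF : ∫ x, fderiv ℝ φ x y * toLinf Ω F x i ∂(vol Ω)
      = (∫ x, fderiv ℝ φ x y • toLinf Ω F x ∂(vol Ω)) i :=
    (EuclideanSpace.proj i : Rd d →L[ℝ] ℝ).integral_comp_comm
      (integrable_fderiv_test_smul φ y le_top (Lp.memLp (toLinf Ω F)))
  have hD : ∫ x, φ x * jacobianL Ω F x y i ∂(vol Ω)
      = (∫ x, φ x • jacobianL Ω F x y ∂(vol Ω)) i :=
    (EuclideanSpace.proj i : Rd d →L[ℝ] ℝ).integral_comp_comm
      (integrable_test_smul φ le_top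
        ((ContinuousLinearMap.apply ℝ (Rd d) y).comp_memLp' (Lp.memLp (jacobianL Ω F))))
  have hcoord := congrArg (fun v : Rd d => v i) (hweak φ y)
  rw [PiLp.neg_apply] at hcoord
  obtain ⟨hiF, hiD⟩ := integrable_fderiv_test_mul_and F φ y i
  rw [integral_add hiF hiD, hF, hD, hcoord, neg_add_cancel]

theorem integral_inner_gradient_add_mul_div_eq_zero (F : W1inf Ω) (φ : 𝓓(Ω, ℝ)) :
    ∫ x, (inner ℝ (toLinf Ω F x) (gradient φ x) + φ x * divL Ω F x) ∂(vol Ω) = 0 := by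
  set E : Fin d → Rd d := fun i => EuclideanSpace.single i (1 : ℝ)
  have hsum : (fun x => inner ℝ (toLinf Ω F x) (gradient φ x) + φ x * divL Ω F x) =ᵐ[vol Ω]
      fun x => ∑ i, (fderiv ℝ φ x (E i) * toLinf Ω F x i + φ x * jacobianL Ω F x (E i) i) := by
    filter_upwards [coeFn_divL F] with x hx
    rw [hx, inner_gradient_eq_sum, Finset.sum_add_distrib, Finset.mul_sum]
  have hint (i : Fin d) : Integrable
      (fun x => fderiv ℝ φ x (E i) * toLinf Ω F x i + φ x * jacobianL Ω F x (E i) i) (vol Ω) :=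
    (integrable_fderiv_test_mul_and F φ (E i) i).1.add
      (integrable_fderiv_test_mul_and F φ (E i) i).2
  rw [integral_congr_ae hsum, integral_finsetSum _ fun i _ => hint i]
  exact Finset.sum_eq_zero fun i _ => integral_fderiv_test_mul_add_eq_zero F φ (E i) i

theorem inner_mulVec_testPairs (F : W1inf Ω) {p q : WithLp 2 (L2 Ω × L2vec Ω)}
    (hp : p ∈ testPairs Ω) (hq : q ∈ testPairs Ω) :
    inner ℝ (mulVec (toLinf Ω F) p.fst) q.snd
      + inner ℝ (dotL Ω (toLinf Ω F) p.snd + mulScalL Ω (divL Ω F) p.fst) q.fst = 0 := by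
  obtain ⟨φ, hφ, hφ'⟩ := hp
  obtain ⟨ψ, hψ, hψ'⟩ := hq
  rw [L2.inner_def, L2.inner_def, ← integral_add (L2.integrable_inner _ _)
    (L2.integrable_inner _ _), ← integral_inner_gradient_add_mul_div_eq_zero F (testMul φ ψ)]
  refine integral_congr_ae ?_
  filter_upwards [hφ, hφ', hψ, hψ', coeFn_mulVec (toLinf Ω F) p.fst,
    Lp.coeFn_add (dotL Ω (toLinf Ω F) p.snd) (mulScalL Ω (divL Ω F) p.fst),
    coeFn_dotL (toLinf Ω F) p.snd, coeFn_mulScalL (divL Ω F) p.fst]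
    with x hφ hφ' hψ hψ' hmul hadd hdot hscal
  have htest : testMul φ ψ x = φ x * ψ x := rfl
  rw [hmul, hadd, Pi.add_apply, hdot, hscal, hφ, hφ', hψ, hψ', real_inner_smul_left,
    inner_gradient_testMul, htest, real_inner_comm]
  simp only [RCLike.inner_apply, conj_trivial]
  ring

theorem eq_zero_of_mem_topologicalClosure_span {E F G : Type*} [NormedAddCommGroup E]
    [NormedSpace ℝ E] [NormedAddCommGroup F] [NormedSpace ℝ F] [NormedAddCommGroup G]
    [NormedSpace ℝ G] (B : E →L[ℝ] F →L[ℝ] G) {S : Set E} {S' : Set F}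
    (h : ∀ p ∈ S, ∀ q ∈ S', B p q = 0) {p : E} (hp : p ∈ (Submodule.span ℝ S).topologicalClosure)
    {q : F} (hq : q ∈ (Submodule.span ℝ S').topologicalClosure) : B p q = 0 := by
  have hq' : ∀ p ∈ S, B p q = 0 := fun p hp => by
    have hle : (Submodule.span ℝ S').topologicalClosure ≤ LinearMap.ker (B p).toLinearMap :=
      Submodule.topologicalClosure_minimal _ (Submodule.span_le.2 (h p hp)) (B p).isClosed_ker
    exact hle hq
  have hle : (Submodule.span ℝ S).topologicalClosure ≤ LinearMap.ker (B.flip q).toLinearMap :=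
    Submodule.topologicalClosure_minimal _ (Submodule.span_le.2 hq') (B.flip q).isClosed_ker
  exact hle hp

theorem inner_mulVec_grad (F : W1inf Ω) (v w : H10 Ω) :
    inner ℝ (mulVec (toLinf Ω F) (toL2 Ω v)) (grad Ω w) = -inner ℝ (divMul Ω F v) (toL2 Ω w) := by
  rw [eq_neg_iff_add_eq_zero]
  set f₁ := WithLp.fstL 2 ℝ (L2 Ω) (L2vec Ω)
  set f₂ := WithLp.sndL 2 ℝ (L2 Ω) (L2vec Ω)
  set ip : L2 Ω →L[ℝ] L2 Ω →L[ℝ] ℝ := innerSL ℝ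
  set ipVec : L2vec Ω →L[ℝ] L2vec Ω →L[ℝ] ℝ := innerSL ℝ
  set D := dotL Ω (toLinf Ω F) ∘L f₂ + mulScalL Ω (divL Ω F) ∘L f₁
  exact eq_zero_of_mem_topologicalClosure_span
    (ipVec.bilinearComp (mulVec (toLinf Ω F) ∘L f₁) f₂ + ip.bilinearComp D f₁)
    (fun p hp q hq => inner_mulVec_testPairs F hp hq) v.2.2 w.2.2

/-! ### The diffusion form -/

theorem inner_mulMat_comm {κ : LinfMat Ω}
    (hκ : ∀ᵐ x ∂(vol Ω), (κ x : Rd d →ₗ[ℝ] Rd d).IsSymmetric) (ξ ζ : L2vec Ω) :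
    inner ℝ (mulMat κ ξ) ζ = inner ℝ (mulMat κ ζ) ξ := by
  rw [L2.inner_def, L2.inner_def]
  refine integral_congr_ae ?_
  filter_upwards [hκ, coeFn_mulMat κ ξ, coeFn_mulMat κ ζ] with x hsymm hξ hζ
  rw [hξ, hζ, real_inner_comm (ξ x)]
  exact hsymm (ξ x) (ζ x)

theorem mul_norm_sq_le_inner_of_le_eigenvalues {E : Type*} [NormedAddCommGroup E]
    [InnerProductSpace ℝ E] [FiniteDimensional ℝ E] {A : E →ₗ[ℝ] E} (hA : A.IsSymmetric) {c₀ : ℝ}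
    (h : ∀ lam : ℝ, Module.End.HasEigenvalue A lam → c₀ ≤ lam) (ξ : E) :
    c₀ * ‖ξ‖ ^ 2 ≤ inner ℝ (A ξ) ξ := by
  set b := hA.eigenvectorBasis rfl
  have hform : inner ℝ (A ξ) ξ = ∑ i, hA.eigenvalues rfl i * inner ℝ ξ (b i) ^ 2 := by
    rw [← b.sum_inner_mul_inner (A ξ) ξ]
    refine Finset.sum_congr rfl fun i _ => ?_
    rw [hA ξ (b i), hA.apply_eigenvectorBasis rfl i, real_inner_smul_right,
      real_inner_comm ξ (b i), RCLike.ofReal_real_eq_id, id]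
    ring
  have hnorm : ‖ξ‖ ^ 2 = ∑ i, inner ℝ ξ (b i) ^ 2 := by
    simp only [← b.sum_sq_norm_inner_left ξ, Real.norm_eq_abs, sq_abs]
  rw [hform, hnorm, Finset.mul_sum]
  exact Finset.sum_le_sum fun i _ =>
    mul_le_mul_of_nonneg_right (h _ (hA.hasEigenvalue_eigenvalues rfl i)) (sq_nonneg _)

theorem mul_norm_sq_le_inner_mulMat {κ : LinfMat Ω} {c₀ : ℝ}
    (hκ : ∀ᵐ x ∂(vol Ω), (κ x : Rd d →ₗ[ℝ] Rd d).IsSymmetric ∧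
      ∀ lam : ℝ, Module.End.HasEigenvalue (κ x : Rd d →ₗ[ℝ] Rd d) lam → c₀ ≤ lam)
    (ξ : L2vec Ω) : c₀ * ‖ξ‖ ^ 2 ≤ inner ℝ (mulMat κ ξ) ξ := by
  rw [← real_inner_self_eq_norm_sq, L2.inner_def, L2.inner_def, ← integral_const_mul]
  refine integral_mono_ae ((L2.integrable_inner _ _).const_mul _) (L2.integrable_inner _ _) ?_
  filter_upwards [hκ, coeFn_mulMat κ ξ] with x hx hξ
  rw [hξ, real_inner_self_eq_norm_sq]
  exact mul_norm_sq_le_inner_of_le_eigenvalues hx.1 hx.2 (ξ x)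

end

/-! ### Simultaneous diagonalization -/

section

variable {V H : Type*} [AddCommGroup V] [Module ℝ V] [NormedAddCommGroup H]
  [InnerProductSpace ℝ H]

theorem exists_isSymmetric_of_symm_bilin [FiniteDimensional ℝ H] (a : H →ₗ[ℝ] H →ₗ[ℝ] ℝ)
    (ha : ∀ v w, a v w = a w v) :
    ∃ A : H →ₗ[ℝ] H, A.IsSymmetric ∧ ∀ v w, inner ℝ (A v) w = a v w := by
  have hA (v w : H) : inner ℝ ((InnerProductSpace.toDual ℝ H).symm
      (LinearMap.toContinuousLinearMap (a v))) w = a v w := by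
    simp [InnerProductSpace.toDual_symm_apply]
  refine ⟨{ toFun := fun v => (InnerProductSpace.toDual ℝ H).symm
              (LinearMap.toContinuousLinearMap (a v))
            map_add' := fun v w => by simp
            map_smul' := fun r v => by simp }, fun v w => ?_, hA⟩
  exact (hA v w).trans ((ha v w).trans ((hA w v).symm.trans (real_inner_comm _ _)))

/-- A basis `e` of `V` that is orthonormal for the inner product pulled back along `ι`, and that
diagonalizes the form `a` with eigenvalues `lam`. -/
structure IsEigenbasis (ι : V →ₗ[ℝ] H) (a : V →ₗ[ℝ] V →ₗ[ℝ] ℝ) {n : ℕ} (e : Fin n → V)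
    (lam : Fin n → ℝ) : Prop where
  orthonormal : Orthonormal ℝ fun j => ι (e j)
  apply_left : ∀ j w, a (e j) w = lam j * inner ℝ (ι (e j)) (ι w)
  eq_sum : ∀ v, v = ∑ j, inner ℝ (ι v) (ι (e j)) • e j

theorem exists_isEigenbasis [FiniteDimensional ℝ V] (ι : V →ₗ[ℝ] H) (hι : Function.Injective ι)
    (a : V →ₗ[ℝ] V →ₗ[ℝ] ℝ) (ha : ∀ v w, a v w = a w v) :
    ∃ (n : ℕ) (e : Fin n → V) (lam : Fin n → ℝ), IsEigenbasis ι a e lam := by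
  set Y := LinearMap.range ι
  have : FiniteDimensional ℝ Y := LinearMap.finiteDimensional_range ι
  set ε : V ≃ₗ[ℝ] Y := LinearEquiv.ofInjective ι hι
  have hε (v : V) : ((ε v : Y) : H) = ι v := rfl
  obtain ⟨A, hsymm, hA⟩ := exists_isSymmetric_of_symm_bilin
    (a.compl₁₂ ε.symm.toLinearMap ε.symm.toLinearMap) fun v w => ha _ _
  set b := hsymm.eigenvectorBasis rfl
  have hb (j) : ι (ε.symm (b j)) = (b j : Y) := by rw [← hε, LinearEquiv.apply_symm_apply]
  refine ⟨Module.finrank ℝ Y, fun j => ε.symm (b j), hsymm.eigenvalues rfl,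
    ⟨?_, fun j w => ?_, fun v => ε.injective ?_⟩⟩
  · simp only [hb]
    exact b.orthonormal.comp_linearIsometry Y.subtypeₗᵢ
  · calc a (ε.symm (b j)) w = inner ℝ (A (b j)) (ε w) := by simp [hA]
      _ = hsymm.eigenvalues rfl j * inner ℝ (ι (ε.symm (b j))) (ι w) := by
        rw [hsymm.apply_eigenvectorBasis rfl j, real_inner_smul_left, hb, ← hε w,
          Submodule.coe_inner]
        rfl
  · conv_lhs => rw [← b.sum_repr' (ε v)]
    simp only [map_sum, map_smul, LinearEquiv.apply_symm_apply, hb, ← hε v, ← Submodule.coe_inner,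
      real_inner_comm]

namespace IsEigenbasis

variable {ι : V →ₗ[ℝ] H} {a : V →ₗ[ℝ] V →ₗ[ℝ] ℝ} {n : ℕ} {e : Fin n → V} {lam : Fin n → ℝ}

theorem apply_self (h : IsEigenbasis ι a e lam) (v : V) :
    a v v = ∑ j, lam j * inner ℝ (ι v) (ι (e j)) ^ 2 := by
  have hsum := congrArg (fun w => a w v) (h.eq_sum v)
  simp only [map_sum, map_smul, LinearMap.sum_apply, LinearMap.smul_apply, smul_eq_mul,
    h.apply_left] at hsum
  rw [hsum]
  refine Finset.sum_congr rfl fun j _ => ?_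
  rw [real_inner_comm]
  ring

theorem norm_sq (h : IsEigenbasis ι a e lam) (v : V) :
    ‖ι v‖ ^ 2 = ∑ j, inner ℝ (ι v) (ι (e j)) ^ 2 := by
  have hinner : IsEigenbasis ι ((innerₗ H).compl₁₂ ι ι) e fun _ => 1 :=
    { h with apply_left := fun j w => (one_mul _).symm }
  simpa only [one_mul] using (real_inner_self_eq_norm_sq (ι v)).symm.trans (hinner.apply_self v)

theorem lam_nonneg (h : IsEigenbasis ι a e lam) (ha : ∀ v, 0 ≤ a v v) (j : Fin n) :
    0 ≤ lam j := by
  have hj := ha (e j)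
  rwa [h.apply_left, real_inner_self_eq_norm_sq, h.orthonormal.1 j, one_pow, mul_one] at hj

theorem sum_sqrt_mul_sq (h : IsEigenbasis ι a e lam) (ha : ∀ v, 0 ≤ a v v) (v : V) :
    ∑ j, (√(1 + lam j) * inner ℝ (ι v) (ι (e j))) ^ 2 = ‖ι v‖ ^ 2 + a v v := by
  rw [h.norm_sq, h.apply_self, ← Finset.sum_add_distrib]
  refine Finset.sum_congr rfl fun j _ => ?_
  rw [mul_pow, Real.sq_sqrt (add_nonneg zero_le_one (h.lam_nonneg ha j)), one_add_mul]

end IsEigenbasis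

end

/-! ### Integration by parts in time -/

section

/-- The derivative `ω_α'(t) = (α - 1) t^{α-2} / Γ(α)` of `omega α` on `(0,∞)`. -/
def domega (α t : ℝ) : ℝ := (α - 1) * t ^ (α - 2) / Real.Gamma α

variable {α : ℝ}

theorem hasDerivAt_omega {x : ℝ} (hx : 0 < x) : HasDerivAt (omega α) (domega α x) x := by
  have h := (Real.hasDerivAt_rpow_const (p := α - 1) (Or.inl hx.ne')).div_const (Real.Gamma α)
  rwa [sub_sub, one_add_one_eq_two] at h

theorem intervalIntegrable_omega_sub (hα : 0 < α) (s t : ℝ) :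
    IntervalIntegrable (fun z => omega α (z - s)) volume s t := by
  simpa only [zero_add, sub_add_cancel] using
    (intervalIntegrable_omega hα 0 (t - s)).comp_sub_right s

theorem omega_mul_self {x : ℝ} (hx : 0 < x) : omega α x * x = x ^ α / Real.Gamma α := by
  rw [omega, div_mul_eq_mul_div, ← Real.rpow_add_one hx.ne', sub_add_cancel]

theorem abs_domega_mul_le (hα : 0 < α) (hα₁ : α ≤ 1) {x b K : ℝ} (hx : 0 < x)
    (hb : |b| ≤ K * x) : |domega α x * b| ≤ (1 - α) / Real.Gamma α * K * x ^ (α - 1) := by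
  have hΓ := Real.Gamma_pos_of_pos hα
  have habs : |domega α x| = (1 - α) / Real.Gamma α * x ^ (α - 2) := by
    rw [domega, abs_div, abs_mul, abs_of_pos hΓ, abs_of_nonpos (by linarith),
      abs_of_pos (Real.rpow_pos_of_pos hx _)]
    ring
  calc |domega α x * b| = |domega α x| * |b| := abs_mul _ _
    _ ≤ |domega α x| * (K * x) := mul_le_mul_of_nonneg_left hb (abs_nonneg _)
    _ = (1 - α) / Real.Gamma α * K * (x ^ (α - 2) * x) := by rw [habs]; ring
    _ = (1 - α) / Real.Gamma α * K * x ^ (α - 1) := by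
      rw [← Real.rpow_add_one hx.ne']
      ring_nf

theorem continuousOn_domega : ContinuousOn (domega α) (Ioi 0) := fun x hx =>
  ((continuousAt_const.mul (Real.continuousAt_rpow_const x _ (Or.inl (ne_of_gt hx)))).div_const
    _).continuousWithinAt

open Filter Topology in
theorem continuousOn_omega_mul (hα : 0 < α) {b : ℝ → ℝ} {s t K : ℝ}
    (hb : ContinuousOn b (Icc s t)) (hK : ∀ z ∈ Icc s t, |b z| ≤ K * (z - s)) :
    ContinuousOn (fun z => omega α (z - s) * b z) (Icc s t) := by
  intro z hz
  rcases hz.1.eq_or_lt with rfl | hsz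
  · have hbs : b s = 0 := by simpa using hK s hz
    have hlim : Tendsto (fun z => K / Real.Gamma α * (z - s) ^ α) (𝓝[Icc s t] s) (𝓝 0) := by
      have hcont : Continuous fun z : ℝ => K / Real.Gamma α * (z - s) ^ α :=
        continuous_const.mul
          ((Real.continuous_rpow_const hα.le).comp (continuous_id.sub continuous_const))
      have h := hcont.tendsto s
      rw [sub_self, Real.zero_rpow hα.ne', mul_zero] at h
      exact h.mono_left nhdsWithin_le_nhds
    rw [ContinuousWithinAt, hbs, mul_zero]
    refine squeeze_zero_norm' ?_ hlim
    filter_upwards [self_mem_nhdsWithin] with z hz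
    rcases hz.1.eq_or_lt with rfl | hsz
    · simp [hbs, Real.zero_rpow hα.ne']
    · have hzs : 0 < z - s := sub_pos.2 hsz
      calc ‖omega α (z - s) * b z‖ = omega α (z - s) * |b z| := by
            rw [norm_mul, Real.norm_eq_abs, Real.norm_eq_abs, abs_of_pos (omega_pos hα hzs)]
        _ ≤ omega α (z - s) * (K * (z - s)) :=
            mul_le_mul_of_nonneg_left (hK z hz) (omega_pos hα hzs).le
        _ = K / Real.Gamma α * (z - s) ^ α := by
            rw [mul_left_comm, omega_mul_self hzs]
            ring
  · have homega : ContinuousAt (fun z => omega α (z - s)) z :=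
      ((hasDerivAt_omega (sub_pos.2 hsz)).comp_sub_const z s).continuousAt
    exact homega.continuousWithinAt.mul (hb z hz)

theorem intervalIntegrable_domega_mul (hα : 0 < α) (hα₁ : α ≤ 1) {b : ℝ → ℝ} {s t K : ℝ}
    (hst : s ≤ t) (hb : ContinuousOn b (Icc s t)) (hK : ∀ z ∈ Icc s t, |b z| ≤ K * (z - s)) :
    IntervalIntegrable (fun z => domega α (z - s) * b z) volume s t := by
  have hdom : IntervalIntegrable (fun z => (1 - α) / Real.Gamma α * K * (z - s) ^ (α - 1))
      volume s t := by
    have h := (intervalIntegrable_rpow_sub_one hα 0 (t - s)).comp_sub_right s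
    rw [zero_add, sub_add_cancel] at h
    exact h.const_mul _
  rw [intervalIntegrable_iff_integrableOn_Ioo_of_le hst] at hdom ⊢
  refine Integrable.mono' hdom (ContinuousOn.aestronglyMeasurable ?_ measurableSet_Ioo) ?_
  · exact (continuousOn_domega.comp (by fun_prop) fun z hz => sub_pos.2 hz.1).mul
      (hb.mono Ioo_subset_Icc_self)
  · filter_upwards [ae_restrict_mem measurableSet_Ioo] with z hz
    exact abs_domega_mul_le hα hα₁ (sub_pos.2 hz.1) (hK z ⟨hz.1.le, hz.2.le⟩)

theorem omega_mul_sub_integral (hα : 0 < α) (hα₁ : α ≤ 1) {β β' : ℝ → ℝ} {s t : ℝ} (hst : s ≤ t)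
    (hβ : ∀ z ∈ Icc s t, HasDerivWithinAt β (β' z) (Icc s t) z) (hβ' : ContinuousOn β' (Icc s t)) :
    omega α (t - s) * β t - ∫ z in s..t, omega α (z - s) * β' z
      = omega α (t - s) * β s + ∫ z in s..t, domega α (z - s) * (β z - β s) := by
  obtain ⟨K, hK⟩ := isCompact_Icc.exists_bound_of_continuousOn hβ'
  have hLip : ∀ z ∈ Icc s t, |β z - β s| ≤ K * (z - s) := fun z hz => by
    have h := Convex.norm_image_sub_le_of_norm_hasDerivWithin_le hβ hK (convex_Icc s t)
      (left_mem_Icc.2 hst) hz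
    rwa [Real.norm_eq_abs, Real.norm_eq_abs, abs_of_nonneg (sub_nonneg.2 hz.1)] at h
  have hcont : ContinuousOn (fun z => β z - β s) (Icc s t) := fun z hz =>
    (hβ z hz).continuousWithinAt.sub continuousWithinAt_const
  have hderiv : ∀ z ∈ Ioo s t, HasDerivAt (fun z => omega α (z - s) * (β z - β s))
      (domega α (z - s) * (β z - β s) + omega α (z - s) * β' z) z := fun z hz =>
    ((hasDerivAt_omega (sub_pos.2 hz.1)).comp_sub_const z s).mul
      (((hβ z ⟨hz.1.le, hz.2.le⟩).hasDerivAt (Icc_mem_nhds hz.1 hz.2)).sub_const (β s))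
  have hint := intervalIntegrable_domega_mul hα hα₁ hst hcont hLip
  have hint' : IntervalIntegrable (fun z => omega α (z - s) * β' z) volume s t :=
    (intervalIntegrable_omega_sub hα s t).mul_continuousOn (by rwa [uIcc_of_le hst])
  have hFTC := intervalIntegral.integral_eq_sub_of_hasDerivAt_of_le hst
    (continuousOn_omega_mul hα hcont hLip) hderiv (hint.add hint')
  rw [intervalIntegral.integral_add hint hint', sub_self (β s), mul_zero, sub_zero] at hFTC
  linarith

end

/-! ### The memory term -/

section

open scoped NNReal

theorem integrable_tri_of_abs_le {F : ℝ → ℝ → ℝ} {α t C : ℝ} (hα : 0 < α) (ht : 0 ≤ t)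
    (hF : ContinuousOn (Function.uncurry F) (tri ∩ Ioc 0 t ×ˢ Ioc 0 t))
    (hC : ∀ s r, 0 < r → r < s → s ≤ t → |F s r| ≤ C * (s - r) ^ (α - 1)) :
    Integrable (tri.indicator (Function.uncurry F)) (sqMeasure t) := by
  have hset : MeasurableSet (Ioc 0 t ×ˢ Ioc 0 t : Set (ℝ × ℝ)) :=
    measurableSet_Ioc.prod measurableSet_Ioc
  refine (integrable_tri_left ht (intervalIntegrable_const (c := C))
    (intervalIntegrable_rpow_sub_one hα 0 t)).mono' ?_ ?_
  · rw [sqMeasure, Measure.prod_restrict, aestronglyMeasurable_indicator_iff measurableSet_tri,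
      Measure.restrict_restrict measurableSet_tri]
    exact hF.aestronglyMeasurable (measurableSet_tri.inter hset)
  · rw [sqMeasure, Measure.prod_restrict]
    filter_upwards [ae_restrict_mem hset] with x hx
    by_cases hxt : x ∈ tri
    · rw [indicator_of_mem hxt, indicator_of_mem hxt]
      exact hC x.1 x.2 hx.2.1 hxt hx.1.2
    · simp [indicator_of_notMem hxt]

theorem integrableOn_sub_rpow_mul_norm {V : Type*} [NormedAddCommGroup V] {u : ℝ → V} {α T : ℝ}
    (hα : 0 < α) (c : ℝ) (hu : ContinuousOn u (Icc 0 T)) {z : ℝ} (hz : z ∈ Ioc 0 T) :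
    IntegrableOn (fun s => c * ((z - s) ^ (α - 1) * ‖u s‖)) (Ioo 0 z) := by
  have hu' : ContinuousOn (fun s => ‖u s‖) (uIcc 0 z) := by
    rw [uIcc_of_le hz.1.le]
    exact (hu.mono (Icc_subset_Icc_right hz.2)).norm
  rw [← intervalIntegrable_iff_integrableOn_Ioo_of_le hz.1.le]
  exact (intervalIntegrable_vconv_right (intervalIntegrable_rpow_sub_one hα 0 z) hu').const_mul c

section

variable {V H : Type*} [NormedAddCommGroup V] [NormedSpace ℝ V] [NormedAddCommGroup H]
  [NormedSpace ℝ H]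

/-- The memory term `∫₀ᶻ ω_α'(z-s) (B(z) - B(s)) u(s) ds`, which remains when the singular kernel
`ω_α(t-s) B(t)` is integrated by parts in time. -/
def memTerm (α : ℝ) (B : ℝ → V →L[ℝ] H) (u : ℝ → V) (z : ℝ) : H :=
  ∫ s in (0 : ℝ)..z, domega α (z - s) • (B z - B s) (u s)

variable {B : ℝ → V →L[ℝ] H} {u : ℝ → V} {α T : ℝ} {K : ℝ≥0}

theorem norm_domega_smul_le (hα : 0 < α) (hα₁ : α ≤ 1)
    (hB : LipschitzOnWith K B (Icc 0 T)) {z s : ℝ} (hs : 0 ≤ s) (hsz : s < z) (hz : z ≤ T)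
    (v : V) :
    ‖domega α (z - s) • (B z - B s) v‖
      ≤ (1 - α) / Real.Gamma α * K * ((z - s) ^ (α - 1) * ‖v‖) := by
  have hzs : 0 < z - s := sub_pos.2 hsz
  have hdiff : ‖B z - B s‖ ≤ K * (z - s) := by
    have h := hB.dist_le_mul z ⟨hs.trans hsz.le, hz⟩ s ⟨hs, hsz.le.trans hz⟩
    rwa [dist_eq_norm, dist_eq_norm, Real.norm_eq_abs, abs_of_pos hzs] at h
  have hv : |‖(B z - B s) v‖| ≤ K * ‖v‖ * (z - s) := by
    rw [abs_norm, mul_right_comm]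
    exact (B z - B s).le_of_opNorm_le hdiff v
  calc ‖domega α (z - s) • (B z - B s) v‖
      = |domega α (z - s) * ‖(B z - B s) v‖| := by
        rw [norm_smul, Real.norm_eq_abs, abs_mul, abs_norm]
    _ ≤ (1 - α) / Real.Gamma α * (K * ‖v‖) * (z - s) ^ (α - 1) :=
        abs_domega_mul_le hα hα₁ hzs hv
    _ = (1 - α) / Real.Gamma α * K * ((z - s) ^ (α - 1) * ‖v‖) := by ring

theorem intervalIntegrable_memTerm (hα : 0 < α) (hα₁ : α ≤ 1)
    (hB : LipschitzOnWith K B (Icc 0 T)) (hu : ContinuousOn u (Icc 0 T)) {z : ℝ}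
    (hz : z ∈ Ioc 0 T) :
    IntervalIntegrable (fun s => domega α (z - s) • (B z - B s) (u s)) volume 0 z := by
  have hsub : Ioo 0 z ⊆ Icc 0 T := fun s hs => ⟨hs.1.le, hs.2.le.trans hz.2⟩
  rw [intervalIntegrable_iff_integrableOn_Ioo_of_le hz.1.le]
  refine Integrable.mono' (integrableOn_sub_rpow_mul_norm hα ((1 - α) / Real.Gamma α * K) hu hz)
    (ContinuousOn.aestronglyMeasurable ?_ measurableSet_Ioo) ?_
  · exact (continuousOn_domega.comp (by fun_prop) fun s hs => sub_pos.2 hs.2).smul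
      ((continuousOn_const.sub (hB.continuousOn.mono hsub)).clm_apply (hu.mono hsub))
  · filter_upwards [ae_restrict_mem measurableSet_Ioo] with s hs
    exact norm_domega_smul_le hα hα₁ hB hs.1.le hs.2 hz.2 (u s)

theorem norm_memTerm_le (hα : 0 < α) (hα₁ : α ≤ 1) (hB : LipschitzOnWith K B (Icc 0 T))
    (hu : ContinuousOn u (Icc 0 T)) {z : ℝ} (hz : z ∈ Ioc 0 T) :
    ‖memTerm α B u z‖ ≤ (1 - α) / Real.Gamma α * K *
      vconv (fun x => x ^ (α - 1)) (fun s => ‖u s‖) z := by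
  rw [memTerm, vconv, ← intervalIntegral.integral_const_mul,
    intervalIntegral.integral_of_le hz.1.le, intervalIntegral.integral_of_le hz.1.le,
    integral_Ioc_eq_integral_Ioo, integral_Ioc_eq_integral_Ioo]
  refine norm_integral_le_of_norm_le (integrableOn_sub_rpow_mul_norm hα _ hu hz) ?_
  filter_upwards [ae_restrict_mem measurableSet_Ioo] with s hs
  exact norm_domega_smul_le hα hα₁ hB hs.1.le hs.2 hz.2 (u s)

end

section

variable {V H : Type*} [NormedAddCommGroup V] [NormedSpace ℝ V] [NormedAddCommGroup H]
  [InnerProductSpace ℝ H] {B : ℝ → V →L[ℝ] H} {u : ℝ → V} {α T : ℝ} {K : ℝ≥0}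

theorem inner_memTerm [CompleteSpace H] (hα : 0 < α) (hα₁ : α ≤ 1)
    (hB : LipschitzOnWith K B (Icc 0 T)) (hu : ContinuousOn u (Icc 0 T)) {z : ℝ}
    (hz : z ∈ Ioc 0 T) (w : H) :
    inner ℝ (memTerm α B u z) w
      = ∫ s in (0 : ℝ)..z, domega α (z - s) * inner ℝ ((B z - B s) (u s)) w := by
  have h := (innerSL ℝ w).intervalIntegral_comp_comm (intervalIntegrable_memTerm hα hα₁ hB hu hz)
  rw [memTerm, real_inner_comm]
  refine h.symm.trans (intervalIntegral.integral_congr fun s _ => ?_)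
  simp only [innerSL_apply_apply, inner_smul_right, real_inner_comm]

theorem integrable_tri_memTerm (hα : 0 < α) (hα₁ : α ≤ 1) (hB : LipschitzOnWith K B (Icc 0 T))
    (hu : ContinuousOn u (Icc 0 T)) {t : ℝ} (ht : t ∈ Ioc 0 T) (w : H) :
    Integrable (tri.indicator (Function.uncurry fun z s =>
      domega α (z - s) * inner ℝ ((B z - B s) (u s)) w)) (sqMeasure t) := by
  obtain ⟨C, hC⟩ := isCompact_Icc.exists_bound_of_continuousOn hu
  refine integrable_tri_of_abs_le hα (C := (1 - α) / Real.Gamma α * K * C * ‖w‖) ht.1.le ?_ ?_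
  · have hfst : MapsTo Prod.fst (tri ∩ Ioc 0 t ×ˢ Ioc 0 t) (Icc 0 T) := fun x hx =>
      ⟨hx.2.1.1.le, hx.2.1.2.trans ht.2⟩
    have hsnd : MapsTo Prod.snd (tri ∩ Ioc 0 t ×ˢ Ioc 0 t) (Icc 0 T) := fun x hx =>
      ⟨hx.2.2.1.le, hx.2.2.2.trans ht.2⟩
    refine ContinuousOn.mul ?_ (ContinuousOn.inner ?_ continuousOn_const)
    · exact continuousOn_domega.comp (by fun_prop) fun x hx =>
        sub_pos.2 (show x.2 < x.1 from hx.1)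
    · exact ((hB.continuousOn.comp continuousOn_fst hfst).sub
        (hB.continuousOn.comp continuousOn_snd hsnd)).clm_apply (hu.comp continuousOn_snd hsnd)
  · intro z s hs hsz hzt
    have hnorm := norm_domega_smul_le hα hα₁ hB hs.le hsz (hzt.trans ht.2) (u s)
    have hus := hC s ⟨hs.le, hsz.le.trans (hzt.trans ht.2)⟩
    have hc : 0 ≤ (1 - α) / Real.Gamma α * K :=
      mul_nonneg (div_nonneg (sub_nonneg.2 hα₁) (Real.Gamma_pos_of_pos hα).le) K.2
    have hpow : 0 ≤ (z - s) ^ (α - 1) := Real.rpow_nonneg (sub_pos.2 hsz).le _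
    calc |domega α (z - s) * inner ℝ ((B z - B s) (u s)) w|
        = |inner ℝ (domega α (z - s) • (B z - B s) (u s)) w| := by rw [real_inner_smul_left]
      _ ≤ ‖domega α (z - s) • (B z - B s) (u s)‖ * ‖w‖ := abs_real_inner_le_norm _ _
      _ ≤ (1 - α) / Real.Gamma α * K * ((z - s) ^ (α - 1) * C) * ‖w‖ := by
          refine mul_le_mul_of_nonneg_right (hnorm.trans ?_) (norm_nonneg _)
          exact mul_le_mul_of_nonneg_left (mul_le_mul_of_nonneg_left hus hpow) hc
      _ = (1 - α) / Real.Gamma α * K * C * ‖w‖ * (z - s) ^ (α - 1) := by ring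

end

end

/-! ### The lower-order operators -/

section

variable {d : ℕ} {Ω : TopologicalSpace.Opens (Rd d)}

theorem norm_sq_eq (v : H10 Ω) : ‖v‖ ^ 2 = ‖toL2 Ω v‖ ^ 2 + ‖grad Ω v‖ ^ 2 :=
  WithLp.prod_norm_sq_eq_of_L2 (H10incl Ω v)

theorem toL2_injective : Function.Injective (toL2 Ω) :=
  (injective_iff_map_eq_zero _).2 eq_zero_of_toL2_eq_zero

theorem integral_smul_apply_apply {V : Type*} [NormedAddCommGroup V] [NormedSpace ℝ V]
    {A : ℝ → V →L[ℝ] StrongDual ℝ V} {k : ℝ → ℝ} {s t : ℝ}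
    (hk : IntervalIntegrable k volume s t) (hA : ContinuousOn A (uIcc s t)) (v w : V) :
    (∫ z in s..t, k z • A z) v w = ∫ z in s..t, k z * A z v w := by
  have hAv : ContinuousOn (fun z => A z v) (uIcc s t) := hA.clm_apply continuousOn_const
  rw [ContinuousLinearMap.intervalIntegral_apply (hk.smul_continuousOn hA)]
  simp only [smul_apply]
  rw [ContinuousLinearMap.intervalIntegral_apply (hk.smul_continuousOn hAv)]
  rfl

/-- The multiplication `mulScal` restricted to `H¹₀(Ω)`, as a map of the multiplier. -/
def mulH10 (Ω : TopologicalSpace.Opens (Rd d)) : Linf Ω →L[ℝ] H10 Ω →L[ℝ] L2 Ω :=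
  (ContinuousLinearMap.compL ℝ (H10 Ω) (L2 Ω) (L2 Ω)).flip (toL2 Ω) ∘L mulScalL Ω

/-- The lower-order part `v ↦ div (F v) + a v` of the operators in the equation. -/
def lowerOrder (F : W1inf Ω) (a : Linf Ω) : H10 Ω →L[ℝ] L2 Ω := divMul Ω F + mulH10 Ω a

theorem inner_lowerOrder (F : W1inf Ω) (a : Linf Ω) (v w : H10 Ω) :
    inner ℝ (lowerOrder F a v) (toL2 Ω w)
      = -inner ℝ (mulVec (toLinf Ω F) (toL2 Ω v)) (grad Ω w)
        + inner ℝ (mulScal a (toL2 Ω v)) (toL2 Ω w) := by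
  rw [inner_mulVec_grad F v w, neg_neg]
  exact inner_add_left _ _ _

theorem continuousOn_lowerOrder {F : ℝ → W1inf Ω} {a : ℝ → Linf Ω} {s : Set ℝ}
    (hF : ContinuousOn F s) (ha : ContinuousOn a s) :
    ContinuousOn (fun t => lowerOrder (F t) (a t)) s :=
  ((divMul Ω).continuous.comp_continuousOn hF).add ((mulH10 Ω).continuous.comp_continuousOn ha)

theorem hasDerivWithinAt_lowerOrder {F : ℝ → W1inf Ω} {a : ℝ → Linf Ω} {F' : W1inf Ω}
    {a' : Linf Ω} {s : Set ℝ} {t : ℝ} (hF : HasDerivWithinAt F F' s t)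
    (ha : HasDerivWithinAt a a' s t) :
    HasDerivWithinAt (fun t => lowerOrder (F t) (a t)) (lowerOrder F' a') s t :=
  ((divMul Ω).hasFDerivAt.comp_hasDerivWithinAt t hF).add
    ((mulH10 Ω).hasFDerivAt.comp_hasDerivWithinAt t ha)

namespace Coefficients

variable (c : Coefficients Ω) {T α : ℝ}

/-- The form `⟨κ∇v, ∇w⟩`. -/
def diffForm : H10 Ω →ₗ[ℝ] H10 Ω →ₗ[ℝ] ℝ :=
  (innerₗ (L2vec Ω)).compl₁₂ ((mulMat c.κ).toLinearMap ∘ₗ (grad Ω).toLinearMap)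
    (grad Ω).toLinearMap

/-- The lower-order part of `K₁(t)`. -/
def lower₁ (t : ℝ) : H10 Ω →L[ℝ] L2 Ω := lowerOrder (c.F t) (c.a t)

/-- The time derivative of the lower-order part of `K₁(t)`. -/
def lower₁' (T t : ℝ) : H10 Ω →L[ℝ] L2 Ω :=
  lowerOrder (derivWithin c.F (Icc 0 T) t) (derivWithin c.a (Icc 0 T) t)

/-- The operator `K₂(t)`, with values in `L₂(Ω)`. -/
def lower₂ (t : ℝ) : H10 Ω →L[ℝ] L2 Ω := lowerOrder (c.G t) (c.b t)

theorem K₁_apply (t : ℝ) (v w : H10 Ω) :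
    c.K₁ t v w = c.diffForm v w + inner ℝ (c.lower₁ t v) (toL2 Ω w) := by
  rw [lower₁, inner_lowerOrder, ← add_assoc, ← sub_eq_add_neg]
  rfl

theorem K₂_apply (t : ℝ) (v w : H10 Ω) :
    c.K₂ t (toL2 Ω v) w = inner ℝ (c.lower₂ t v) (toL2 Ω w) := by
  rw [lower₂, inner_lowerOrder, neg_add_eq_sub]
  rfl

theorem K₁'_apply (t : ℝ) (v w : H10 Ω) :
    c.K₁' T t v w = inner ℝ (c.lower₁' T t v) (toL2 Ω w) :=
  (inner_lowerOrder _ _ _ _).symm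

theorem K₁'_eq (t : ℝ) : c.K₁' T t = pairL2 Ω ∘L c.lower₁' T t := by
  ext v w
  exact c.K₁'_apply t v w

variable {c}

theorem hasDerivWithinAt_lower₁ (hF : DifferentiableOn ℝ c.F (Icc 0 T))
    (ha : DifferentiableOn ℝ c.a (Icc 0 T)) {t : ℝ} (ht : t ∈ Icc 0 T) :
    HasDerivWithinAt c.lower₁ (c.lower₁' T t) (Icc 0 T) t :=
  hasDerivWithinAt_lowerOrder (hF t ht).hasDerivWithinAt (ha t ht).hasDerivWithinAt

theorem continuousOn_lower₁' (hT : 0 < T) (hF : ContDiffOn ℝ 1 c.F (Icc 0 T))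
    (ha : ContDiffOn ℝ 1 c.a (Icc 0 T)) : ContinuousOn (c.lower₁' T) (Icc 0 T) :=
  continuousOn_lowerOrder (hF.continuousOn_derivWithin (uniqueDiffOn_Icc hT) le_rfl)
    (ha.continuousOn_derivWithin (uniqueDiffOn_Icc hT) le_rfl)

theorem exists_lipschitzOnWith_lower₁ (hT : 0 < T) (hF : ContDiffOn ℝ 1 c.F (Icc 0 T))
    (ha : ContDiffOn ℝ 1 c.a (Icc 0 T)) : ∃ K, LipschitzOnWith K c.lower₁ (Icc 0 T) := by
  obtain ⟨K, hK⟩ := isCompact_Icc.exists_bound_of_continuousOn (continuousOn_lower₁' hT hF ha)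
  refine ⟨K.toNNReal, (convex_Icc 0 T).lipschitzOnWith_of_nnnorm_hasDerivWithin_le
    (fun t ht => hasDerivWithinAt_lower₁ (hF.differentiableOn one_ne_zero)
      (ha.differentiableOn one_ne_zero) ht) fun t ht => ?_⟩
  exact NNReal.coe_le_coe.1 ((hK t ht).trans (Real.le_coe_toNNReal K))

theorem integral_smul_K₁'_apply (hα : 0 < α) (hT : 0 < T) (hF : ContDiffOn ℝ 1 c.F (Icc 0 T))
    (ha : ContDiffOn ℝ 1 c.a (Icc 0 T)) {s t : ℝ} (hst : uIcc s t ⊆ Icc 0 T) (v w : H10 Ω) :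
    (∫ z in s..t, omega α (z - s) • c.K₁' T z) v w
      = ∫ z in s..t, omega α (z - s) * inner ℝ (c.lower₁' T z v) (toL2 Ω w) := by
  have hK₁' : ContinuousOn (c.K₁' T) (uIcc s t) := by
    rw [show c.K₁' T = _ from funext fun z => c.K₁'_eq z]
    exact continuousOn_const.clm_comp ((continuousOn_lower₁' hT hF ha).mono hst)
  simp only [integral_smul_apply_apply (intervalIntegrable_omega_sub hα s t) hK₁', K₁'_apply]

/-- Integration by parts in time replaces the derivative in the memory integral by a difference. -/
theorem K_apply (hα : 0 < α) (hα₁ : α ≤ 1) (hF : ContDiffOn ℝ 1 c.F (Icc 0 T))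
    (ha : ContDiffOn ℝ 1 c.a (Icc 0 T)) {s t : ℝ} (hs : 0 ≤ s) (hst : s < t) (ht : t ≤ T)
    (v w : H10 Ω) :
    c.K T α t s v w = omega α (t - s) * (c.diffForm v w + inner ℝ (c.lower₁ s v) (toL2 Ω w))
      + inner ℝ (c.lower₂ s v) (toL2 Ω w)
      + ∫ z in s..t, domega α (z - s) * inner ℝ ((c.lower₁ z - c.lower₁ s) v) (toL2 Ω w) := by
  have hT : 0 < T := (hs.trans_lt hst).trans_le ht
  have hsub : Icc s t ⊆ Icc 0 T := Icc_subset_Icc hs ht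
  set ℓ : (H10 Ω →L[ℝ] L2 Ω) →L[ℝ] ℝ :=
    innerSL ℝ (toL2 Ω w) ∘L ContinuousLinearMap.apply ℝ (L2 Ω) v
  have hℓ (A : H10 Ω →L[ℝ] L2 Ω) : ℓ A = inner ℝ (A v) (toL2 Ω w) :=
    real_inner_comm (A v) (toL2 Ω w)
  have hparts := omega_mul_sub_integral hα hα₁ (β := fun z => ℓ (c.lower₁ z))
    (β' := fun z => ℓ (c.lower₁' T z)) hst.le
    (fun z hz => (ℓ.hasFDerivAt.comp_hasDerivWithinAt z (hasDerivWithinAt_lower₁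
      (hF.differentiableOn one_ne_zero) (ha.differentiableOn one_ne_zero) (hsub hz))).mono hsub)
    (ℓ.continuous.comp_continuousOn ((continuousOn_lower₁' hT hF ha).mono hsub))
  simp only [hℓ, ← inner_sub_left, ← sub_apply] at hparts
  have hK : c.K T α t s v w = omega α (t - s) * c.K₁ t v w + c.K₂ s (toL2 Ω v) w
      - (∫ z in s..t, omega α (z - s) • c.K₁' T z) v w := rfl
  rw [hK, K₁_apply, K₂_apply,
    integral_smul_K₁'_apply hα hT hF ha ((uIcc_of_le hst.le).trans_subset hsub)]
  linear_combination hparts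

end Coefficients

end

/-! ### The weak form of the Galerkin equation -/

section

open scoped NNReal

variable {V H : Type*} [NormedAddCommGroup V] [NormedSpace ℝ V] [NormedAddCommGroup H]
  [InnerProductSpace ℝ H]

theorem intervalIntegrable_of_forall_inner [FiniteDimensional ℝ V] {ι : V →ₗ[ℝ] H}
    (hι : Function.Injective ι) {F : ℝ → V} {a b : ℝ}
    (hF : ∀ w, IntervalIntegrable (fun s => inner ℝ (ι (F s)) (ι w)) volume a b) :
    IntervalIntegrable F volume a b := by
  obtain ⟨n, e, _, he⟩ := exists_isEigenbasis ι hι 0 fun _ _ => rfl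
  have hsum : F = ∑ j, fun s => inner ℝ (ι (F s)) (ι (e j)) • e j := by
    ext1 s
    rw [Finset.sum_apply]
    exact he.eq_sum (F s)
  rw [hsum]
  exact IntervalIntegrable.sum _ fun j _ => (hF (e j)).smul_continuousOn continuousOn_const

variable [CompleteSpace H] {B : ℝ → V →L[ℝ] H} {u : ℝ → V} {α T : ℝ} {K : ℝ≥0}

theorem intervalIntegrable_inner_memTerm (hα : 0 < α) (hα₁ : α ≤ 1)
    (hB : LipschitzOnWith K B (Icc 0 T)) (hu : ContinuousOn u (Icc 0 T)) {t : ℝ}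
    (ht : t ∈ Ioc 0 T) (w : H) :
    IntervalIntegrable (fun z => inner ℝ (memTerm α B u z) w) volume 0 t := by
  refine (intervalIntegrable_tri_fst ht.1.le
    (integrable_tri_memTerm hα hα₁ hB hu ht w)).congr fun z hz => ?_
  rw [uIoc_of_le ht.1.le] at hz
  exact (inner_memTerm hα hα₁ hB hu ⟨hz.1, hz.2.trans ht.2⟩ w).symm

theorem integral_inner_memTerm (hα : 0 < α) (hα₁ : α ≤ 1)
    (hB : LipschitzOnWith K B (Icc 0 T)) (hu : ContinuousOn u (Icc 0 T)) {t : ℝ}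
    (ht : t ∈ Ioc 0 T) (w : H) :
    ∫ z in (0 : ℝ)..t, inner ℝ (memTerm α B u z) w
      = ∫ s in (0 : ℝ)..t, ∫ z in s..t, domega α (z - s) * inner ℝ ((B z - B s) (u s)) w := by
  rw [← integral_tri_swap ht.1.le (integrable_tri_memTerm hα hα₁ hB hu ht w),
    intervalIntegral.integral_of_le ht.1.le, intervalIntegral.integral_of_le ht.1.le]
  exact setIntegral_congr_fun measurableSet_Ioc fun z hz =>
    inner_memTerm hα hα₁ hB hu ⟨hz.1, hz.2.trans ht.2⟩ w

end

section

variable {d : ℕ} {Ω : TopologicalSpace.Opens (Rd d)} {c : Coefficients Ω} {T α t : ℝ}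

theorem intervalIntegrable_and_integral_K_apply (hα : 0 < α) (hα₁ : α ≤ 1)
    (hF : ContDiffOn ℝ 1 c.F (Icc 0 T)) (ha : ContDiffOn ℝ 1 c.a (Icc 0 T))
    (hG : ContinuousOn c.G (Icc 0 T)) (hb : ContinuousOn c.b (Icc 0 T)) {u : ℝ → H10 Ω}
    (hu : ContinuousOn u (Icc 0 T)) (ht : t ∈ Ioc 0 T) (w : H10 Ω) :
    IntervalIntegrable (fun s => c.K T α t s (u s) w) volume 0 t ∧
    ∫ s in (0 : ℝ)..t, c.K T α t s (u s) w
      = vconv (omega α) (fun s => c.diffForm (u s) w) t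
        + vconv (omega α) (fun s => inner ℝ (c.lower₁ s (u s)) (toL2 Ω w)) t
        + ∫ s in (0 : ℝ)..t, (inner ℝ (c.lower₂ s (u s)) (toL2 Ω w)
          + inner ℝ (memTerm α c.lower₁ u s) (toL2 Ω w)) := by
  obtain ⟨K, hLip⟩ := Coefficients.exists_lipschitzOnWith_lower₁ (ht.1.trans_le ht.2) hF ha
  have hsub : uIcc 0 t ⊆ Icc 0 T := by
    rw [uIcc_of_le ht.1.le]
    exact Icc_subset_Icc_right ht.2
  have hdiff : ContinuousOn (fun s => c.diffForm (u s) w) (uIcc 0 t) :=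
    ContinuousOn.inner (𝕜 := ℝ) ((mulMat c.κ ∘L grad Ω).continuous.comp_continuousOn (hu.mono hsub))
      continuousOn_const
  have hlow₁ : ContinuousOn (fun s => inner ℝ (c.lower₁ s (u s)) (toL2 Ω w)) (uIcc 0 t) :=
    ((hLip.continuousOn.clm_apply hu).inner continuousOn_const).mono hsub
  have hlow₂ : ContinuousOn (fun s => inner ℝ (c.lower₂ s (u s)) (toL2 Ω w)) (uIcc 0 t) :=
    (((continuousOn_lowerOrder hG hb).clm_apply hu).inner continuousOn_const).mono hsub
  have hω := intervalIntegrable_omega hα 0 t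
  have hi₀ := intervalIntegrable_vconv_right hω hdiff
  have hi₁ := intervalIntegrable_vconv_right hω hlow₁
  have hi₂ := hlow₂.intervalIntegrable (μ := volume)
  have hi₃ := intervalIntegrable_tri_snd ht.1.le
    (integrable_tri_memTerm hα hα₁ hLip hu ht (toL2 Ω w))
  have hK : EqOn (fun s => omega α (t - s) * c.diffForm (u s) w
      + omega α (t - s) * inner ℝ (c.lower₁ s (u s)) (toL2 Ω w)
      + inner ℝ (c.lower₂ s (u s)) (toL2 Ω w)
      + ∫ z in s..t, domega α (z - s) * inner ℝ ((c.lower₁ z - c.lower₁ s) (u s)) (toL2 Ω w))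
      (fun s => c.K T α t s (u s) w) (Ioo 0 t) := fun s hs => by
    simp only [Coefficients.K_apply hα hα₁ hF ha hs.1.le hs.2 ht.2, mul_add]
  refine ⟨(((hi₀.add hi₁).add hi₂).add hi₃).congr_uIoo (uIoo_of_le ht.1.le ▸ hK), ?_⟩
  rw [← intervalIntegral.integral_congr_Ioo_of_le ht.1.le hK,
    intervalIntegral.integral_add ((hi₀.add hi₁).add hi₂) hi₃,
    intervalIntegral.integral_add (hi₀.add hi₁) hi₂, intervalIntegral.integral_add hi₀ hi₁,
    intervalIntegral.integral_add hi₂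
      (intervalIntegrable_inner_memTerm hα hα₁ hLip hu ht (toL2 Ω w)),
    integral_inner_memTerm hα hα₁ hLip hu ht (toL2 Ω w), add_assoc]
  rfl

variable {u₀ : L2 Ω} {g : ℝ → L2 Ω} {X : Submodule ℝ (H10 Ω)} [FiniteDimensional ℝ X]

theorem inner_fX (hg : IntervalIntegrable g volume 0 t) (w : X) :
    inner ℝ (toL2 Ω (fX u₀ g X t)) (toL2 Ω w)
      = inner ℝ u₀ (toL2 Ω w) + ∫ s in (0 : ℝ)..t, inner ℝ (g s) (toL2 Ω w) := by
  have hint := (innerSL ℝ (toL2 Ω w)).intervalIntegral_comp_comm hg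
  simp only [innerSL_apply_apply, real_inner_comm] at hint
  rw [hint, ← inner_add_left]
  exact inner_proj X (pairL2 Ω (source u₀ g t)) w

theorem inner_integral_KX {u : ℝ → X}
    (hK : ∀ w : X, IntervalIntegrable (fun s => c.K T α t s (u s) w) volume 0 t) (w : X) :
    inner ℝ (toL2 Ω (∫ s in (0 : ℝ)..t, KX c T α X t s (u s) : X)) (toL2 Ω w)
      = ∫ s in (0 : ℝ)..t, c.K T α t s (u s) w := by
  have hKX (w : X) : (fun s => inner ℝ (toL2 Ω (KX c T α X t s (u s))) (toL2 Ω w))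
      = fun s => c.K T α t s (u s) w := funext fun s => inner_proj X (c.K T α t s (u s)) w
  have hint : IntervalIntegrable (fun s => KX c T α X t s (u s)) volume 0 t :=
    intervalIntegrable_of_forall_inner (ι := (toL2 Ω).toLinearMap ∘ₗ X.subtype)
      (toL2_injective.comp Subtype.val_injective) fun w => (hKX w).symm ▸ hK w
  have hcomm := (innerSL ℝ (toL2 Ω w) ∘L toL2 Ω ∘L X.subtypeL).intervalIntegral_comp_comm hint
  rw [← hKX w, real_inner_comm (toL2 Ω w)]
  refine hcomm.symm.trans (intervalIntegral.integral_congr fun s _ => ?_)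
  exact real_inner_comm (toL2 Ω (KX c T α X t s (u s))) (toL2 Ω w)

theorem IsGalerkinSolution.weak_equation (hα : 0 < α) (hα₁ : α ≤ 1)
    (hF : ContDiffOn ℝ 1 c.F (Icc 0 T)) (ha : ContDiffOn ℝ 1 c.a (Icc 0 T))
    (hG : ContinuousOn c.G (Icc 0 T)) (hb : ContinuousOn c.b (Icc 0 T)) {u : ℝ → X}
    (hu : IsGalerkinSolution c T α u₀ g X u) (ht : t ∈ Ioc 0 T)
    (hg : IntervalIntegrable g volume 0 t) (w : X) :
    inner ℝ (toL2 Ω (u t)) (toL2 Ω w) + vconv (omega α) (fun s => c.diffForm (u s) w) t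
        + vconv (omega α) (fun s => inner ℝ (c.lower₁ s (u s)) (toL2 Ω w)) t
        + ∫ s in (0 : ℝ)..t, (inner ℝ (c.lower₂ s (u s)) (toL2 Ω w)
          + inner ℝ (memTerm α c.lower₁ (fun s => (u s : H10 Ω)) s) (toL2 Ω w))
      = inner ℝ u₀ (toL2 Ω w) + ∫ s in (0 : ℝ)..t, inner ℝ (g s) (toL2 Ω w) := by
  have huc : ContinuousOn (fun s => (u s : H10 Ω)) (Icc 0 T) :=
    continuous_subtype_val.comp_continuousOn hu.continuousOn
  have hK (w : X) :=
    intervalIntegrable_and_integral_K_apply hα hα₁ hF ha hG hb huc ht (w : H10 Ω)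
  have heq := congrArg (fun v : X => inner ℝ (toL2 Ω v) (toL2 Ω w))
    (hu.equation t ⟨ht.1.le, ht.2⟩)
  simp only [Submodule.coe_add, map_add, inner_add_left] at heq
  rw [inner_integral_KX (fun w => (hK w).1), inner_fX hg] at heq
  linear_combination heq - (hK w).2

end

/-! ### Reduction to a Volterra system -/

theorem intervalIntegrable_of_norm_le_rpow {E : Type*} [NormedAddCommGroup E] {T η M : ℝ}
    (hT : 0 ≤ T) (hη : 0 < η) {g : ℝ → E} (hg : AEStronglyMeasurable g (volume.restrict (Ioc 0 T)))
    (hgM : ∀ t ∈ Ioc 0 T, ‖g t‖ ≤ M * t ^ (η - 1)) : IntervalIntegrable g volume 0 T := by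
  have hdom := (intervalIntegrable_rpow_sub_one hη 0 T).const_mul M
  rw [intervalIntegrable_iff_integrableOn_Ioc_of_le hT] at hdom ⊢
  exact hdom.mono' hg ((ae_restrict_mem measurableSet_Ioc).mono hgM)

theorem intervalIntegrable_inner_const {H : Type*} [NormedAddCommGroup H]
    [InnerProductSpace ℝ H] {g : ℝ → H} {a b : ℝ} (hg : IntervalIntegrable g volume a b) (φ : H) :
    IntervalIntegrable (fun s => inner ℝ (g s) φ) volume a b :=
  ⟨hg.1.inner_const φ, hg.2.inner_const φ⟩

section

open scoped NNReal

variable {V H : Type*} [NormedAddCommGroup V] [NormedSpace ℝ V] [NormedAddCommGroup H]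
  [NormedSpace ℝ H] {B : ℝ → V →L[ℝ] H} {u : ℝ → V} {α T : ℝ} {K : ℝ≥0}

theorem norm_add_memTerm_le (hα : 0 < α) (hα₁ : α ≤ 1) (hB : LipschitzOnWith K B (Icc 0 T))
    (hu : ContinuousOn u (Icc 0 T)) {A : V →L[ℝ] H} {L z : ℝ} (hA : ‖A‖ ≤ L)
    (hKL : (1 - α) / Real.Gamma α * K ≤ L) (hz : z ∈ Ioc 0 T) :
    ‖A (u z) + memTerm α B u z‖
      ≤ L * (‖u z‖ + vconv (fun x => x ^ (α - 1)) (fun s => ‖u s‖) z) := by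
  have hconv : 0 ≤ vconv (fun x => x ^ (α - 1)) (fun s => ‖u s‖) z :=
    intervalIntegral.integral_nonneg hz.1.le fun s hs =>
      mul_nonneg (Real.rpow_nonneg (sub_nonneg.2 hs.2) _) (norm_nonneg _)
  rw [mul_add]
  exact norm_add_le_of_le (A.le_of_opNorm_le hA _)
    ((norm_memTerm_le hα hα₁ hB hu hz).trans (mul_le_mul_of_nonneg_right hKL hconv))

end

variable {d : ℕ} {Ω : TopologicalSpace.Opens (Rd d)}

namespace Coefficients

open scoped NNReal

variable {c : Coefficients Ω}

theorem Elliptic.diffForm_comm (hκ : c.Elliptic) (v w : H10 Ω) :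
    c.diffForm v w = c.diffForm w v :=
  let ⟨_, _, h⟩ := hκ
  inner_mulMat_comm (h.mono fun _ hx => hx.1) _ _

theorem Elliptic.exists_coercive (hκ : c.Elliptic) :
    ∃ c₀ > 0, ∀ v, c₀ * ‖grad Ω v‖ ^ 2 ≤ c.diffForm v v :=
  let ⟨c₀, hc₀, h⟩ := hκ
  ⟨c₀, hc₀, fun v => mul_norm_sq_le_inner_mulMat h (grad Ω v)⟩

theorem norm_le_sqrt_mul {c₀ : ℝ} (hc₀ : 0 < c₀)
    (hcoer : ∀ v, c₀ * ‖grad Ω v‖ ^ 2 ≤ c.diffForm v v) (v : H10 Ω) :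
    ‖v‖ ≤ √(1 + c₀⁻¹) * √(‖toL2 Ω v‖ ^ 2 + c.diffForm v v) := by
  have hgrad : ‖grad Ω v‖ ^ 2 ≤ c₀⁻¹ * c.diffForm v v := (le_inv_mul_iff₀ hc₀).2 (hcoer v)
  have hform : 0 ≤ c.diffForm v v := le_trans (by positivity) (hcoer v)
  have hinv : 0 ≤ c₀⁻¹ * ‖toL2 Ω v‖ ^ 2 := by positivity
  rw [← Real.sqrt_mul (by positivity)]
  refine Real.le_sqrt_of_sq_le ?_
  rw [norm_sq_eq]
  linarith

/-- Bounds, by the constant `L`, for the lower-order operators and for the kernel of the memory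
term, whose size is governed by the Lipschitz constant `K` of `c.lower₁`. -/
structure LowerOrderBound (c : Coefficients Ω) (T α L : ℝ) (K : ℝ≥0) : Prop where
  lipschitz : LipschitzOnWith K c.lower₁ (Icc 0 T)
  memory_le : (1 - α) / Real.Gamma α * K ≤ L
  norm_lower₁_le : ∀ t ∈ Icc 0 T, ‖c.lower₁ t‖ ≤ L
  norm_lower₂_le : ∀ t ∈ Icc 0 T, ‖c.lower₂ t‖ ≤ L

theorem exists_lowerOrderBound {T : ℝ} (hT : 0 < T) (α : ℝ) (hF : ContDiffOn ℝ 1 c.F (Icc 0 T))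
    (ha : ContDiffOn ℝ 1 c.a (Icc 0 T)) (hG : ContinuousOn c.G (Icc 0 T))
    (hb : ContinuousOn c.b (Icc 0 T)) : ∃ L K, 0 ≤ L ∧ c.LowerOrderBound T α L K := by
  obtain ⟨K, hK⟩ := exists_lipschitzOnWith_lower₁ hT hF ha
  obtain ⟨L₁, hL₁⟩ := isCompact_Icc.exists_bound_of_continuousOn hK.continuousOn
  obtain ⟨L₂, hL₂⟩ := isCompact_Icc.exists_bound_of_continuousOn
    (f := c.lower₂) (continuousOn_lowerOrder hG hb)
  set L := max ((1 - α) / Real.Gamma α * K) (max L₁ L₂)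
  have hL₁L : L₁ ≤ L := (le_max_left _ _).trans (le_max_right _ _)
  have hL₂L : L₂ ≤ L := (le_max_right _ _).trans (le_max_right _ _)
  exact ⟨L, K, (norm_nonneg _).trans ((hL₁ 0 (left_mem_Icc.2 hT.le)).trans hL₁L), hK,
    le_max_left _ _, fun t ht => (hL₁ t ht).trans hL₁L, fun t ht => (hL₂ t ht).trans hL₂L⟩

end Coefficients

namespace IsGalerkinSolution

open scoped NNReal

variable {c : Coefficients Ω} {T α : ℝ} {u₀ : L2 Ω} {g : ℝ → L2 Ω} {X : Submodule ℝ (H10 Ω)}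
  [FiniteDimensional ℝ X] {u : ℝ → X} {n : ℕ} {e : Fin n → X} {lam : Fin n → ℝ}

theorem continuousOn_coe (hu : IsGalerkinSolution c T α u₀ g X u) :
    ContinuousOn (fun s => (u s : H10 Ω)) (Icc 0 T) :=
  continuous_subtype_val.comp_continuousOn hu.continuousOn

theorem intervalIntegrable_inner_lower₂_add_memTerm (hα : 0 < α) (hα₁ : α ≤ 1) (hT : 0 < T)
    {K : ℝ≥0} (hK : LipschitzOnWith K c.lower₁ (Icc 0 T)) (hG : ContinuousOn c.G (Icc 0 T))
    (hb : ContinuousOn c.b (Icc 0 T)) (hu : IsGalerkinSolution c T α u₀ g X u) (φ : L2 Ω) :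
    IntervalIntegrable (fun s => inner ℝ (c.lower₂ s (u s)
      + memTerm α c.lower₁ (fun s => (u s : H10 Ω)) s) φ) volume 0 T := by
  have hlow : ContinuousOn (fun s => inner ℝ (c.lower₂ s (u s)) φ) (uIcc 0 T) := by
    rw [uIcc_of_le hT.le]
    exact ((continuousOn_lowerOrder hG hb).clm_apply hu.continuousOn_coe).inner continuousOn_const
  simp only [inner_add_left]
  exact hlow.intervalIntegrable.add
    (intervalIntegrable_inner_memTerm hα hα₁ hK hu.continuousOn_coe (right_mem_Ioc.2 hT) φ)

theorem coordinate_equation (hα : 0 < α) (hα₁ : α ≤ 1) (hκ : c.Elliptic)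
    (hF : ContDiffOn ℝ 1 c.F (Icc 0 T)) (ha : ContDiffOn ℝ 1 c.a (Icc 0 T))
    (hG : ContinuousOn c.G (Icc 0 T)) (hb : ContinuousOn c.b (Icc 0 T))
    (hu : IsGalerkinSolution c T α u₀ g X u)
    (he : IsEigenbasis ((toL2 Ω).toLinearMap ∘ₗ X.subtype)
      (c.diffForm.compl₁₂ X.subtype X.subtype) e lam)
    (hg : IntervalIntegrable g volume 0 T) {t : ℝ} (ht : t ∈ Ioc 0 T) (j : Fin n) :
    inner ℝ (toL2 Ω (u t)) (toL2 Ω (e j))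
        + lam j * vconv (omega α) (fun s => inner ℝ (toL2 Ω (u s)) (toL2 Ω (e j))) t
      = inner ℝ u₀ (toL2 Ω (e j))
        + vconv (omega α) (fun s => inner ℝ (-c.lower₁ s (u s)) (toL2 Ω (e j))) t
        + vconv (fun _ => 1) (fun s => inner ℝ (g s) (toL2 Ω (e j))
          + inner ℝ (-(c.lower₂ s (u s) + memTerm α c.lower₁ (fun s => (u s : H10 Ω)) s))
            (toL2 Ω (e j))) t := by
  obtain ⟨K, hK⟩ := Coefficients.exists_lipschitzOnWith_lower₁ (ht.1.trans_le ht.2) hF ha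
  have hdiff (v : X) : c.diffForm v (e j) = lam j * inner ℝ (toL2 Ω v) (toL2 Ω (e j)) := by
    rw [hκ.diffForm_comm, real_inner_comm]
    exact he.apply_left j v
  have hgt := intervalIntegrable_of_mem_Ioc hg ht
  have hψj := intervalIntegrable_of_mem_Ioc
    (hu.intervalIntegrable_inner_lower₂_add_memTerm hα hα₁ (ht.1.trans_le ht.2) hK hG hb
      (toL2 Ω (e j))) ht
  have hneg : vconv (omega α) (fun s => inner ℝ (-c.lower₁ s (u s)) (toL2 Ω (e j))) t
      = -vconv (omega α) (fun s => inner ℝ (c.lower₁ s (u s)) (toL2 Ω (e j))) t := by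
    simp only [vconv, inner_neg_left, mul_neg, intervalIntegral.integral_neg]
  have hweak := hu.weak_equation hα hα₁ hF ha hG hb ht hgt (e j)
  simp only [hdiff, vconv_const_mul_right, ← inner_add_left] at hweak
  rw [hneg, vconv_one_left]
  simp only [inner_neg_left, ← sub_eq_add_neg]
  rw [intervalIntegral.integral_sub (intervalIntegrable_inner_const hgt _) hψj]
  linarith

theorem volterraSystem {η M L c₀ : ℝ} {K : ℝ≥0} (hα : 0 < α) (hα₁ : α ≤ 1) (hT : 0 < T)
    (hη : 0 < η) (hκ : c.Elliptic) (hF : ContDiffOn ℝ 1 c.F (Icc 0 T))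
    (ha : ContDiffOn ℝ 1 c.a (Icc 0 T)) (hG : ContinuousOn c.G (Icc 0 T))
    (hb : ContinuousOn c.b (Icc 0 T)) (hc₀ : 0 < c₀)
    (hcoer : ∀ v, c₀ * ‖grad Ω v‖ ^ 2 ≤ c.diffForm v v) (hL : c.LowerOrderBound T α L K)
    (hu : IsGalerkinSolution c T α u₀ g X u)
    (hg : AEStronglyMeasurable g (volume.restrict (Ioc 0 T)))
    (hgM : ∀ t ∈ Ioc 0 T, ‖g t‖ ≤ M * t ^ (η - 1))
    (he : IsEigenbasis ((toL2 Ω).toLinearMap ∘ₗ X.subtype)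
      (c.diffForm.compl₁₂ X.subtype X.subtype) e lam) :
    VolterraSystem T α η √(1 + c₀⁻¹) L M (fun j => toL2 Ω (e j)) lam
      (fun j s => inner ℝ (toL2 Ω (u s)) (toL2 Ω (e j))) (fun t => ‖u t‖) u₀
      (fun s => -c.lower₁ s (u s))
      (fun s => -(c.lower₂ s (u s) + memTerm α c.lower₁ (fun s => (u s : H10 Ω)) s)) g where
  orthonormal := he.orthonormal
  lam_nonneg := he.lam_nonneg fun v => le_trans (by positivity) (hcoer v)
  continuousOn_y _ :=
    ((toL2 Ω).continuous.comp_continuousOn hu.continuousOn_coe).inner continuousOn_const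
  continuousOn_N := hu.continuousOn.norm
  N_nonneg _ _ := norm_nonneg _
  N_le t _ := (c.norm_le_sqrt_mul hc₀ hcoer (u t)).trans_eq <| congrArg (√(1 + c₀⁻¹) * √·)
    (he.sum_sqrt_mul_sq (fun v => le_trans (by positivity) (hcoer v)) (u t)).symm
  continuousOn_f := (hL.lipschitz.continuousOn.clm_apply hu.continuousOn_coe).neg
  norm_f_le s hs := (norm_neg _).trans_le
    ((c.lower₁ s).le_of_opNorm_le (hL.norm_lower₁_le s ⟨hs.1.le, hs.2⟩) _)
  norm_ψ_le s hs := (norm_neg _).trans_le (norm_add_memTerm_le hα hα₁ hL.lipschitz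
    hu.continuousOn_coe (hL.norm_lower₂_le s ⟨hs.1.le, hs.2⟩) hL.memory_le hs)
  intervalIntegrable_ψ j := by
    simp only [inner_neg_left]
    exact (hu.intervalIntegrable_inner_lower₂_add_memTerm hα hα₁ hT hL.lipschitz hG hb _).neg
  norm_g_le := hgM
  intervalIntegrable_g _ :=
    intervalIntegrable_inner_const (intervalIntegrable_of_norm_le_rpow hT.le hη hg hgM) _
  equation j t ht :=
    hu.coordinate_equation hα hα₁ hκ hF ha hG hb he
      (intervalIntegrable_of_norm_le_rpow hT.le hη hg hgM) ht j

end IsGalerkinSolution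

/-! ### The stability estimate -/

section

variable {d : ℕ} {Ω : TopologicalSpace.Opens (Rd d)}

theorem norm_toL2_proj_pairL2_le (X : Submodule ℝ (H10 Ω)) [FiniteDimensional ℝ X] (v : L2 Ω) :
    ‖toL2 Ω (proj X (pairL2 Ω v))‖ ≤ ‖v‖ := by
  set p : L2 Ω := toL2 Ω (proj X (pairL2 Ω v))
  have hp : inner ℝ p p = inner ℝ v p := inner_proj X (pairL2 Ω v) (proj X (pairL2 Ω v))
  have hsq : ‖p‖ * ‖p‖ ≤ ‖v‖ * ‖p‖ := by
    rw [← real_inner_self_eq_norm_mul_norm, hp]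
    exact real_inner_le_norm v p
  rcases (norm_nonneg p).eq_or_lt with h | h
  · exact h ▸ norm_nonneg v
  · exact le_of_mul_le_mul_right hsq h

theorem IsGalerkinSolution.norm_toL2_zero_le {c : Coefficients Ω} {T α : ℝ} {u₀ : L2 Ω}
    {g : ℝ → L2 Ω} {X : Submodule ℝ (H10 Ω)} [FiniteDimensional ℝ X] {u : ℝ → X} (hT : 0 ≤ T)
    (hu : IsGalerkinSolution c T α u₀ g X u) : ‖toL2 Ω (u 0)‖ ≤ ‖u₀‖ := by
  have h := hu.equation 0 (left_mem_Icc.2 hT)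
  rw [intervalIntegral.integral_same, add_zero, fX, source, intervalIntegral.integral_same,
    add_zero] at h
  exact h ▸ norm_toL2_proj_pairL2_le X u₀

theorem norm_sq_add_rpow_mul_norm_grad_sq_le {t α A B C : ℝ} (ht : 0 ≤ t) {v : H10 Ω}
    (hv : ‖toL2 Ω v‖ ≤ C * (A + B)) (hv' : t ^ (α / 2) * ‖v‖ ≤ C * (A + B)) :
    ‖toL2 Ω v‖ ^ 2 + t ^ α * ‖grad Ω v‖ ^ 2 ≤ 4 * C ^ 2 * (A ^ 2 + B ^ 2) := by
  have hpow : (t ^ (α / 2)) ^ 2 = t ^ α := by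
    rw [← Real.rpow_mul_natCast ht, Nat.cast_ofNat, div_mul_cancel₀ α two_ne_zero]
  have hgrad : t ^ α * ‖grad Ω v‖ ^ 2 ≤ (t ^ (α / 2) * ‖v‖) ^ 2 := by
    rw [mul_pow, hpow, norm_sq_eq]
    exact mul_le_mul_of_nonneg_left (le_add_of_nonneg_left (sq_nonneg _)) (Real.rpow_nonneg ht _)
  calc ‖toL2 Ω v‖ ^ 2 + t ^ α * ‖grad Ω v‖ ^ 2
      ≤ (C * (A + B)) ^ 2 + (C * (A + B)) ^ 2 :=
        add_le_add (pow_le_pow_left₀ (norm_nonneg _) hv 2) (hgrad.trans (pow_le_pow_left₀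
          (mul_nonneg (Real.rpow_nonneg ht _) (norm_nonneg _)) hv' 2))
    _ = 2 * C ^ 2 * (A + B) ^ 2 := by ring
    _ ≤ 2 * C ^ 2 * (2 * (A ^ 2 + B ^ 2)) :=
        mul_le_mul_of_nonneg_left add_sq_le (by positivity)
    _ = 4 * C ^ 2 * (A ^ 2 + B ^ 2) := by ring

end

end FracADR

end

section

open FracADR

theorem theorem3p3_general {d : ℕ} {Ω : TopologicalSpace.Opens (Rd d)} {T α η : ℝ}
    (hT : 0 < T) (hα : 0 < α) (hα₁ : α ≤ 1) (hη : 0 < η)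
    {c : Coefficients Ω} (hF : ContDiffOn ℝ 1 c.F (Icc 0 T)) (ha : ContDiffOn ℝ 1 c.a (Icc 0 T))
    (hG : ContinuousOn c.G (Icc 0 T)) (hb : ContinuousOn c.b (Icc 0 T)) (hκ : c.Elliptic) :
    ∃ C : ℝ, ∀ (M : ℝ) (u₀ : L2 Ω) (g : ℝ → L2 Ω),
      AEStronglyMeasurable g (volume.restrict (Ioc 0 T)) →
      (∀ t ∈ Ioc 0 T, ‖g t‖ ≤ M * t ^ (η - 1)) →
      ∀ (X : Submodule ℝ (H10 Ω)) [FiniteDimensional ℝ X] (u : ℝ → X),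
        IsGalerkinSolution c T α u₀ g X u →
        ∀ t ∈ Icc 0 T,
          ‖toL2 Ω (u t)‖ ^ 2 + t ^ α * ‖grad Ω (u t)‖ ^ 2
            ≤ C * (‖u₀‖ ^ 2 + M ^ 2 * t ^ (2 * η)) := by
  obtain ⟨c₀, hc₀, hcoer⟩ := hκ.exists_coercive
  obtain ⟨L, K, hL₀, hL⟩ := Coefficients.exists_lowerOrderBound hT α hF ha hG hb
  obtain ⟨C, hbound⟩ := exists_bound_of_volterraSystem (H := L2 Ω) hT.le hα hα₁ hη
    (Real.sqrt_nonneg (1 + c₀⁻¹)) hL₀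
  refine ⟨1 + 4 * C ^ 2, fun M u₀ g hg hgM X _ u hu t ht => ?_⟩
  have hpow : t ^ (2 * η) = (t ^ η) ^ 2 := by
    rw [← Real.rpow_mul_natCast ht.1, Nat.cast_ofNat, mul_comm]
  have hdata : 0 ≤ ‖u₀‖ ^ 2 + (M * t ^ η) ^ 2 := by positivity
  rw [hpow, ← mul_pow]
  rcases ht.1.eq_or_lt with rfl | ht₀
  · have hzero := pow_le_pow_left₀ (norm_nonneg _) (hu.norm_toL2_zero_le hT.le) 2
    rw [Real.zero_rpow hα.ne', zero_mul, add_zero]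
    nlinarith [mul_nonneg (sq_nonneg C) hdata, sq_nonneg (M * (0 : ℝ) ^ η)]
  · obtain ⟨n, e, lam, he⟩ := exists_isEigenbasis ((toL2 Ω).toLinearMap ∘ₗ X.subtype)
      (toL2_injective.comp Subtype.val_injective) (c.diffForm.compl₁₂ X.subtype X.subtype)
      fun v w => hκ.diffForm_comm v w
    obtain ⟨hnorm, hN⟩ := hbound (hu.volterraSystem hα hα₁ hT hη hκ hF ha hG hb hc₀ hcoer hL hg hgM
      he) t ⟨ht₀, ht.2⟩
    have hParseval : ‖toL2 Ω (u t)‖ ^ 2 = ∑ j, inner ℝ (toL2 Ω (u t)) (toL2 Ω (e j)) ^ 2 :=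
      he.norm_sq (u t)
    rw [← hParseval, Real.sqrt_sq (norm_nonneg _)] at hnorm
    exact (norm_sq_add_rpow_mul_norm_grad_sq_le ht.1 hnorm hN).trans
      (mul_le_mul_of_nonneg_right (le_add_of_nonneg_left zero_le_one) hdata)

end

theorem theorem3p3 {d : ℕ} (hd : 1 ≤ d) (Ω : TopologicalSpace.Opens (FracADR.Rd d))
    (hΩ : Bornology.IsBounded (Ω : Set (FracADR.Rd d)))
    (T α η : ℝ) (hT : 0 < T) (hα₀ : 0 < α) (hα₁ : α < 1) (hη : 0 < η)
    (c : FracADR.Coefficients Ω) (hc : c.Regular T) (hκ : c.Elliptic) :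
    ∃ C : ℝ, ∀ (M : ℝ), 0 < M → ∀ (u₀ : FracADR.L2 Ω) (g : ℝ → FracADR.L2 Ω),
      AEStronglyMeasurable g (volume.restrict (Ioc 0 T)) →
      (∀ t ∈ Ioc 0 T, ‖g t‖ ≤ M * t ^ (η - 1)) →
      ∀ (X : Submodule ℝ (FracADR.H10 Ω)) [FiniteDimensional ℝ X] (u : ℝ → X),
        FracADR.IsGalerkinSolution c T α u₀ g X u →
        ∀ t ∈ Icc 0 T,
          ‖FracADR.toL2 Ω (u t)‖ ^ 2 + t ^ α * ‖FracADR.grad Ω (u t)‖ ^ 2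
            ≤ C * (‖u₀‖ ^ 2 + M ^ 2 * t ^ (2 * η)) := by
  obtain ⟨C, hC⟩ := theorem3p3_general hT hα₀ hα₁.le hη (hc.F_mem.of_le one_le_two)
    hc.a_mem hc.G_mem.continuousOn hc.b_mem.continuousOn hκ
  exact ⟨C, fun M _ => hC M⟩
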